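/- **Setting.** Let $\mathfrak g$ be a finite-dimensional simple complex Lie algebra with Cartan subalgebra $\mathfrak h$, root system $R$, a base of simple roots, and an invariant form $(\cdot,\cdot)$ (a nonzero multiple of the Killing form). Let $\nu$ be a diagram automorphism of order $r\in\{2,3\}$: $\nu(\mathfrak h)=\mathfrak h$ and $\nu$ permutes a system of simple root vectors. Put $\mathbf e(x)=e^{2\pi i x}$, $\omega=\mathbf e(1/r)$, $\mathfrak h_m=\{x\in\mathfrak h:\nu x=\omega^m x\}$. Choose root vectors $E_\alpha$ with $(E_\alpha,E_{-\alpha})=1$, an orthonormal basis $\mathfrak e^0_k$ of $\mathfrak h_0$, and, for $0<m<r$, bases $\mathfrak e^m_k$ of $\mathfrak h_m$ with $(\mathfrak e^m_j,\mathfrak e^{r-m}_k)=\delta_{jk}$. For $\alpha\in R$ put $$\mathfrak t^m_\alpha=\sum_{j=0}^{r-1}\omega^{-jm}\nu^j(E_\alpha),\qquad \tilde\alpha=\tfrac1r\sum_{j=0}^{r-1}\alpha\circ\nu^j\in\mathfrak h^*,$$ and let $\mathfrak e_{\tilde\alpha}\in\mathfrak h_0$ be defined by $(\mathfrak e_{\tilde\alpha},x)=\tilde\alpha(x)$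 for $x\in\mathfrak h_0$. Let $\operatorname{Im}\tau>0$, $\Lambda=\mathbb Z+\tau\mathbb Z$, let $\theta(z)=\theta(z|\tau)$ be the odd theta function, $E_1=\theta'/\theta$, $\phi(u,z)=\dfrac{\theta(u+z)\theta'(0)}{\theta(u)\theta(z)}$ and $$g^{(m)}(u,z)=\mathbf e(mz/r)\,\phi(u+m\tau/r,z).$$ The multiplicative spectral parameter is $t=\mathbf e(z/r)$. Let $\varpi\in\mathfrak h$ be arbitrary (for instance $0$ or a fundamental weight, identified with an element of $\mathfrak h$). For $\mathbf u\in\mathfrak h_0$ write $g^{(-m)}_\alpha(z)=g^{(-m)}(-\tilde\alpha(\mathbf u+\varpi),z)$, and let $\partial g^{(-m)}_\alpha(z)$ be the derivative of $g^{(-m)}(-x,z)$ with respect to $x$ at $x=\tilde\alpha(\mathbf u+\varpi)$. Define $r(\mathbf u,z)=\sum_{m=0}^{r-1}r_m(\mathbf u,z)$ with $$r_0=E_1(z)\sum_k\mathfrak e^0_k\otimes\mathfrak e^0_k+\frac1{r^2}\sum_{\alpha\in R}g^{(0)}_\alpha(z)\,\mathfrak t^0_\alpha\otimes\mathfrak t^0_{-\alpha},$$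 $$r_m=g^{(-m)}(0,z)\sum_k\mathfrak e^m_k\otimes\mathfrak e^{r-m}_k+\frac1{r^2}\sum_{\alpha\in R}g^{(-m)}_\alpha(z)\,\mathfrak t^m_\alpha\otimes\mathfrak t^{r-m}_{-\alpha}\quad(0<m<r).$$ (The summands are constant on $\nu$-orbits in $R$.) On the phase space of triples $(\mathbf v,\mathbf u,\mathbf S)$, $\mathbf v=\sum_k v_k\mathfrak e^0_k$, $\mathbf u=\sum_k u_k\mathfrak e^0_k$, $\mathbf S\in\mathfrak g$, let $L(z)=\sum_{m}L_m(z)$ with $$L_0=\sum_k\big(v_k+(\mathbf S,\mathfrak e^0_k)E_1(z)\big)\mathfrak e^0_k+\frac1{r^2}\sum_{\alpha\in R}(\mathbf S,\mathfrak t^0_{-\alpha})\,g^{(0)}_\alpha(z)\,\mathfrak t^0_\alpha,$$ $$L_m=\sum_k(\mathbf S,\mathfrak e^{r-m}_k)\,g^{(-m)}(0,z)\,\mathfrak e^m_k+\frac1{r^2}\sum_{\alpha\in R}(\mathbf S,\mathfrak t^{r-m}_{-\alpha})\,g^{(-m)}_\alpha(z)\,\mathfrak t^m_\alpha\quad(0<m<r).$$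 Call $\mathbf u$ regular if $\tilde\alpha(\mathbf u+\varpi)+m\tau/r\notin\Lambda$ whenever $\alpha\in R$, $0\le m<r$ and $\mathfrak t^m_\alpha\ne0$. **Theorem.** 1. $r_m(\mathbf u,z+1)=\omega^{-m}r_m(\mathbf u,z)$ for $0\le m<r$ (here $z\mapsto z+1$ is $t\mapsto t\omega$). 2. For regular $\mathbf u$ and $z_i-z_j\notin\Lambda$ ($i\ne j$), with $z_{ij}=z_i-z_j$ and $r_{ij}$ the matrix $r(\mathbf u,z_{ij})$ placed in the tensor factors $i,j$, the classical dynamical Yang–Baxter equation holds: $$[r_{12},r_{13}]+[r_{12},r_{23}]+[r_{13},r_{23}]-\frac1{r^2}\sum_{m=0}^{r-1}\sum_{\alpha\in R}\Big(\partial g^{(-m)}_\alpha(z_{12})\,\mathfrak t^m_\alpha\otimes\mathfrak t^{r-m}_{-\alpha}\otimes\mathfrak e_{\tilde\alpha}-\partial g^{(-m)}_\alpha(z_{13})\,\mathfrak t^m_\alpha\otimes\mathfrak e_{\tilde\alpha}\otimes\mathfrak t^{r-m}_{-\alpha}+\partial g^{(-m)}_\alpha(z_{23})\,\mathfrak e_{\tilde\alpha}\otimes\mathfrak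 t^m_\alpha\otimes\mathfrak t^{r-m}_{-\alpha}\Big)=0.$$ 3. Let $(T_a)$ be an orthonormal basis of $\mathfrak g$ and $S_a=(\mathbf S,T_a)$. For the Poisson brackets $\{v_j,u_k\}=\delta_{jk}$, $\{S_a,S_b\}=-(\mathbf S,[T_a,T_b])$, all other brackets of coordinates being zero, at every point with $\mathbf u$ regular and for $z_1,z_2,z_1-z_2\notin\Lambda$, $$\{L(z_1)\otimes1,1\otimes L(z_2)\}=-[L(z_1)\otimes1+1\otimes L(z_2),\,r(\mathbf u,z_1-z_2)]-\frac1{r^2}\sum_{m=0}^{r-1}\sum_{\alpha\in R}\partial g^{(-m)}_\alpha(z_1-z_2)\,\tilde\alpha(\mathbf S^{\mathfrak h}_0)\,\mathfrak t^m_\alpha\otimes\mathfrak t^{r-m}_{-\alpha},$$ where $\mathbf S^{\mathfrak h}_0=\sum_k(\mathbf S,\mathfrak e^0_k)\mathfrak e^0_k$. 4. The last (anomalous) term vanishes on the moment constraints $\mathbf S^{\mathfrak h}_0=0$. 5. The relation in 3 defines these brackets: at a point with $\mathbf u$ regular at which the $\tilde\alpha|_{\mathfrak h_0}$ with $(\mathbf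 S,\mathfrak t^{r-m}_{-\alpha})\neq0$ for some $m$ span $\mathfrak h_0^*$, the matrix of brackets of the coordinates $v_k,u_k,S_a$ is the only matrix for which the relation holds for all admissible $z_1,z_2$. -/

import Mathlib

open scoped TensorProduct

noncomputable section

namespace TwistedCM

/-! ### Elliptic functions, in additive variables `s = e(u)`, `q = e(τ)`, `t = e(z / r)` -/

/-- `e(x) = exp(2πi x)`. -/
def ee (x : ℂ) : ℂ := Complex.exp (2 * Real.pi * Complex.I * x)

/-- The odd theta function
`θ(z|τ) = ∑ₙ exp(πi (n+1/2)² τ + 2πi (n+1/2)(z+1/2))`, written through Mathlib's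
`jacobiTheta₂ z τ = ∑ₙ exp(2πi n z + πi n² τ)`. -/
def oddTheta (τ z : ℂ) : ℂ :=
  Complex.exp (Real.pi * Complex.I * τ / 4 + Real.pi * Complex.I * (z + 1 / 2)) *
    jacobiTheta₂ (z + 1 / 2 + τ / 2) τ

/-- The Kronecker function `φ(u,z|τ) = θ(u+z) θ'(0) / (θ(u) θ(z))`. -/
def kronecker (τ u z : ℂ) : ℂ :=
  oddTheta τ (u + z) * deriv (oddTheta τ) 0 / (oddTheta τ u * oddTheta τ z)

/-- The first Eisenstein function `E₁(z|τ) = ∂_z log θ(z|τ)`. -/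
def eisensteinE1 (τ z : ℂ) : ℂ := deriv (oddTheta τ) z / oddTheta τ z

/-- `g^{(m)} = e(m z / r) φ(u + m τ / r, z | τ)`. -/
def gTw (τ : ℂ) (r : ℕ) (m : ℤ) (u z : ℂ) : ℂ :=
  ee (m * z / r) * kronecker τ (u + m * τ / r) z

/-- The period lattice `ℤ + τ ℤ`. -/
def periods (τ : ℂ) : Set ℂ := {x | ∃ a b : ℤ, x = a + b * τ}

/-! ### Brackets of two-tensors in `𝔤 ⊗ 𝔤 ⊗ 𝔤` -/

section Tensors

variable {𝔤 : Type*} [LieRing 𝔤] [LieAlgebra ℂ 𝔤]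

/-- The Lie bracket as a linear map `𝔤 ⊗ 𝔤 → 𝔤`. -/
def lieT : 𝔤 ⊗[ℂ] 𝔤 →ₗ[ℂ] 𝔤 := TensorProduct.lift (LieAlgebra.ad ℂ 𝔤 : 𝔤 →ₗ[ℂ] 𝔤 →ₗ[ℂ] 𝔤)

/-- `[R₁₂, S₁₃]`. -/
def br1213 (R S : 𝔤 ⊗[ℂ] 𝔤) : 𝔤 ⊗[ℂ] (𝔤 ⊗[ℂ] 𝔤) :=
  LinearMap.rTensor (𝔤 ⊗[ℂ] 𝔤) lieT
    (TensorProduct.tensorTensorTensorComm ℂ 𝔤 𝔤 𝔤 𝔤 (R ⊗ₜ[ℂ] S))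

/-- `[R₁₂, S₂₃]`. -/
def br1223 (R S : 𝔤 ⊗[ℂ] 𝔤) : 𝔤 ⊗[ℂ] (𝔤 ⊗[ℂ] 𝔤) :=
  LinearMap.lTensor 𝔤
    (LinearMap.rTensor 𝔤 lieT ∘ₗ (TensorProduct.assoc ℂ 𝔤 𝔤 𝔤).symm.toLinearMap)
    (TensorProduct.assoc ℂ 𝔤 𝔤 (𝔤 ⊗[ℂ] 𝔤) (R ⊗ₜ[ℂ] S))

/-- `[R₁₃, S₂₃]`. -/
def br1323 (R S : 𝔤 ⊗[ℂ] 𝔤) : 𝔤 ⊗[ℂ] (𝔤 ⊗[ℂ] 𝔤) :=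
  TensorProduct.assoc ℂ 𝔤 𝔤 𝔤
    (LinearMap.lTensor (𝔤 ⊗[ℂ] 𝔤) lieT
      (TensorProduct.tensorTensorTensorComm ℂ 𝔤 𝔤 𝔤 𝔤 (R ⊗ₜ[ℂ] S)))

theorem br1213_tmul (a b c d : 𝔤) :
    br1213 (a ⊗ₜ[ℂ] b) (c ⊗ₜ[ℂ] d) = ⁅a, c⁆ ⊗ₜ[ℂ] (b ⊗ₜ[ℂ] d) := by
  simp [br1213, lieT]

theorem br1223_tmul (a b c d : 𝔤) :
    br1223 (a ⊗ₜ[ℂ] b) (c ⊗ₜ[ℂ] d) = a ⊗ₜ[ℂ] (⁅b, c⁆ ⊗ₜ[ℂ] d) := by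
  simp [br1223, lieT]

theorem br1323_tmul (a b c d : 𝔤) :
    br1323 (a ⊗ₜ[ℂ] b) (c ⊗ₜ[ℂ] d) = a ⊗ₜ[ℂ] (c ⊗ₜ[ℂ] ⁅b, d⁆) := by
  simp [br1323, lieT]

/-- `[x ⊗ 1 + 1 ⊗ y, R]`. -/
def brL (x y : 𝔤) (R : 𝔤 ⊗[ℂ] 𝔤) : 𝔤 ⊗[ℂ] 𝔤 :=
  LinearMap.rTensor 𝔤 (LieAlgebra.ad ℂ 𝔤 x) R + LinearMap.lTensor 𝔤 (LieAlgebra.ad ℂ 𝔤 y) R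

theorem brL_tmul (x y a b : 𝔤) :
    brL x y (a ⊗ₜ[ℂ] b) = ⁅x, a⁆ ⊗ₜ[ℂ] b + a ⊗ₜ[ℂ] ⁅y, b⁆ := by
  simp [brL]

/-- The invariant bilinear form `( , )`; on a simple Lie algebra every invariant form is
a multiple of the Killing form. -/
def form (c : ℂ) (x y : 𝔤) : ℂ := c * killingForm ℂ 𝔤 x y

end Tensors

/-! ### Diagram automorphisms and adapted bases -/

section Twist

variable {𝔤 : Type*} [LieRing 𝔤] [LieAlgebra ℂ 𝔤] [FiniteDimensional ℂ 𝔤]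
  [LieAlgebra.IsSimple ℂ 𝔤]

/-- A diagram automorphism `ν` of `𝔤` with `ν ^ r = 1`, `ν ≠ 1` (so of order `r` when `r` is
prime): it preserves the Cartan subalgebra and permutes a system of simple root vectors. -/
structure DiagramAut (H : LieSubalgebra ℂ 𝔤) [H.IsCartanSubalgebra]
    (b : (LieAlgebra.IsKilling.rootSystem H).Base) (r : ℕ) where
  ν : 𝔤 ≃ₗ⁅ℂ⁆ 𝔤
  map_cartan : ∀ x ∈ H, ν x ∈ H
  perm : Equiv.Perm b.support
  e : b.support → 𝔤
  e_mem : ∀ i, e i ∈ LieAlgebra.rootSpace H ⇑(i.1 : LieModule.Weight ℂ H 𝔤)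
  e_ne_zero : ∀ i, e i ≠ 0
  map_e : ∀ i, ν (e i) = e (perm i)
  iterate_eq : ∀ x, ν^[r] x = x
  ne_refl : ∃ x, ν x ≠ x

variable {H : LieSubalgebra ℂ 𝔤} [H.IsCartanSubalgebra]
  {b : (LieAlgebra.IsKilling.rootSystem H).Base} {r : ℕ}

namespace DiagramAut

/-- The action of `ν` on the Cartan subalgebra. -/
def onCartan (N : DiagramAut H b r) (x : H) : H := ⟨N.ν x.1, N.map_cartan x.1 x.2⟩

/-- `∑_{j<r} ω^{-jm} ν^j(x)`, `ω = e(1/r)`: an element of `𝔤_m = {y | ν y = ω^m y}`. -/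
def twist (N : DiagramAut H b r) (m : ℕ) (x : 𝔤) : 𝔤 :=
  ∑ j ∈ Finset.range r, ee (-((j : ℂ) * m) / r) • N.ν^[j] x

/-- The averaged root `α̃ = (1/r) ∑_j α ∘ ν^j`, as a function on the Cartan subalgebra. -/
def avgRoot (N : DiagramAut H b r) (α : LieModule.Weight ℂ H 𝔤) (x : H) : ℂ :=
  (1 / (r : ℂ)) * ∑ j ∈ Finset.range r, α (N.onCartan^[j] x)

end DiagramAut

/-- Normalised root vectors `E_α`, an orthonormal basis `𝔢⁰_k` of `𝔥₀ = 𝔥^ν`, and bases `𝔢^m_k`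
of the eigenspaces `𝔥_m = {x ∈ 𝔥 | ν x = ω^m x}`, `0 < m < r`, with `𝔢^m` dual to `𝔢^{r-m}`. -/
structure AdaptedBasis (N : DiagramAut H b r) (c : ℂ) (ι₀ ι₁ : Type*)
    [DecidableEq ι₀] [DecidableEq ι₁] where
  E : LieModule.Weight ℂ H 𝔤 → 𝔤
  E_mem : ∀ α ∈ H.root, E α ∈ LieAlgebra.rootSpace H α
  E_pair : ∀ α ∈ H.root, form c (E α) (E (-α)) = 1
  e0 : ι₀ → H
  e0_fixed : ∀ k, N.onCartan (e0 k) = e0 k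
  e0_span : ∀ x : H, N.onCartan x = x → x ∈ Submodule.span ℂ (Set.range e0)
  e0_pair : ∀ j k, form c (e0 j : 𝔤) (e0 k) = if j = k then 1 else 0
  e : ℕ → ι₁ → H
  e_eigen : ∀ m, 0 < m → m < r → ∀ k, N.onCartan (e m k) = ee (m / r) • e m k
  e_span : ∀ m, 0 < m → m < r → ∀ x : H, N.onCartan x = ee (m / r) • x →
    x ∈ Submodule.span ℂ (Set.range (e m))
  e_pair : ∀ m, 0 < m → m < r → ∀ j k,
    form c (e m j : 𝔤) (e (r - m) k) = if j = k then 1 else 0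

namespace AdaptedBasis

variable {N : DiagramAut H b r} {c : ℂ} {ι₀ ι₁ : Type*} [Fintype ι₀] [Fintype ι₁]
  [DecidableEq ι₀] [DecidableEq ι₁] (B : AdaptedBasis N c ι₀ ι₁)

/-- `𝔱^m_α = ∑_j ω^{-jm} ν^j(E_α)`. -/
def t (m : ℕ) (α : LieModule.Weight ℂ H 𝔤) : 𝔤 := N.twist m (B.E α)

/-- `𝔢_α̃`, the element of `𝔥₀` with `(𝔢_α̃, x) = α̃(x)` for all `x ∈ 𝔥₀`. -/
def dualRoot (α : LieModule.Weight ℂ H 𝔤) : H := ∑ k, N.avgRoot α (B.e0 k) • B.e0 k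

/-- `𝐮 = ∑_k u_k 𝔢⁰_k`. -/
def vec (u : ι₀ → ℂ) : H := ∑ k, u k • B.e0 k

/-- `𝐮` avoids the poles: `α̃(𝐮 + ϖ) + mτ/r ∉ ℤ + τℤ` whenever `𝔱^m_α ≠ 0`. -/
def IsRegular (τ : ℂ) (ϖ u : H) : Prop :=
  ∀ m < r, ∀ α ∈ H.root, B.t m α ≠ 0 → N.avgRoot α (u + ϖ) + m * τ / r ∉ periods τ

/-- `∂ g^{(-m)}(s_α̃^{-1}(𝐮 + ϖ), z) / ∂ α̃(𝐮)`. -/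
def dg (_B : AdaptedBasis N c ι₀ ι₁) (τ : ℂ) (ϖ : H) (m : ℕ) (α : LieModule.Weight ℂ H 𝔤)
    (u : H) (z : ℂ) : ℂ :=
  deriv (fun x => gTw τ r (-(m : ℤ)) (-x) z) (N.avgRoot α (u + ϖ))

/-- The component `r_m(𝐮, z)` of the twisted `r`-matrix. The sum runs over all roots of `𝔤`;
the summand is constant on orbits of `ν`, so that an orbit of length `r` contributes
`(1/r) g^{(-m)} 𝔱^m_α ⊗ 𝔱^{r-m}_{-α}`. -/
def rComp (τ : ℂ) (ϖ : H) (m : ℕ) (u : H) (z : ℂ) : 𝔤 ⊗[ℂ] 𝔤 :=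
  (if m = 0 then eisensteinE1 τ z • ∑ k, (B.e0 k : 𝔤) ⊗ₜ[ℂ] (B.e0 k : 𝔤)
    else gTw τ r (-(m : ℤ)) 0 z • ∑ k, (B.e m k : 𝔤) ⊗ₜ[ℂ] (B.e (r - m) k : 𝔤)) +
  (1 / (r : ℂ) ^ 2) • ∑ α ∈ H.root,
    gTw τ r (-(m : ℤ)) (-N.avgRoot α (u + ϖ)) z • (B.t m α ⊗ₜ[ℂ] B.t (r - m) (-α))

/-- The twisted dynamical `r`-matrix `r(𝐮, z) = ∑_m r_m(𝐮, z)`. -/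
def rMatrix (τ : ℂ) (ϖ u : H) (z : ℂ) : 𝔤 ⊗[ℂ] 𝔤 :=
  ∑ m ∈ Finset.range r, B.rComp τ ϖ m u z

/-- The dynamical term of the Yang–Baxter equation. -/
def dynTerm (τ : ℂ) (ϖ u : H) (z₁ z₂ z₃ : ℂ) : 𝔤 ⊗[ℂ] (𝔤 ⊗[ℂ] 𝔤) :=
  (1 / (r : ℂ) ^ 2) • ∑ m ∈ Finset.range r, ∑ α ∈ H.root,
    (B.dg τ ϖ m α u (z₁ - z₂) •
        (B.t m α ⊗ₜ[ℂ] (B.t (r - m) (-α) ⊗ₜ[ℂ] (B.dualRoot α : 𝔤)))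
      - B.dg τ ϖ m α u (z₁ - z₃) •
        (B.t m α ⊗ₜ[ℂ] ((B.dualRoot α : 𝔤) ⊗ₜ[ℂ] B.t (r - m) (-α)))
      + B.dg τ ϖ m α u (z₂ - z₃) •
        ((B.dualRoot α : 𝔤) ⊗ₜ[ℂ] (B.t m α ⊗ₜ[ℂ] B.t (r - m) (-α))))

/-! ### Phase space, Lax operator and Poisson brackets -/

/-- The component `L_m(z)` of the Lax operator at the point `(𝐯, 𝐮, 𝐒)`, with the coordinates
`S_0^k = (𝐒, 𝔢⁰_k)`, `S_m^k = (𝐒, 𝔢^{r-m}_k)`, `S_m^α = (𝐒, 𝔱^{r-m}_{-α})`. -/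
def laxComp (τ : ℂ) (ϖ : H) (m : ℕ) (z : ℂ) (p : (ι₀ → ℂ) × (ι₀ → ℂ) × 𝔤) : 𝔤 :=
  (if m = 0 then
      ∑ k, (p.1 k + form c p.2.2 (B.e0 k : 𝔤) * eisensteinE1 τ z) • (B.e0 k : 𝔤)
    else ∑ k, (form c p.2.2 (B.e (r - m) k : 𝔤) * gTw τ r (-(m : ℤ)) 0 z) • (B.e m k : 𝔤)) +
  (1 / (r : ℂ) ^ 2) • ∑ α ∈ H.root,
    (form c p.2.2 (B.t (r - m) (-α)) *
      gTw τ r (-(m : ℤ)) (-N.avgRoot α (B.vec p.2.1 + ϖ)) z) • B.t m α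

/-- The Lax operator `L = ∑_m L_m`. -/
def lax (τ : ℂ) (ϖ : H) (z : ℂ) (p : (ι₀ → ℂ) × (ι₀ → ℂ) × 𝔤) : 𝔤 :=
  ∑ m ∈ Finset.range r, B.laxComp τ ϖ m z p

/-- `𝐒_0^𝔥 = ∑_k S_0^k 𝔢⁰_k`, the invariant Cartan part of `𝐒`. -/
def cartanPart (S : 𝔤) : H := ∑ k, form c S (B.e0 k : 𝔤) • B.e0 k

/-- The anomalous term of the `RLL` relation. -/
def anomaly (τ : ℂ) (ϖ u : H) (S : 𝔤) (z : ℂ) : 𝔤 ⊗[ℂ] 𝔤 :=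
  (1 / (r : ℂ) ^ 2) • ∑ m ∈ Finset.range r, ∑ α ∈ H.root,
    (B.dg τ ϖ m α u z * N.avgRoot α (B.cartanPart S)) •
      (B.t m α ⊗ₜ[ℂ] B.t (r - m) (-α))

/-- `𝐒` is generic: the averaged roots `α̃` with some component `S_m^α ≠ 0` span `𝔥₀^*`. -/
def IsGeneric (S : 𝔤) : Prop :=
  ∀ w : ι₀ → ℂ, (∀ m < r, ∀ α ∈ H.root, form c S (B.t (r - m) (-α)) ≠ 0 →
    N.avgRoot α (B.vec w) = 0) → w = 0

end AdaptedBasis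

end Twist

section Poisson

variable {𝔤 : Type*} [LieRing 𝔤] [LieAlgebra ℂ 𝔤] {ι₀ κ : Type*} [DecidableEq ι₀]

/-- The coordinate directions `∂/∂v_k`, `∂/∂u_k`, `∂/∂S_a` on the phase space of triples
`(𝐯, 𝐮, 𝐒)`, where `𝐒 = ∑_a S_a T_a`. -/
def coordDir (T : κ → 𝔤) : ι₀ ⊕ ι₀ ⊕ κ → (ι₀ → ℂ) × (ι₀ → ℂ) × 𝔤
  | Sum.inl k => (Pi.single k 1, 0, 0)
  | Sum.inr (Sum.inl k) => (0, Pi.single k 1, 0)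
  | Sum.inr (Sum.inr a) => (0, 0, T a)

/-- The matrix of the Poisson brackets of the coordinate functions at the point with spin
variable `𝐒`: `{v_j, u_k} = δ_jk`, `{S_a, S_b} = -(𝐒, [T_a, T_b])`, all others zero
(for an orthonormal basis `T` of `𝔤`, so that `S_a = (𝐒, T_a)`). -/
def poissonMatrix (c : ℂ) (T : κ → 𝔤) (S : 𝔤) : ι₀ ⊕ ι₀ ⊕ κ → ι₀ ⊕ ι₀ ⊕ κ → ℂ
  | Sum.inl j, Sum.inr (Sum.inl k) => if j = k then 1 else 0
  | Sum.inr (Sum.inl j), Sum.inl k => if j = k then -1 else 0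
  | Sum.inr (Sum.inr a), Sum.inr (Sum.inr a') => -form c S ⁅T a, T a'⁆
  | _, _ => 0

variable [Fintype ι₀] [Fintype κ]

/-- `{F, G}(p) = ∑_{ij} P_ij ∂_i F(p) ∂_j G(p)`. -/
def pbracket (T : κ → 𝔤) (P : ι₀ ⊕ ι₀ ⊕ κ → ι₀ ⊕ ι₀ ⊕ κ → ℂ)
    (F G : (ι₀ → ℂ) × (ι₀ → ℂ) × 𝔤 → ℂ) (p : (ι₀ → ℂ) × (ι₀ → ℂ) × 𝔤) : ℂ :=
  ∑ i, ∑ j, P i j * lineDeriv ℂ F p (coordDir T i) * lineDeriv ℂ G p (coordDir T j)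

/-- `{F ⊗ 1, 1 ⊗ G} = ∑_{ab} {F_a, G_b} T_a ⊗ T_b` for `𝔤`-valued functions `F`, `G`, where
`F_a = (F, T_a)` are the coordinates in the orthonormal basis `T`. -/
def pbracketTensor (c : ℂ) (T : κ → 𝔤) (P : ι₀ ⊕ ι₀ ⊕ κ → ι₀ ⊕ ι₀ ⊕ κ → ℂ)
    (F G : (ι₀ → ℂ) × (ι₀ → ℂ) × 𝔤 → 𝔤) (p : (ι₀ → ℂ) × (ι₀ → ℂ) × 𝔤) : 𝔤 ⊗[ℂ] 𝔤 :=
  ∑ a, ∑ a', pbracket T P (fun x => form c (F x) (T a)) (fun x => form c (G x) (T a')) p •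
    (T a ⊗ₜ[ℂ] T a')

end Poisson

end TwistedCM

end

/-! The `r`-matrix is diagonal on homogeneous vectors. Decompose `𝔤` under `ν` and `ad 𝔥₀`, so that
a homogeneous vector has a degree `n` mod `r` and a weight `β` on `𝔥₀`. Contracting one factor of
`r(𝐮, z)` with an element of `𝔥₀` multiplies it by `E₁(z)`. Contracting with a homogeneous vector of
the complement (some `𝔢^m_k` or `𝔱^m_α`) multiplies it by `g^{(∓n)}(∓β, z)`, where `β` is evaluated
at the `ν`-average of `𝐮 + ϖ`. The sums over roots collapse because they are projected Casimir
expansions (`pair2_rootTensor_right`, `pair2_rootTensor_left`, collected in `IsTwistedVector`).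

Paired with homogeneous `x, y, w`, the brackets of the Yang–Baxter equation become a scalar times
`([x, y], w)`, which is nonzero only if degrees and weights cancel. Three vectors outside `𝔥₀` leave
Fay's identity. One vector in `𝔥₀` leaves the degenerate Fay identity, whose derivative is the
dynamical term. With two or three vectors in `𝔥₀` everything vanishes.

Both Fay identities come from Weierstrass' three-term identity: `θ(x+y)θ(x-y)` is a 2×2 determinant
in two theta functions of modulus `2τ` (`oddTheta_mul_oddTheta`), and the three-term identity is the
Plücker relation of such determinants. The same determinant confines the zeros of `θ` to the lattice
and gives `θ'(0) ≠ 0`.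

The Lax operator is `𝐯` plus the contraction of `r(𝐮, z)` with `𝐒` (`lax_eq`). Hence the `RLL`
relation is the Yang–Baxter equation at `z₃ = 0` with third factor paired with `𝐒`: `{v, u}` gives
two of the dynamical terms, `{S, S}` gives `[r₁₃, r₂₃]`, the third dynamical term is the anomaly,
and the terms in `𝐯` cancel by the `𝔥₀`-invariance of `r`.

For uniqueness, a bracket matrix enters bilinearly through the vectors of partial derivatives of
`L(z₁)` and `L(z₂)`. Near `z = 0` the functions `1, E₁` are independent, as are `g, ∂g`, so at a
generic point no nonzero vector annihilates these derivatives (`eq_zero_of_sum_mul_laxDeriv`). This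
is applied in each variable in turn. -/

noncomputable section

namespace TwistedCM

set_option linter.unusedSectionVars false

/-! ### The odd theta function -/

section Theta

open Complex Filter Topology

theorem ee_add (x y : ℂ) : ee (x + y) = ee x * ee y := by
  simp only [ee, ← Complex.exp_add]; ring_nf

theorem ee_zero : ee 0 = 1 := by simp [ee]

theorem ee_ne_zero (x : ℂ) : ee x ≠ 0 := Complex.exp_ne_zero _

theorem ee_neg (x : ℂ) : ee (-x) = (ee x)⁻¹ := by
  simp only [ee, ← Complex.exp_neg]; ring_nf

theorem ee_int (n : ℤ) : ee n = 1 := by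
  rw [ee, Complex.exp_eq_one_iff]; exact ⟨n, by ring⟩

theorem ee_eq_one_iff {x : ℂ} : ee x = 1 ↔ ∃ n : ℤ, x = n := by
  rw [ee, Complex.exp_eq_one_iff]
  refine exists_congr fun n => ?_
  have : (2 * Real.pi * Complex.I : ℂ) ≠ 0 := Complex.two_pi_I_ne_zero
  rw [mul_comm (n : ℂ)]
  exact mul_right_inj' this

theorem ee_eq_of_add_int {x y : ℂ} (n : ℤ) (h : x = y + n) : ee x = ee y := by
  rw [h, ee_add, ee_int, mul_one]

theorem ee_half : ee (1 / 2) = -1 := by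
  rw [ee, show (2 * Real.pi * Complex.I * (1 / 2) : ℂ) = Real.pi * Complex.I by ring,
    Complex.exp_pi_mul_I]

variable {τ : ℂ}

theorem differentiable_oddTheta (hτ : 0 < τ.im) : Differentiable ℂ (oddTheta τ) := by
  intro z
  refine DifferentiableAt.mul (by fun_prop) ?_
  exact (differentiableAt_jacobiTheta₂_fst _ hτ).comp z
    (f := fun z : ℂ => z + 1 / 2 + τ / 2) (by fun_prop)

theorem oddTheta_add_one (z : ℂ) : oddTheta τ (z + 1) = -oddTheta τ z := by
  unfold oddTheta
  rw [show z + 1 + 1 / 2 + τ / 2 = (z + 1 / 2 + τ / 2) + 1 by ring, jacobiTheta₂_add_left,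
    show (Real.pi * I * τ / 4 + Real.pi * I * (z + 1 + 1 / 2) : ℂ) =
      (Real.pi * I * τ / 4 + Real.pi * I * (z + 1 / 2)) + Real.pi * I by ring,
    Complex.exp_add _ (Real.pi * I), Complex.exp_pi_mul_I]
  ring

theorem oddTheta_add_tau (z : ℂ) :
    oddTheta τ (z + τ) = -(ee (-z - τ / 2)) * oddTheta τ z := by
  unfold oddTheta ee
  rw [show z + τ + 1 / 2 + τ / 2 = (z + 1 / 2 + τ / 2) + τ by ring, jacobiTheta₂_add_left',
    ← mul_assoc, ← mul_assoc, ← Complex.exp_add, ← neg_one_mul (cexp _), ← Complex.exp_pi_mul_I,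
    ← Complex.exp_add, ← Complex.exp_add]
  congr 1
  rw [Complex.exp_eq_exp_iff_exists_int]
  exact ⟨-1, by push_cast; ring⟩

theorem oddTheta_neg (z : ℂ) : oddTheta τ (-z) = -oddTheta τ z := by
  unfold oddTheta
  rw [← jacobiTheta₂_neg_left (-z + 1 / 2 + τ / 2),
    show z + 1 / 2 + τ / 2 = (-(-z + 1 / 2 + τ / 2) + τ) + 1 by ring, jacobiTheta₂_add_left,
    jacobiTheta₂_add_left', ← mul_assoc, ← neg_mul, ← Complex.exp_add,
    ← neg_one_mul (cexp _), ← Complex.exp_pi_mul_I, ← Complex.exp_add]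
  congr 1
  rw [Complex.exp_eq_exp_iff_exists_int]
  exact ⟨-1, by push_cast; ring⟩

theorem oddTheta_zero : oddTheta τ 0 = 0 := by
  have := oddTheta_neg (τ := τ) 0
  rw [neg_zero] at this
  linear_combination this / 2

/-- The theta constants of modulus `2τ` of the addition formula. -/
def thetaEven (τ x : ℂ) : ℂ := jacobiTheta₂ (2 * x) (2 * τ)

/-- The odd counterpart of `thetaEven`. -/
def thetaHalf (τ x : ℂ) : ℂ :=
  Complex.exp (Real.pi * I * τ / 2 + 2 * Real.pi * I * x) * jacobiTheta₂ (2 * x + τ) (2 * τ)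

/-- Pairs of integers, split according to the parity of their sum. -/
def parityEquiv : (ℤ × ℤ) ⊕ (ℤ × ℤ) ≃ ℤ × ℤ where
  toFun := Sum.elim (fun p => (p.1 + p.2, p.1 - p.2 - 1)) (fun p => (p.1 + p.2, p.1 - p.2))
  invFun p := if Even (p.1 + p.2) then Sum.inr ((p.1 + p.2) / 2, (p.1 - p.2) / 2)
    else Sum.inl ((p.1 + p.2 + 1) / 2, (p.1 - p.2 - 1) / 2)
  left_inv := by
    rintro (⟨k, l⟩ | ⟨k, l⟩)
    · have h : ¬ Even (k + l + (k - l - 1)) := by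
        rw [Int.even_iff]; omega
      refine (if_neg h).trans ?_
      simp only [Sum.elim_inl, Sum.inl.injEq, Prod.mk.injEq]
      omega
    · have h : Even (k + l + (k - l)) := by
        rw [Int.even_iff]; omega
      refine (if_pos h).trans ?_
      simp only [Sum.elim_inr, Sum.inr.injEq, Prod.mk.injEq]
      omega
  right_inv := by
    rintro ⟨n, m⟩
    by_cases h : Even (n + m)
    · simp only [if_pos h, Sum.elim_inr, Prod.mk.injEq]
      rw [Int.even_iff] at h
      omega
    · simp only [if_neg h, Sum.elim_inl, Prod.mk.injEq]
      rw [Int.even_iff] at h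
      omega

theorem hasSum_oddTheta (hτ : 0 < τ.im) (z : ℂ) :
    HasSum (fun n : ℤ => ee ((n + 1 / 2) ^ 2 * τ / 2 + (n + 1 / 2) * (z + 1 / 2)))
      (oddTheta τ z) := by
  have := (hasSum_jacobiTheta₂_term (z + 1 / 2 + τ / 2) hτ).mul_left
    (cexp (Real.pi * I * τ / 4 + Real.pi * I * (z + 1 / 2)))
  refine (congrArg (fun f : ℤ → ℂ => HasSum f _) (funext fun n => ?_)).mpr this
  simp only [jacobiTheta₂_term, ← Complex.exp_add, ee]
  ring_nf

theorem two_mul_im_pos (hτ : 0 < τ.im) : 0 < (2 * τ).im := by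
  simpa using hτ

theorem hasSum_thetaEven (hτ : 0 < τ.im) (x : ℂ) :
    HasSum (fun n : ℤ => ee (n ^ 2 * τ + 2 * n * x)) (thetaEven τ x) := by
  have := hasSum_jacobiTheta₂_term (2 * x) (two_mul_im_pos hτ)
  unfold thetaEven
  convert this using 1
  ext n
  rw [jacobiTheta₂_term, ee]
  ring_nf

theorem hasSum_thetaHalf (hτ : 0 < τ.im) (x : ℂ) :
    HasSum (fun n : ℤ => ee ((n + 1 / 2) ^ 2 * τ + (2 * n + 1) * x)) (thetaHalf τ x) := by
  have := (hasSum_jacobiTheta₂_term (2 * x + τ) (two_mul_im_pos hτ)).mul_left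
    (cexp (Real.pi * I * τ / 2 + 2 * Real.pi * I * x))
  refine (congrArg (fun f : ℤ → ℂ => HasSum f _) (funext fun n => ?_)).mpr this
  simp only [jacobiTheta₂_term, ← Complex.exp_add, ee]
  ring_nf

theorem hasSum_mul_prod {f g : ℤ → ℂ} {s t : ℂ} (hf : HasSum f s) (hg : HasSum g t) :
    HasSum (fun p : ℤ × ℤ => f p.1 * g p.2) (s * t) :=
  hf.mul hg (summable_mul_of_summable_norm hf.summable.norm hg.summable.norm)

/-- The addition formula of the odd theta function. -/
theorem oddTheta_mul_oddTheta (hτ : 0 < τ.im) (x y : ℂ) :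
    oddTheta τ (x + y) * oddTheta τ (x - y) =
      thetaEven τ x * thetaHalf τ y - thetaHalf τ x * thetaEven τ y := by
  have h := hasSum_mul_prod (hasSum_oddTheta hτ (x + y)) (hasSum_oddTheta hτ (x - y))
  rw [← parityEquiv.hasSum_iff] at h
  have h1 := hasSum_mul_prod (hasSum_thetaEven hτ x) (hasSum_thetaHalf hτ y)
  have h2 := (hasSum_mul_prod (hasSum_thetaHalf hτ x) (hasSum_thetaEven hτ y)).neg
  refine h.unique ?_
  rw [sub_eq_add_neg (thetaEven τ x * _)]
  refine HasSum.sum (M := ℂ) ?_ ?_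
  -- Here `n + m + 1 = 2k`, so the shift by `1/2` in the argument of theta contributes `e(k) = 1`.
  · convert h1 using 2 with p
    obtain ⟨k, l⟩ := p
    simp only [Function.comp_apply, parityEquiv, Equiv.coe_fn_mk, Sum.elim_inl, ← ee_add]
    exact ee_eq_of_add_int k (by push_cast; ring)
  · refine (congrArg (fun f : ℤ × ℤ → ℂ => HasSum f _) (funext fun p => ?_)).mpr h2
    obtain ⟨k, l⟩ := p
    simp only [Function.comp_apply, parityEquiv, Equiv.coe_fn_mk, Sum.elim_inr, ← ee_add]
    -- Here `n + m + 1 = 2k + 1`, and the shift contributes `e(k + 1/2) = -1`, the sign of the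
    -- second product.
    rw [← neg_one_mul, ← ee_half, ← ee_add]
    exact ee_eq_of_add_int k (by push_cast; ring)

/-- Weierstrass' three-term identity. -/
theorem oddTheta_three_term (hτ : 0 < τ.im) (a b c d : ℂ) :
    oddTheta τ (a + b) * oddTheta τ (a - b) * (oddTheta τ (c + d) * oddTheta τ (c - d)) -
      oddTheta τ (a + c) * oddTheta τ (a - c) * (oddTheta τ (b + d) * oddTheta τ (b - d)) +
      oddTheta τ (a + d) * oddTheta τ (a - d) * (oddTheta τ (b + c) * oddTheta τ (b - c)) = 0 := by
  -- Every product is now a 2×2 minor of the 2×4 matrix of theta constants at `a, b, c, d`; what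
  -- remains is the Plücker relation.
  simp only [oddTheta_mul_oddTheta hτ]
  ring

/-! ### Zeros of the odd theta function -/

theorem jacobiTheta₂_exists_ne_zero (hτ : 0 < τ.im) : ∃ z, jacobiTheta₂ z τ ≠ 0 := by
  by_contra! h
  -- Integrate the supposedly vanishing series over one period: only the term `n = 0` survives, and
  -- it contributes `1`.
  have h1 := intervalIntegral.hasSum_intervalIntegral_of_summable_norm (a := 0) (b := 1)
    (f := fun n : ℤ => (⟨fun x : ℝ => jacobiTheta₂_term n x τ, by
      unfold jacobiTheta₂_term; fun_prop⟩ : C(ℝ, ℂ))) (by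
      have := (summable_jacobiTheta₂_term_iff 0 τ).2 hτ
      refine this.norm.of_nonneg_of_le (fun n => norm_nonneg _) fun n => ?_
      rw [ContinuousMap.norm_le _ (norm_nonneg _)]
      rintro ⟨x, hx⟩
      simp [norm_jacobiTheta₂_term])
  have h2 : ∀ x : ℝ, ∑' n : ℤ, jacobiTheta₂_term n x τ = 0 := fun x => h x
  simp only [ContinuousMap.coe_mk, h2, intervalIntegral.integral_zero] at h1
  have h3 : ∀ n : ℤ, ∫ x in (0 : ℝ)..1, jacobiTheta₂_term n x τ = if n = 0 then 1 else 0 := by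
    intro n
    split_ifs with hn
    · subst hn; simp [jacobiTheta₂_term]
    · simp only [jacobiTheta₂_term, Complex.exp_add, intervalIntegral.integral_mul_const]
      have : (2 * Real.pi * I * n : ℂ) ≠ 0 :=
        mul_ne_zero Complex.two_pi_I_ne_zero (Int.cast_ne_zero.2 hn)
      rw [integral_exp_mul_complex this]
      have h4 : cexp (2 * Real.pi * I * n * (1 : ℝ)) = 1 := by
        rw [Complex.exp_eq_one_iff]; exact ⟨n, by push_cast; ring⟩
      rw [h4]; simp
  simp only [h3] at h1
  exact one_ne_zero ((hasSum_ite_eq (0 : ℤ) (1 : ℂ)).unique h1)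

theorem oddTheta_exists_ne_zero (hτ : 0 < τ.im) : ∃ z, oddTheta τ z ≠ 0 := by
  obtain ⟨z, hz⟩ := jacobiTheta₂_exists_ne_zero hτ
  refine ⟨z - 1 / 2 - τ / 2, mul_ne_zero (Complex.exp_ne_zero _) ?_⟩
  convert hz using 2
  ring

theorem differentiable_thetaEven (hτ : 0 < τ.im) : Differentiable ℂ (thetaEven τ) := fun z =>
  (differentiableAt_jacobiTheta₂_fst _ (two_mul_im_pos hτ)).comp z
    (f := fun z : ℂ => 2 * z) (by fun_prop)

theorem differentiable_thetaHalf (hτ : 0 < τ.im) : Differentiable ℂ (thetaHalf τ) := fun z =>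
  DifferentiableAt.mul (by fun_prop)
    ((differentiableAt_jacobiTheta₂_fst _ (two_mul_im_pos hτ)).comp z
      (f := fun z : ℂ => 2 * z + τ) (by fun_prop))

theorem thetaEven_add_half (x : ℂ) : thetaEven τ (x + 1 / 2) = thetaEven τ x := by
  unfold thetaEven
  rw [show 2 * (x + 1 / 2) = 2 * x + 1 by ring, jacobiTheta₂_add_left]

theorem thetaHalf_add_half (x : ℂ) : thetaHalf τ (x + 1 / 2) = -thetaHalf τ x := by
  unfold thetaHalf
  rw [show 2 * (x + 1 / 2) + τ = (2 * x + τ) + 1 by ring, jacobiTheta₂_add_left,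
    show (Real.pi * I * τ / 2 + 2 * Real.pi * I * (x + 1 / 2) : ℂ) =
      (Real.pi * I * τ / 2 + 2 * Real.pi * I * x) + Real.pi * I by ring,
    Complex.exp_add _ (Real.pi * I), Complex.exp_pi_mul_I]
  ring

theorem thetaEven_add_half_tau (x : ℂ) :
    thetaEven τ (x + τ / 2) = ee (-τ / 4 - x) * thetaHalf τ x := by
  unfold thetaEven thetaHalf ee
  rw [← mul_assoc, ← Complex.exp_add, show 2 * (x + τ / 2) = 2 * x + τ by ring,
    ← one_mul (jacobiTheta₂ _ _)]
  rw [show (2 * Real.pi * I * (-τ / 4 - x) + (Real.pi * I * τ / 2 + 2 * Real.pi * I * x) : ℂ) = 0 by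
    ring, Complex.exp_zero, one_mul, one_mul]

theorem thetaHalf_add_half_tau (x : ℂ) :
    thetaHalf τ (x + τ / 2) = ee (-τ / 4 - x) * thetaEven τ x := by
  unfold thetaEven thetaHalf ee
  rw [show 2 * (x + τ / 2) + τ = 2 * x + 2 * τ by ring, jacobiTheta₂_add_left', ← mul_assoc,
    ← Complex.exp_add]
  ring_nf

/-- A common zero `x` would make `θ(x+y)θ(x-y)` vanish for all `y`; one of the two analytic factors,
hence `θ` itself, would then be zero. -/
theorem thetaEven_ne_zero_or (hτ : 0 < τ.im) (x : ℂ) :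
    thetaEven τ x ≠ 0 ∨ thetaHalf τ x ≠ 0 := by
  by_contra! h
  have h1 : ∀ y, oddTheta τ (x + y) * oddTheta τ (x - y) = 0 := fun y => by
    rw [oddTheta_mul_oddTheta hτ, h.1, h.2]; ring
  have hd := differentiable_oddTheta hτ
  have ha : AnalyticOnNhd ℂ (fun y => oddTheta τ (x + y)) Set.univ :=
    DifferentiableOn.analyticOnNhd (fun y _ => by
      exact (hd.comp (by fun_prop : Differentiable ℂ fun y => x + y) y).differentiableWithinAt)
      isOpen_univ
  have hb : AnalyticOnNhd ℂ (fun y => oddTheta τ (x - y)) Set.univ :=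
    DifferentiableOn.analyticOnNhd (fun y _ => by
      exact (hd.comp (by fun_prop : Differentiable ℂ fun y => x - y) y).differentiableWithinAt)
      isOpen_univ
  obtain ⟨w, hw⟩ := oddTheta_exists_ne_zero hτ
  rcases ha.eq_zero_or_eq_zero_of_mul_eq_zero hb (fun y _ => h1 y) isPreconnected_univ with
    h2 | h2
  · exact hw (by simpa using h2 (w - x) trivial)
  · exact hw (by simpa using h2 (x - w) trivial)

theorem mem_periods_neg {x : ℂ} (hx : x ∈ periods τ) : -x ∈ periods τ := by
  obtain ⟨a, b, rfl⟩ := hx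
  exact ⟨-a, -b, by push_cast; ring⟩

theorem mem_periods_add {x y : ℂ} (hx : x ∈ periods τ) (hy : y ∈ periods τ) :
    x + y ∈ periods τ := by
  obtain ⟨a, b, rfl⟩ := hx
  obtain ⟨a', b', rfl⟩ := hy
  exact ⟨a + a', b + b', by push_cast; ring⟩

theorem neg_mem_periods_iff {x : ℂ} : -x ∈ periods τ ↔ x ∈ periods τ :=
  ⟨fun h => by simpa using mem_periods_neg h, mem_periods_neg⟩

/-- An entire doubly periodic function is constant. -/
theorem constant_of_doublyPeriodic {f : ℂ → ℂ} (hf : Differentiable ℂ f)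
    {p q : ℂ} (hpq : ∀ z : ℂ, ∃ s t : ℝ, z = s * p + t * q) (h1 : ∀ z, f (z + p) = f z)
    (h2 : ∀ z, f (z + q) = f z) (z w : ℂ) : f z = f w := by
  -- Liouville: the range is the image of the compact fundamental parallelogram.
  refine hf.apply_eq_apply_of_bounded ?_ z w
  have hn1 : ∀ (n : ℤ) z, f (z + n * p) = f z := by
    intro n z
    have := (show Function.Periodic f p from h1).int_mul n z
    simpa using this
  have hn2 : ∀ (n : ℤ) z, f (z + n * q) = f z := by
    intro n z
    have := (show Function.Periodic f q from h2).int_mul n z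
    simpa using this
  have hK : IsCompact ((fun x : ℝ × ℝ => f (x.1 * p + x.2 * q)) ''
      (Set.Icc 0 1 ×ˢ Set.Icc 0 1)) := by
    refine (isCompact_Icc.prod isCompact_Icc).image ?_
    have := hf.continuous
    fun_prop
  refine hK.isBounded.subset ?_
  rintro _ ⟨z, rfl⟩
  obtain ⟨s, t, rfl⟩ := hpq z
  refine ⟨(Int.fract s, Int.fract t), ⟨⟨Int.fract_nonneg _, (Int.fract_lt_one _).le⟩,
    ⟨Int.fract_nonneg _, (Int.fract_lt_one _).le⟩⟩, ?_⟩
  rw [← hn1 (-⌊s⌋), ← hn2 (-⌊t⌋)]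
  simp only [Int.fract]
  congr 1
  push_cast
  ring

theorem exists_real_combination (hτ : 0 < τ.im) (z : ℂ) :
    ∃ s t : ℝ, z = s * (1 / 2 : ℂ) + t * (τ / 2) := by
  refine ⟨2 * (z.re - z.im / τ.im * τ.re), 2 * (z.im / τ.im), ?_⟩
  apply Complex.ext <;> (simp; field_simp; try ring)

/-- A translation preserving the pencil of theta constants is a period. -/
theorem mem_periods_of_translate (hτ : 0 < τ.im) {p : ℂ} {l : ℂ → ℂ}
    (hE : ∀ y, thetaEven τ (y + p) = l y * thetaEven τ y)
    (hH : ∀ y, thetaHalf τ (y + p) = l y * thetaHalf τ y) : p ∈ periods τ := by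
  have hdE := differentiable_thetaEven hτ
  have hdH := differentiable_thetaHalf hτ
  -- The two theta constants have no common zero, so an identity multiplied by each of them may be
  -- cancelled.
  have hcancel : ∀ y a b : ℂ, a * thetaEven τ y = b * thetaEven τ y →
      a * thetaHalf τ y = b * thetaHalf τ y → a = b := by
    intro y a b h1 h2
    rcases thetaEven_ne_zero_or hτ y with h | h
    · exact mul_right_cancel₀ h h1
    · exact mul_right_cancel₀ h h2
  have hl0 : ∀ y, l y ≠ 0 := by
    intro y h
    rcases thetaEven_ne_zero_or hτ (y + p) with h' | h'
    · exact h' (by rw [hE, h, zero_mul])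
    · exact h' (by rw [hH, h, zero_mul])
  -- Near each point `l` is the quotient by whichever theta constant does not vanish there.
  have hld : Differentiable ℂ l := by
    have key : ∀ (g : ℂ → ℂ), Differentiable ℂ g → (∀ y, g (y + p) = l y * g y) →
        ∀ y, g y ≠ 0 → DifferentiableAt ℂ l y := by
      intro g hg hgl y hy
      have h1 : DifferentiableAt ℂ (fun y => g (y + p) / g y) y :=
        ((hg.comp (by fun_prop : Differentiable ℂ fun y => y + p)) y).div (hg y) hy
      refine h1.congr_of_eventuallyEq ?_
      filter_upwards [hg.continuous.continuousAt.eventually_ne hy] with w hw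
      rw [hgl, mul_div_cancel_right₀ _ hw]
    intro y
    rcases thetaEven_ne_zero_or hτ y with h | h
    · exact key _ hdE hE y h
    · exact key _ hdH hH y h
  have hl1 : ∀ y, l (y + 1 / 2) = l y := by
    intro y
    refine hcancel y _ _ ?_ ?_
    · rw [← hE, ← thetaEven_add_half y, ← hE, add_right_comm, thetaEven_add_half]
    · have := hH (y + 1 / 2)
      rw [add_right_comm, thetaHalf_add_half, thetaHalf_add_half, hH] at this
      linear_combination this
  -- Translation by `τ/2` exchanges the two theta constants with factor `e(-τ/4 - y)`; comparing
  -- this factor at `y + p` and at `y` leaves `e(-p)`.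
  have hl2 : ∀ y, l (y + τ / 2) = ee (-p) * l y := by
    intro y
    have e : ee (-τ / 4 - (y + p)) = ee (-τ / 4 - y) * ee (-p) := by
      rw [← ee_add]; ring_nf
    refine hcancel y _ _ ?_ ?_
    · have := hH (y + τ / 2)
      rw [add_right_comm, thetaHalf_add_half_tau, thetaHalf_add_half_tau, hE, e] at this
      refine mul_left_cancel₀ (ee_ne_zero (-τ / 4 - y)) ?_
      linear_combination -this
    · have := hE (y + τ / 2)
      rw [add_right_comm, thetaEven_add_half_tau, thetaEven_add_half_tau, hH, e] at this
      refine mul_left_cancel₀ (ee_ne_zero (-τ / 4 - y)) ?_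
      linear_combination -this
  have hd1 : ∀ y, deriv l (y + 1 / 2) = deriv l y := by
    intro y
    rw [← deriv_comp_add_const, funext hl1]
  have hd2 : ∀ y, deriv l (y + τ / 2) = ee (-p) * deriv l y := by
    intro y
    rw [← deriv_comp_add_const, funext hl2, deriv_const_mul _ (hld y)]
  have hld' : Differentiable ℂ (deriv l) := by
    have := (hld.contDiff (n := 2)).differentiable_deriv_two
    exact this
  -- The constant multiplier `e(-p)` disappears in the logarithmic derivative, which is therefore
  -- entire and doubly periodic. So `l` is an exponential.
  have hlog : ∀ z, deriv l z / l z = deriv l 0 / l 0 := fun z =>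
    constant_of_doublyPeriodic (f := fun z => deriv l z / l z)
      (fun z => (hld' z).div (hld z) (hl0 z)) (exists_real_combination hτ)
      (fun z => by simp only [hl1, hd1])
      (fun z => by simp only [hl2, hd2]; rw [mul_div_mul_left _ _ (ee_ne_zero _)]) z 0
  set a := deriv l 0 / l 0
  have hconst : ∀ z, l z * Complex.exp (-(a * z)) = l 0 := by
    intro z
    have hd : ∀ z, HasDerivAt (fun z => l z * Complex.exp (-(a * z))) 0 z := by
      intro z
      have h1 := (hld z).hasDerivAt.mul (((hasDerivAt_id z).const_mul a).neg.cexp)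
      refine h1.congr_deriv ?_
      have := hlog z
      rw [div_eq_iff (hl0 z)] at this
      rw [this]
      simp only [id]
      ring
    have := is_const_of_deriv_eq_zero (fun z => (hd z).differentiableAt) (fun z => (hd z).deriv) z 0
    simpa using this
  have hform : ∀ z, l z = l 0 * Complex.exp (a * z) := by
    intro z
    rw [← hconst z, mul_assoc, ← Complex.exp_add]; simp
  have e1 : Complex.exp (a * (1 / 2)) = 1 := by
    have h1 := hl1 0
    rw [zero_add, hform (1 / 2)] at h1
    exact mul_left_cancel₀ (hl0 0) (by rw [h1, mul_one])
  have e2 : Complex.exp (a * (τ / 2)) = ee (-p) := by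
    have h1 := hl2 0
    rw [zero_add, hform (τ / 2), mul_comm (ee _)] at h1
    exact mul_left_cancel₀ (hl0 0) h1
  rw [Complex.exp_eq_one_iff] at e1
  obtain ⟨k, hk⟩ := e1
  -- The half-period `1/2` forces `a = 4πik`; the half-period `τ/2` then gives `e(kτ) = e(-p)`.
  have e3 : ee (p + k * τ) = 1 := by
    have : ee (k * τ) = ee (-p) := by
      rw [← e2, ee]
      congr 1
      linear_combination (-τ) * hk
    rw [ee_add, this, ee_neg, mul_inv_cancel₀ (ee_ne_zero p)]
  obtain ⟨n, hn⟩ := ee_eq_one_iff.1 e3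
  exact ⟨n, -k, by push_cast; linear_combination hn⟩

/-- The zeros of the odd theta function lie in the period lattice. -/
theorem oddTheta_ne_zero (hτ : 0 < τ.im) {p : ℂ} (hp : p ∉ periods τ) : oddTheta τ p ≠ 0 := by
  intro h0
  -- By the addition formula this determinant is `θ(2y + p)θ(p)`. Its vanishing makes the pair of
  -- theta constants at `y + p` proportional to the pair at `y`.
  have hdet : ∀ y, thetaEven τ (y + p) * thetaHalf τ y = thetaHalf τ (y + p) * thetaEven τ y := by
    intro y
    have := oddTheta_mul_oddTheta hτ (y + p) y
    rw [add_sub_cancel_left, h0, mul_zero] at this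
    linear_combination -this
  refine hp (mem_periods_of_translate hτ (l := fun y => if thetaEven τ y = 0 then
    thetaHalf τ (y + p) / thetaHalf τ y else thetaEven τ (y + p) / thetaEven τ y) ?_ ?_)
  · intro y
    split_ifs with h
    · have h' := (thetaEven_ne_zero_or hτ y).resolve_left (not_not.2 h)
      have := hdet y
      rw [h, mul_zero] at this ⊢
      exact (mul_eq_zero.1 this).resolve_right h'
    · rw [div_mul_cancel₀ _ h]
  · intro y
    split_ifs with h
    · have h' := (thetaEven_ne_zero_or hτ y).resolve_left (not_not.2 h)
      rw [div_mul_cancel₀ _ h']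
    · rw [div_mul_eq_mul_div, eq_div_iff h, hdet]

/-- The Wronskian of the two theta constants at `x` is `θ(2x)θ'(0)`, by differentiating the addition
formula. If it vanished identically, the theta constants would be proportional, first on a disc and
then everywhere, and the determinant `θ(w)²` would be zero for all `w`. -/
theorem deriv_oddTheta_zero_ne_zero (hτ : 0 < τ.im) : deriv (oddTheta τ) 0 ≠ 0 := by
  intro h0
  have hdE := differentiable_thetaEven hτ
  have hdH := differentiable_thetaHalf hτ
  have hdθ := differentiable_oddTheta hτ
  have hW : ∀ x, deriv (thetaEven τ) x * thetaHalf τ x = deriv (thetaHalf τ) x * thetaEven τ x := by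
    intro x
    have h1 : HasDerivAt (fun y => oddTheta τ (y + x) * oddTheta τ (y - x)) 0 x := by
      have e1 : HasDerivAt (fun y => oddTheta τ (y + x)) (deriv (oddTheta τ) (x + x)) x := by
        simpa using (hdθ (x + x)).hasDerivAt.comp_add_const x x
      have e2 : HasDerivAt (fun y => oddTheta τ (y - x)) (deriv (oddTheta τ) (x - x)) x := by
        simpa using (hdθ (x - x)).hasDerivAt.comp_sub_const x x
      refine (e1.mul e2).congr_deriv ?_
      rw [sub_self, h0, oddTheta_zero]; ring
    have h2 := ((hdE x).hasDerivAt.mul_const (thetaHalf τ x)).sub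
      ((hdH x).hasDerivAt.mul_const (thetaEven τ x))
    have h3 := h1.unique (h2.congr_of_eventuallyEq
      (Eventually.of_forall fun y => oddTheta_mul_oddTheta hτ y x))
    linear_combination -h3
  have hex : ∃ x, thetaHalf τ x ≠ 0 := by
    rcases thetaEven_ne_zero_or hτ 0 with h | h
    · refine ⟨τ / 2, ?_⟩
      have := thetaHalf_add_half_tau (τ := τ) 0
      rw [zero_add] at this
      rw [this]
      exact mul_ne_zero (ee_ne_zero _) h
    · exact ⟨0, h⟩
  obtain ⟨x, hx⟩ := hex
  obtain ⟨ε, hε, hball⟩ := Metric.eventually_nhds_iff_ball.1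
    (hdH.continuous.continuousAt.eventually_ne hx)
  have hratio : ∀ y ∈ Metric.ball x ε,
      thetaEven τ y / thetaHalf τ y = thetaEven τ x / thetaHalf τ x := by
    intro y hy
    refine (convex_ball x ε).is_const_of_fderivWithin_eq_zero (𝕜 := ℂ)
      (f := fun y => thetaEven τ y / thetaHalf τ y) ?_ ?_ hy (Metric.mem_ball_self hε)
    · intro w hw
      exact ((hdE w).div (hdH w) (hball w hw)).differentiableWithinAt
    · intro w hw
      have hd : HasDerivAt (fun y => thetaEven τ y / thetaHalf τ y) _ w :=
        (hdE w).hasDerivAt.div (hdH w).hasDerivAt (hball w hw)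
      rw [show deriv (thetaEven τ) w * thetaHalf τ w - thetaEven τ w * deriv (thetaHalf τ) w = 0 by
        rw [hW]; ring, zero_div] at hd
      rw [fderivWithin_of_isOpen Metric.isOpen_ball hw, hd.hasFDerivAt.fderiv]
      ext; simp
  have hall : thetaEven τ = fun y => thetaEven τ x / thetaHalf τ x * thetaHalf τ y := by
    refine AnalyticOnNhd.eq_of_eventuallyEq (𝕜 := ℂ) (z₀ := x)
      (fun z _ => hdE.analyticAt z) (fun z _ => (hdH.const_mul _).analyticAt z) ?_
    filter_upwards [Metric.ball_mem_nhds x hε] with y hy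
    rw [← hratio y hy, div_mul_cancel₀ _ (hball y hy)]
  obtain ⟨w, hw⟩ := oddTheta_exists_ne_zero hτ
  have h4 := oddTheta_mul_oddTheta hτ (w / 2 + w / 2) (w / 2 - w / 2)
  rw [hall] at h4
  have h5 : oddTheta τ w * oddTheta τ w = 0 := by
    convert h4 using 1
    · ring_nf
    · ring
  exact hw (mul_self_eq_zero.1 h5)

end Theta

/-! ### Kronecker and Eisenstein functions -/

section Kronecker

open Filter Topology

variable {τ : ℂ}

theorem kronecker_add_one_right (u z : ℂ) : kronecker τ u (z + 1) = kronecker τ u z := by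
  unfold kronecker
  rw [← add_assoc, oddTheta_add_one, oddTheta_add_one, neg_mul, mul_neg, neg_div_neg_eq]

theorem kronecker_neg_neg (u z : ℂ) : kronecker τ (-u) (-z) = -kronecker τ u z := by
  unfold kronecker
  rw [← neg_add, oddTheta_neg, oddTheta_neg, oddTheta_neg, neg_mul_neg, neg_mul, neg_div]

theorem kronecker_add_tau (u z : ℂ) : kronecker τ (u + τ) z = ee (-z) * kronecker τ u z := by
  unfold kronecker
  rw [add_right_comm, oddTheta_add_tau, oddTheta_add_tau,
    show -(u + z) - τ / 2 = -z + (-u - τ / 2) by ring, ee_add]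
  have := ee_ne_zero (-u - τ / 2)
  rw [show -(ee (-z) * ee (-u - τ / 2)) * oddTheta τ (u + z) * deriv (oddTheta τ) 0 =
    (-ee (-u - τ / 2)) * (ee (-z) * (oddTheta τ (u + z) * deriv (oddTheta τ) 0)) by ring,
    mul_assoc (-ee (-u - τ / 2)), mul_div_mul_left _ _ (neg_ne_zero.2 this), mul_div_assoc]

theorem kronecker_add_int_mul_tau (k : ℤ) (u z : ℂ) :
    kronecker τ (u + k * τ) z = ee (-(k * z)) * kronecker τ u z := by
  induction k using Int.induction_on with
  | zero => simp [ee_zero]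
  | succ n ih =>
    push_cast at ih ⊢
    rw [add_mul, one_mul, ← add_assoc, kronecker_add_tau, ih, ← mul_assoc, ← ee_add]
    ring_nf
  | pred n ih =>
    have := kronecker_add_tau (τ := τ) (u + ((-(n : ℤ) - 1 : ℤ) : ℂ) * τ) z
    rw [show u + ((-(n : ℤ) - 1 : ℤ) : ℂ) * τ + τ = u + ((-(n : ℤ) : ℤ) : ℂ) * τ by
      push_cast; ring, ih] at this
    refine mul_left_cancel₀ (ee_ne_zero (-z)) ?_
    rw [← this, ← mul_assoc, ← ee_add]
    push_cast
    ring_nf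

variable {r : ℕ}

/-- The prefactor `e(mz/r)` exactly compensates the multiplier `e(-kz)` of `φ` under `u ↦ u + kτ`,
so the degree matters only mod `r`. -/
theorem gTw_add_mul (hr : r ≠ 0) (m k : ℤ) (u z : ℂ) :
    gTw τ r (m + r * k) u z = gTw τ r m u z := by
  have hr' : (r : ℂ) ≠ 0 := Nat.cast_ne_zero.2 hr
  unfold gTw
  rw [show u + ((m + r * k : ℤ) : ℂ) * τ / r = u + m * τ / r + k * τ by
    push_cast; field_simp; ring, kronecker_add_int_mul_tau, ← mul_assoc, ← ee_add]
  congr 2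
  push_cast
  field_simp
  ring

theorem gTw_congr (hr : r ≠ 0) {m n : ℤ} (h : (r : ℤ) ∣ m - n) (u z : ℂ) :
    gTw τ r m u z = gTw τ r n u z := by
  obtain ⟨k, hk⟩ := h
  rw [show m = n + r * k by linarith, gTw_add_mul hr]

theorem gTw_neg (m : ℤ) (u z : ℂ) : gTw τ r (-m) (-u) (-z) = -gTw τ r m u z := by
  unfold gTw
  rw [show -u + ((-m : ℤ) : ℂ) * τ / r = -(u + m * τ / r) by push_cast; ring, kronecker_neg_neg,
    show ((-m : ℤ) : ℂ) * -z / r = m * z / r by push_cast; ring, mul_neg]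

theorem gTw_add_one (m : ℤ) (u z : ℂ) :
    gTw τ r m u (z + 1) = ee (m / r) * gTw τ r m u z := by
  unfold gTw
  rw [kronecker_add_one_right, ← mul_assoc, ← ee_add]
  ring_nf

theorem deriv_oddTheta_neg (z : ℂ) : deriv (oddTheta τ) (-z) = deriv (oddTheta τ) z := by
  have h : deriv (fun x => oddTheta τ (-x)) z = -deriv (oddTheta τ) (-z) := deriv_comp_neg _ _
  rw [show (fun x => oddTheta τ (-x)) = fun x => -oddTheta τ x from funext oddTheta_neg,
    deriv.fun_neg] at h
  exact (neg_injective h).symm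

theorem eisensteinE1_neg (z : ℂ) : eisensteinE1 τ (-z) = -eisensteinE1 τ z := by
  unfold eisensteinE1
  rw [deriv_oddTheta_neg, oddTheta_neg, div_neg]

theorem eisensteinE1_add_one (z : ℂ) : eisensteinE1 τ (z + 1) = eisensteinE1 τ z := by
  unfold eisensteinE1
  rw [← deriv_comp_add_const, funext oddTheta_add_one, deriv.fun_neg, oddTheta_add_one,
    neg_div_neg_eq]

/-- The three-term identity with the half-sum arguments that make its factors `x+z`, `y+w`, `x+y`,
`z-w` and so on. -/
theorem oddTheta_fay (hτ : 0 < τ.im) (x y z w : ℂ) :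
    oddTheta τ (x + z) * oddTheta τ (y + w) * oddTheta τ (x + y) * oddTheta τ (z - w) =
      oddTheta τ (x + (z - w)) * oddTheta τ (x + y + w) * oddTheta τ y * oddTheta τ z -
        oddTheta τ (y + (w - z)) * oddTheta τ (x + y + z) * oddTheta τ x * oddTheta τ w := by
  have h := oddTheta_three_term hτ ((x + y + z + w) / 2) ((x + z - y - w) / 2)
    ((x + y + z - w) / 2) ((x + y - z + w) / 2)
  rw [show (x + y + z + w) / 2 + (x + z - y - w) / 2 = x + z by ring,
    show (x + y + z + w) / 2 - (x + z - y - w) / 2 = y + w by ring,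
    show (x + y + z - w) / 2 + (x + y - z + w) / 2 = x + y by ring,
    show (x + y + z - w) / 2 - (x + y - z + w) / 2 = z - w by ring,
    show (x + y + z + w) / 2 + (x + y + z - w) / 2 = x + y + z by ring,
    show (x + y + z + w) / 2 - (x + y + z - w) / 2 = w by ring,
    show (x + z - y - w) / 2 + (x + y - z + w) / 2 = x by ring,
    show (x + z - y - w) / 2 - (x + y - z + w) / 2 = -(y + (w - z)) by ring,
    show (x + y + z + w) / 2 + (x + y - z + w) / 2 = x + y + w by ring,
    show (x + y + z + w) / 2 - (x + y - z + w) / 2 = z by ring,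
    show (x + z - y - w) / 2 + (x + y + z - w) / 2 = x + (z - w) by ring,
    show (x + z - y - w) / 2 - (x + y + z - w) / 2 = -y by ring,
    oddTheta_neg, oddTheta_neg] at h
  linear_combination h

theorem neg_notMem_periods {x : ℂ} (hx : x ∉ periods τ) : -x ∉ periods τ := fun h =>
  hx (neg_mem_periods_iff.1 h)

/-- Fay's identity. -/
theorem kronecker_fay (hτ : 0 < τ.im) {x y z w : ℂ} (hx : x ∉ periods τ) (hy : y ∉ periods τ)
    (hxy : x + y ∉ periods τ) (hz : z ∉ periods τ) (hw : w ∉ periods τ)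
    (hzw : z - w ∉ periods τ) :
    kronecker τ x z * kronecker τ y w =
      kronecker τ x (z - w) * kronecker τ (x + y) w +
        kronecker τ y (w - z) * kronecker τ (x + y) z := by
  have h := oddTheta_fay hτ x y z w
  have hx := oddTheta_ne_zero hτ hx
  have hy := oddTheta_ne_zero hτ hy
  have hxy := oddTheta_ne_zero hτ hxy
  have hz := oddTheta_ne_zero hτ hz
  have hw := oddTheta_ne_zero hτ hw
  have hzw := oddTheta_ne_zero hτ hzw
  have hwz : oddTheta τ (w - z) = -oddTheta τ (z - w) := by rw [← oddTheta_neg, neg_sub]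
  unfold kronecker
  rw [hwz]
  generalize deriv (oddTheta τ) 0 = d
  field_simp
  linear_combination d ^ 2 * h

/-- The `y`-derivative of `oddTheta_fay` at `y = -x`. Differentiating the identity between theta
functions avoids a limit at the pole of `φ(x + y, ·)`. -/
theorem oddTheta_fay_degenerate (hτ : 0 < τ.im) (x z w : ℂ) :
    oddTheta τ (x + z) * oddTheta τ (x - w) * deriv (oddTheta τ) 0 * oddTheta τ (z - w) =
      oddTheta τ (x + (z - w)) * oddTheta τ x *
          (deriv (oddTheta τ) w * oddTheta τ z - deriv (oddTheta τ) z * oddTheta τ w) +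
        (deriv (oddTheta τ) (x + (z - w)) * oddTheta τ x -
          oddTheta τ (x + (z - w)) * deriv (oddTheta τ) x) * oddTheta τ z * oddTheta τ w := by
  have hd := differentiable_oddTheta hτ
  have hs : ∀ a y : ℂ, HasDerivAt (fun y => oddTheta τ (y + a)) (deriv (oddTheta τ) (y + a)) y :=
    fun a y => (hd (y + a)).hasDerivAt.comp_add_const y a
  have hs' : ∀ a y : ℂ, HasDerivAt (fun y => oddTheta τ (x + y + a))
      (deriv (oddTheta τ) (x + y + a)) y := fun a y => by
    have := hs (x + a) y
    rw [show (fun y => oddTheta τ (y + (x + a))) = fun y => oddTheta τ (x + y + a) from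
      funext fun y => by ring_nf, show y + (x + a) = x + y + a by ring] at this
    exact this
  have hs0 : HasDerivAt (fun y => oddTheta τ (x + y)) (deriv (oddTheta τ) 0) (-x) := by
    have := hs' 0 (-x)
    simpa using this
  have hy0 : HasDerivAt (fun y => oddTheta τ y) (deriv (oddTheta τ) x) (-x) := by
    have := (hd (-x)).hasDerivAt
    rwa [deriv_oddTheta_neg] at this
  have hL := ((((hs w (-x)).mul hs0).const_mul (oddTheta τ (x + z))).mul_const
    (oddTheta τ (z - w)))
  have hR := (((((hs' w (-x)).mul hy0).const_mul (oddTheta τ (x + (z - w)))).mul_const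
    (oddTheta τ z))).sub
    (((((hs (w - z) (-x)).mul (hs' z (-x))).mul_const (oddTheta τ x)).mul_const (oddTheta τ w)))
  have h := hL.unique (hR.congr_of_eventuallyEq (Eventually.of_forall fun y => by
    have := oddTheta_fay hτ x y z w
    simp only [Pi.mul_apply, Pi.sub_apply]
    linear_combination this))
  simp only [add_neg_cancel, zero_add, oddTheta_zero, mul_zero] at h
  rw [show -x + w = -(x - w) by ring, show -x + (w - z) = -(x + (z - w)) by ring,
    oddTheta_neg, oddTheta_neg, oddTheta_neg, deriv_oddTheta_neg] at h
  linear_combination -h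

theorem hasDerivAt_kronecker (hτ : 0 < τ.im) {x : ℂ} (hx : x ∉ periods τ) (z : ℂ) :
    HasDerivAt (fun y => kronecker τ y z)
      (deriv (oddTheta τ) 0 / oddTheta τ z * ((deriv (oddTheta τ) (x + z) * oddTheta τ x -
        oddTheta τ (x + z) * deriv (oddTheta τ) x) / oddTheta τ x ^ 2)) x := by
  have hd := differentiable_oddTheta hτ
  have h1 : HasDerivAt (fun y => oddTheta τ (y + z)) (deriv (oddTheta τ) (x + z)) x :=
    (hd (x + z)).hasDerivAt.comp_add_const x z
  have h2 := (h1.div (hd x).hasDerivAt (oddTheta_ne_zero hτ hx)).const_mul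
    (deriv (oddTheta τ) 0 / oddTheta τ z)
  refine h2.congr_of_eventuallyEq (Eventually.of_forall fun y => ?_)
  simp only [kronecker, Pi.div_apply]
  rw [div_mul_div_comm, mul_comm (oddTheta τ z), mul_comm (oddTheta τ (y + z))]

/-- The degenerate Fay identity. -/
theorem kronecker_fay_degenerate (hτ : 0 < τ.im) {x z w : ℂ} (hx : x ∉ periods τ)
    (hz : z ∉ periods τ) (hw : w ∉ periods τ) (hzw : z - w ∉ periods τ) :
    kronecker τ x z * kronecker τ (-x) w =
      kronecker τ x (z - w) * (eisensteinE1 τ w - eisensteinE1 τ z) +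
        deriv (fun y => kronecker τ y (z - w)) x := by
  rw [(hasDerivAt_kronecker hτ hx _).deriv]
  have h := oddTheta_fay_degenerate hτ x z w
  have hx := oddTheta_ne_zero hτ hx
  have hz := oddTheta_ne_zero hτ hz
  have hw := oddTheta_ne_zero hτ hw
  have hzw := oddTheta_ne_zero hτ hzw
  unfold kronecker eisensteinE1
  rw [show -x + w = -(x - w) by ring, oddTheta_neg, oddTheta_neg]
  generalize deriv (oddTheta τ) 0 = d at *
  field_simp
  linear_combination d * h

/-- The derivative of `gTw` in the dynamical variable. -/
def dgTw (τ : ℂ) (r : ℕ) (m : ℤ) (u z : ℂ) : ℂ := deriv (fun x => gTw τ r m x z) u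

theorem dgTw_congr (hr : r ≠ 0) {m n : ℤ} (h : (r : ℤ) ∣ m - n) (u z : ℂ) :
    dgTw τ r m u z = dgTw τ r n u z := by
  unfold dgTw
  simp only [gTw_congr hr h]

theorem hasDerivAt_gTw (hτ : 0 < τ.im) {m : ℤ} {u : ℂ} (hu : u + m * τ / r ∉ periods τ) (z : ℂ) :
    HasDerivAt (fun x => gTw τ r m x z) (dgTw τ r m u z) u := by
  refine DifferentiableAt.hasDerivAt ?_
  refine DifferentiableAt.const_mul ?_ _
  exact ((hasDerivAt_kronecker hτ hu z).comp_add_const u _).differentiableAt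

theorem dgTw_eq (m : ℤ) (u z : ℂ) :
    dgTw τ r m u z = ee (m * z / r) * deriv (fun y => kronecker τ y z) (u + m * τ / r) := by
  unfold dgTw gTw
  rw [deriv_const_mul_field, ← deriv_comp_add_const]

/-- Fay's identity at the shifted points `x + mτ/r`, `y + nτ/r`; all three products carry the same
exponential `e((mz + nw)/r)`. -/
theorem gTw_fay (hτ : 0 < τ.im) {m n : ℤ} {x y z w : ℂ} (hx : x + m * τ / r ∉ periods τ)
    (hy : y + n * τ / r ∉ periods τ) (hxy : x + y + (m + n : ℤ) * τ / r ∉ periods τ)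
    (hz : z ∉ periods τ) (hw : w ∉ periods τ) (hzw : z - w ∉ periods τ) :
    gTw τ r m x z * gTw τ r n y w =
      gTw τ r m x (z - w) * gTw τ r (m + n) (x + y) w +
        gTw τ r n y (w - z) * gTw τ r (m + n) (x + y) z := by
  have e : x + y + (m + n : ℤ) * τ / r = x + m * τ / r + (y + n * τ / r) := by push_cast; ring
  rw [e] at hxy
  have h := kronecker_fay hτ hx hy hxy hz hw hzw
  unfold gTw
  rw [e, mul_mul_mul_comm, h, mul_mul_mul_comm (ee _), mul_mul_mul_comm (ee _) (kronecker _ _ _),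
    ← ee_add, ← ee_add, ← ee_add,
    show (m : ℂ) * (z - w) / r + (m + n : ℤ) * w / r = m * z / r + n * w / r by push_cast; ring,
    show (n : ℂ) * (w - z) / r + (m + n : ℤ) * z / r = m * z / r + n * w / r by push_cast; ring]
  ring

theorem gTw_fay_degenerate (hτ : 0 < τ.im) {m : ℤ} {x z w : ℂ} (hx : x + m * τ / r ∉ periods τ)
    (hz : z ∉ periods τ) (hw : w ∉ periods τ) (hzw : z - w ∉ periods τ) :
    gTw τ r m x z * gTw τ r (-m) (-x) w =
      gTw τ r m x (z - w) * (eisensteinE1 τ w - eisensteinE1 τ z) + dgTw τ r m x (z - w) := by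
  have h := kronecker_fay_degenerate hτ hx hz hw hzw
  rw [dgTw_eq]
  unfold gTw
  rw [show -x + (-m : ℤ) * τ / r = -(x + m * τ / r) by push_cast; ring, mul_mul_mul_comm, h,
    ← ee_add, show (m : ℂ) * z / r + (-m : ℤ) * w / r = m * (z - w) / r by push_cast; ring]
  ring

theorem oddTheta_eq_zero_of_mem_periods {z : ℂ} (hz : z ∈ periods τ) : oddTheta τ z = 0 := by
  obtain ⟨a, b, rfl⟩ := hz
  have h1 : ∀ (a : ℤ) z, oddTheta τ z = 0 → oddTheta τ (z + a) = 0 := by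
    intro a z hz
    induction a using Int.induction_on with
    | zero => simpa using hz
    | succ n ih => push_cast at ih ⊢; rw [← add_assoc, oddTheta_add_one, ih, neg_zero]
    | pred n ih =>
      have := oddTheta_add_one (τ := τ) (z + ((-(n : ℤ) - 1 : ℤ) : ℂ))
      rw [show z + ((-(n : ℤ) - 1 : ℤ) : ℂ) + 1 = z + ((-(n : ℤ) : ℤ) : ℂ) by push_cast; ring,
        ih] at this
      exact neg_eq_zero.1 this.symm
  have h2 : ∀ (a : ℤ) z, oddTheta τ z = 0 → oddTheta τ (z + a * τ) = 0 := by
    intro a z hz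
    induction a using Int.induction_on with
    | zero => simpa using hz
    | succ n ih =>
      push_cast at ih ⊢; rw [add_mul, one_mul, ← add_assoc, oddTheta_add_tau, ih, mul_zero]
    | pred n ih =>
      have := oddTheta_add_tau (τ := τ) (z + ((-(n : ℤ) - 1 : ℤ) : ℂ) * τ)
      rw [show z + ((-(n : ℤ) - 1 : ℤ) : ℂ) * τ + τ = z + ((-(n : ℤ) : ℤ) : ℂ) * τ by
        push_cast; ring, ih] at this
      exact (mul_eq_zero.1 this.symm).resolve_left (neg_ne_zero.2 (ee_ne_zero _))
  exact h2 b _ (by simpa using h1 a 0 oddTheta_zero)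

/-! ### Linear independence of the coefficient functions near `z = 0` -/

theorem eventually_notMem_periods_zero (hτ : 0 < τ.im) : ∀ᶠ z in 𝓝[≠] (0 : ℂ), z ∉ periods τ := by
  have h : HasDerivAt (oddTheta τ) (deriv (oddTheta τ) 0) 0 :=
    (differentiable_oddTheta hτ 0).hasDerivAt
  filter_upwards [h.eventually_ne (c := 0) (deriv_oddTheta_zero_ne_zero hτ)] with z hz hp
  exact hz (oddTheta_eq_zero_of_mem_periods hp)

theorem eventually_sub_notMem_periods (hτ : 0 < τ.im) {w : ℂ} (hw : w ∉ periods τ) :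
    ∀ᶠ z in 𝓝[≠] (0 : ℂ), z - w ∉ periods τ := by
  have hc := (differentiable_oddTheta hτ).continuous
  have h1 : ContinuousAt (fun z => oddTheta τ (z - w)) 0 := by fun_prop
  have h2 : oddTheta τ (0 - w) ≠ 0 := by
    rw [zero_sub]
    exact oddTheta_ne_zero hτ (neg_notMem_periods hw)
  filter_upwards [(h1.eventually_ne h2).filter_mono nhdsWithin_le_nhds] with z hz hp
  exact hz (oddTheta_eq_zero_of_mem_periods hp)

/-- Multiply by `θ(z)` and let `z → 0`: only `b θ'(0)` remains, since `E₁` has a pole and the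
constant does not. -/
theorem eisensteinE1_independent (hτ : 0 < τ.im) {a b : ℂ}
    (h : ∀ᶠ z in 𝓝[≠] (0 : ℂ), a + b * eisensteinE1 τ z = 0) : a = 0 ∧ b = 0 := by
  have hd := differentiable_oddTheta hτ
  have hd' : Continuous (deriv (oddTheta τ)) := (hd.contDiff (n := 1)).continuous_deriv_one
  have h1 : ∀ᶠ z in 𝓝[≠] (0 : ℂ), a * oddTheta τ z + b * deriv (oddTheta τ) z = 0 := by
    filter_upwards [h, eventually_notMem_periods_zero hτ] with z hz hp
    have := oddTheta_ne_zero hτ hp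
    unfold eisensteinE1 at hz
    field_simp at hz
    linear_combination hz
  have h2 : Tendsto (fun z => a * oddTheta τ z + b * deriv (oddTheta τ) z) (𝓝[≠] (0 : ℂ))
      (𝓝 (a * oddTheta τ 0 + b * deriv (oddTheta τ) 0)) := by
    refine (Continuous.tendsto ?_ 0).mono_left nhdsWithin_le_nhds
    have := hd.continuous
    fun_prop
  have h3 := tendsto_nhds_unique (h2.congr' h1) tendsto_const_nhds
  rw [oddTheta_zero, mul_zero, zero_add, mul_eq_zero] at h3
  have hb := h3.resolve_right (deriv_oddTheta_zero_ne_zero hτ)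
  subst hb
  obtain ⟨z, hz⟩ := h.exists
  exact ⟨by simpa using hz, rfl⟩

/-- `g` has a simple pole at `z = 0` while `∂g` is regular there, which forces `b = 0`; then `∂g`
must not vanish identically. -/
theorem gTw_independent (hτ : 0 < τ.im) {m : ℤ} {x : ℂ} (hx : x + m * τ / r ∉ periods τ)
    {a b : ℂ} (h : ∀ᶠ z in 𝓝[≠] (0 : ℂ), a * dgTw τ r m x z + b * gTw τ r m x z = 0) :
    a = 0 ∧ b = 0 := by
  have hd := differentiable_oddTheta hτ
  have hdd : Differentiable ℂ (deriv (oddTheta τ)) :=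
    (hd.contDiff (n := 2)).differentiable_deriv_two
  have hd' : Continuous (deriv (oddTheta τ)) := hdd.continuous
  have hc := hd.continuous
  have h0 := deriv_oddTheta_zero_ne_zero hτ
  have hp := oddTheta_ne_zero hτ hx
  set p := x + m * τ / r
  have h1 : ∀ᶠ z in 𝓝[≠] (0 : ℂ), a * (deriv (oddTheta τ) (p + z) * oddTheta τ p -
      oddTheta τ (p + z) * deriv (oddTheta τ) p) + b * oddTheta τ (p + z) * oddTheta τ p = 0 := by
    filter_upwards [h, eventually_notMem_periods_zero hτ] with z hz hzp
    have := oddTheta_ne_zero hτ hzp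
    rw [dgTw_eq, (hasDerivAt_kronecker hτ hx z).deriv] at hz
    unfold gTw kronecker at hz
    have he := ee_ne_zero (m * z / r)
    change a * (ee _ * (deriv (oddTheta τ) 0 / oddTheta τ z * ((deriv (oddTheta τ) (p + z) *
      oddTheta τ p - oddTheta τ (p + z) * deriv (oddTheta τ) p) / oddTheta τ p ^ 2))) +
      b * (ee _ * (oddTheta τ (p + z) * deriv (oddTheta τ) 0 /
        (oddTheta τ p * oddTheta τ z))) = 0 at hz
    field_simp at hz
    refine mul_left_cancel₀ (mul_ne_zero he h0) ?_
    rw [mul_zero]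
    linear_combination hz
  have h2 : Tendsto (fun z => a * (deriv (oddTheta τ) (p + z) * oddTheta τ p -
      oddTheta τ (p + z) * deriv (oddTheta τ) p) + b * oddTheta τ (p + z) * oddTheta τ p)
      (𝓝[≠] (0 : ℂ)) (𝓝 (a * (deriv (oddTheta τ) (p + 0) * oddTheta τ p -
      oddTheta τ (p + 0) * deriv (oddTheta τ) p) + b * oddTheta τ (p + 0) * oddTheta τ p)) := by
    refine (Continuous.tendsto ?_ 0).mono_left nhdsWithin_le_nhds
    fun_prop
  have h3 := tendsto_nhds_unique (h2.congr' h1) tendsto_const_nhds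
  have hb : b = 0 := by
    rw [add_zero] at h3
    have : b * (oddTheta τ p * oddTheta τ p) = 0 := by linear_combination h3
    exact (mul_eq_zero.1 this).resolve_right (mul_ne_zero hp hp)
  refine ⟨?_, hb⟩
  subst hb
  by_contra ha
  have h4 : ∀ᶠ z in 𝓝[≠] (0 : ℂ), deriv (oddTheta τ) (p + z) * oddTheta τ p =
      oddTheta τ (p + z) * deriv (oddTheta τ) p := by
    filter_upwards [h1] with z hz
    have : a * (deriv (oddTheta τ) (p + z) * oddTheta τ p -
      oddTheta τ (p + z) * deriv (oddTheta τ) p) = 0 := by linear_combination hz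
    exact sub_eq_zero.1 ((mul_eq_zero.1 this).resolve_left ha)
  have hs : Differentiable ℂ fun z : ℂ => p + z := by fun_prop
  -- The identity theorem extends the relation to all `z`, and at `z = -p` it reads `θ'(0)θ(p) = 0`.
  have h5 := AnalyticOnNhd.eq_of_frequently_eq (𝕜 := ℂ)
    (fun z _ => ((hdd.comp hs).mul_const (oddTheta τ p)).analyticAt z)
    (fun z _ => ((hd.comp hs).mul_const (deriv (oddTheta τ) p)).analyticAt z) h4.frequently
  have h6 := congrFun h5 (-p)
  simp only [Function.comp_apply, add_neg_cancel, oddTheta_zero, zero_mul] at h6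
  exact mul_ne_zero h0 hp h6

/-- Imaginary parts would give `m = br` with `b` an integer. This is the regularity needed for the
weight-zero vectors `𝔢^m_k`, whatever `𝐮` is. -/
theorem natCast_mul_div_notMem_periods (hτ : 0 < τ.im) {m : ℕ} (h0 : 0 < m) (hm : m < r) :
    (m : ℂ) * τ / r ∉ periods τ := by
  rintro ⟨a, b, h⟩
  have hr : (r : ℂ) ≠ 0 := Nat.cast_ne_zero.2 (by omega)
  have h1 := congrArg Complex.im ((div_eq_iff hr).1 h)
  have h2 : (m : ℝ) * τ.im = b * τ.im * r := by simpa using h1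
  have h3 : (m : ℝ) = b * r := mul_right_cancel₀ hτ.ne' (by linarith)
  have h4 : (m : ℤ) = b * r := by exact_mod_cast h3
  have h5 : (r : ℤ) ∣ m := ⟨b, by rw [h4]; ring⟩
  exact absurd (Nat.le_of_dvd h0 (Int.natCast_dvd_natCast.1 h5)) (by omega)

end Kronecker

/-! ### Pairing of tensors with the invariant form -/

section Pairing

variable {𝔤 : Type*} [LieRing 𝔤] [LieAlgebra ℂ 𝔤]

/-- The invariant form as a bilinear map. -/
def formL (c : ℂ) : 𝔤 →ₗ[ℂ] 𝔤 →ₗ[ℂ] ℂ := c • killingForm ℂ 𝔤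

theorem formL_apply (c : ℂ) (x y : 𝔤) : formL c x y = form c x y := rfl

variable (c : ℂ)

theorem form_add_left (x x' y : 𝔤) : form c (x + x') y = form c x y + form c x' y := by
  simp [← formL_apply]

theorem form_add_right (x y y' : 𝔤) : form c x (y + y') = form c x y + form c x y' := by
  simp [← formL_apply]

theorem form_smul_left (a : ℂ) (x y : 𝔤) : form c (a • x) y = a * form c x y := by
  simp [← formL_apply]

theorem form_smul_right (a : ℂ) (x y : 𝔤) : form c x (a • y) = a * form c x y := by
  simp [← formL_apply]

theorem form_zero_left (y : 𝔤) : form c 0 y = 0 := by simp [← formL_apply]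

theorem form_zero_right (x : 𝔤) : form c x 0 = 0 := by simp [← formL_apply]

theorem form_neg_right (x y : 𝔤) : form c x (-y) = -form c x y := by simp [← formL_apply]

theorem form_sum_left {κ : Type*} (s : Finset κ) (f : κ → 𝔤) (y : 𝔤) :
    form c (∑ i ∈ s, f i) y = ∑ i ∈ s, form c (f i) y := by
  simp [← formL_apply]

theorem form_sum_right {κ : Type*} (s : Finset κ) (x : 𝔤) (f : κ → 𝔤) :
    form c x (∑ i ∈ s, f i) = ∑ i ∈ s, form c x (f i) := by
  simp [← formL_apply]

theorem form_comm (x y : 𝔤) : form c x y = form c y x := by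
  rw [form, form, LieModule.traceForm_comm]

theorem form_lie (x y z : 𝔤) : form c ⁅x, y⁆ z = form c x ⁅y, z⁆ := by
  rw [form, form, LieModule.traceForm_apply_lie_apply]

theorem form_lie_right (x y z : 𝔤) : form c y ⁅x, z⁆ = -form c ⁅x, y⁆ z := by
  rw [← form_lie, ← lie_skew, form, form, map_neg, LinearMap.neg_apply, mul_neg]

/-- The pairing of two-tensors with `x ⊗ y`. -/
def pair2 (x y : 𝔤) : 𝔤 ⊗[ℂ] 𝔤 →ₗ[ℂ] ℂ :=
  TensorProduct.dualDistrib ℂ 𝔤 𝔤 (formL c x ⊗ₜ[ℂ] formL c y)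

/-- The pairing of three-tensors with `x ⊗ y ⊗ w`. -/
def pair3 (x y w : 𝔤) : 𝔤 ⊗[ℂ] (𝔤 ⊗[ℂ] 𝔤) →ₗ[ℂ] ℂ :=
  TensorProduct.dualDistrib ℂ 𝔤 (𝔤 ⊗[ℂ] 𝔤) (formL c x ⊗ₜ[ℂ] pair2 c y w)

/-- Contraction of the second factor of a two-tensor with `y`. -/
def contrR (y : 𝔤) : 𝔤 ⊗[ℂ] 𝔤 →ₗ[ℂ] 𝔤 :=
  (TensorProduct.rid ℂ 𝔤).toLinearMap ∘ₗ LinearMap.lTensor 𝔤 (formL c y)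

/-- Contraction of the first factor of a two-tensor with `x`. -/
def contrL (x : 𝔤) : 𝔤 ⊗[ℂ] 𝔤 →ₗ[ℂ] 𝔤 :=
  (TensorProduct.lid ℂ 𝔤).toLinearMap ∘ₗ LinearMap.rTensor 𝔤 (formL c x)

@[simp] theorem pair2_tmul (x y a b : 𝔤) :
    pair2 c x y (a ⊗ₜ[ℂ] b) = form c x a * form c y b := by
  simp [pair2, formL_apply]

@[simp] theorem pair3_tmul (x y w a : 𝔤) (R : 𝔤 ⊗[ℂ] 𝔤) :
    pair3 c x y w (a ⊗ₜ[ℂ] R) = form c x a * pair2 c y w R := by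
  simp [pair3, formL_apply]

@[simp] theorem contrR_tmul (y a b : 𝔤) : contrR c y (a ⊗ₜ[ℂ] b) = form c y b • a := by
  simp [contrR, formL_apply]

@[simp] theorem contrL_tmul (x a b : 𝔤) : contrL c x (a ⊗ₜ[ℂ] b) = form c x a • b := by
  simp [contrL, formL_apply]

theorem form_contrR (x y : 𝔤) (R : 𝔤 ⊗[ℂ] 𝔤) : form c x (contrR c y R) = pair2 c x y R := by
  induction R with
  | zero => simp [form_zero_right]
  | add R S hR hS => simp [form_add_right, hR, hS]
  | tmul a b => simp [form_smul_right, mul_comm]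

theorem form_contrL (x y : 𝔤) (R : 𝔤 ⊗[ℂ] 𝔤) : form c y (contrL c x R) = pair2 c x y R := by
  induction R with
  | zero => simp [form_zero_right]
  | add R S hR hS => simp [form_add_right, hR, hS]
  | tmul a b => simp [form_smul_right]

theorem br1213_add_left (R R' S : 𝔤 ⊗[ℂ] 𝔤) :
    br1213 (R + R') S = br1213 R S + br1213 R' S := by
  simp [br1213, TensorProduct.add_tmul]

theorem br1213_add_right (R S S' : 𝔤 ⊗[ℂ] 𝔤) :
    br1213 R (S + S') = br1213 R S + br1213 R S' := by
  simp [br1213, TensorProduct.tmul_add]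

theorem br1223_add_left (R R' S : 𝔤 ⊗[ℂ] 𝔤) :
    br1223 (R + R') S = br1223 R S + br1223 R' S := by
  simp only [br1223, TensorProduct.add_tmul, map_add]

theorem br1223_add_right (R S S' : 𝔤 ⊗[ℂ] 𝔤) :
    br1223 R (S + S') = br1223 R S + br1223 R S' := by
  simp only [br1223, TensorProduct.tmul_add, map_add]

theorem br1323_add_left (R R' S : 𝔤 ⊗[ℂ] 𝔤) :
    br1323 (R + R') S = br1323 R S + br1323 R' S := by
  simp only [br1323, TensorProduct.add_tmul, map_add]

theorem br1323_add_right (R S S' : 𝔤 ⊗[ℂ] 𝔤) :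
    br1323 R (S + S') = br1323 R S + br1323 R S' := by
  simp only [br1323, TensorProduct.tmul_add, map_add]

/-- The two factors not touched by the bracket can be contracted beforehand. With its two companions
this reduces the Yang–Baxter brackets to Lie brackets of contractions of `r`. -/
theorem pair3_br1213 (x y w : 𝔤) (R S : 𝔤 ⊗[ℂ] 𝔤) :
    pair3 c x y w (br1213 R S) = form c x ⁅contrR c y R, contrR c w S⁆ := by
  induction R with
  | zero => simp [br1213, form_zero_right]
  | add R R' hR hR' => simp [br1213_add_left, form_add_right, hR, hR']
  | tmul a b =>
    induction S with
    | zero => simp [br1213, form_zero_right]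
    | add S S' hS hS' =>
      rw [br1213_add_right, map_add, map_add, lie_add, form_add_right, hS, hS']
    | tmul a' b' => simp [br1213_tmul, form_smul_right]; ring

theorem pair3_br1223 (x y w : 𝔤) (R S : 𝔤 ⊗[ℂ] 𝔤) :
    pair3 c x y w (br1223 R S) = form c y ⁅contrL c x R, contrR c w S⁆ := by
  induction R with
  | zero => simp [br1223, form_zero_right]
  | add R R' hR hR' => simp [br1223_add_left, form_add_right, hR, hR']
  | tmul a b =>
    induction S with
    | zero => simp [br1223, form_zero_right]
    | add S S' hS hS' =>
      rw [br1223_add_right, map_add, map_add, lie_add, form_add_right, hS, hS']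
    | tmul a' b' => simp [br1223_tmul, form_smul_right]; ring

theorem pair3_br1323 (x y w : 𝔤) (R S : 𝔤 ⊗[ℂ] 𝔤) :
    pair3 c x y w (br1323 R S) = form c w ⁅contrL c x R, contrL c y S⁆ := by
  induction R with
  | zero => simp [br1323, form_zero_right]
  | add R R' hR hR' => simp [br1323_add_left, form_add_right, hR, hR']
  | tmul a b =>
    induction S with
    | zero => simp [br1323, form_zero_right]
    | add S S' hS hS' =>
      rw [br1323_add_right, map_add, map_add, lie_add, form_add_right, hS, hS']
    | tmul a' b' => simp [br1323_tmul, form_smul_right]; ring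

theorem pair2_brL (x y l l' : 𝔤) (R : 𝔤 ⊗[ℂ] 𝔤) :
    pair2 c x y (brL l l' R) =
      form c x ⁅l, contrR c y R⁆ + form c y ⁅l', contrL c x R⁆ := by
  induction R with
  | zero => simp [brL, form_zero_right]
  | add R S hR hS =>
    simp only [brL, map_add, lie_add, form_add_right] at hR hS ⊢
    linear_combination hR + hS
  | tmul a b => simp [brL_tmul, form_smul_right]; ring

theorem pair2_add_left (x x' y : 𝔤) : pair2 c (x + x') y = pair2 c x y + pair2 c x' y := by
  simp [pair2, TensorProduct.add_tmul]

theorem pair2_add_right (x y y' : 𝔤) : pair2 c x (y + y') = pair2 c x y + pair2 c x y' := by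
  simp [pair2, TensorProduct.tmul_add]

theorem pair2_smul_left (a : ℂ) (x y : 𝔤) : pair2 c (a • x) y = a • pair2 c x y := by
  simp [pair2, ← TensorProduct.smul_tmul']

theorem pair2_smul_right (a : ℂ) (x y : 𝔤) : pair2 c x (a • y) = a • pair2 c x y := by
  simp [pair2]

theorem pair2_zero_left (y : 𝔤) : pair2 c (0 : 𝔤) y = 0 := by simp [pair2]

theorem pair2_sum_right {κ : Type*} (s : Finset κ) (x : 𝔤) (f : κ → 𝔤) :
    pair2 c x (∑ i ∈ s, f i) = ∑ i ∈ s, pair2 c x (f i) := by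
  simp [pair2, TensorProduct.tmul_sum]

/-- A three-tensor is determined by its pairings with the elements of a spanning set. -/
theorem pair3_eq_zero_of_span {s : Set 𝔤} (hs : Submodule.span ℂ s = ⊤)
    {X : 𝔤 ⊗[ℂ] (𝔤 ⊗[ℂ] 𝔤)}
    (h : ∀ x ∈ s, ∀ y ∈ s, ∀ w ∈ s, pair3 c x y w X = 0) (x y w : 𝔤) :
    pair3 c x y w X = 0 := by
  have hx : x ∈ Submodule.span ℂ s := hs ▸ trivial
  have hy : y ∈ Submodule.span ℂ s := hs ▸ trivial
  have hw : w ∈ Submodule.span ℂ s := hs ▸ trivial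
  induction hx using Submodule.span_induction with
  | zero => simp [pair3]
  | add a b _ _ ha hb =>
    simp only [pair3, map_add, TensorProduct.add_tmul, LinearMap.add_apply] at ha hb ⊢
    rw [ha, hb, add_zero]
  | smul k a _ ha =>
    simp only [pair3, map_smul, ← TensorProduct.smul_tmul', LinearMap.smul_apply] at ha ⊢
    rw [ha, smul_zero]
  | mem x hx =>
    induction hy using Submodule.span_induction with
    | zero => simp [pair3, pair2]
    | add a b _ _ ha hb =>
      simp only [pair3, pair2_add_left, TensorProduct.tmul_add, map_add,
        LinearMap.add_apply] at ha hb ⊢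
      rw [ha, hb, add_zero]
    | smul k a _ ha =>
      simp only [pair3, pair2_smul_left, TensorProduct.tmul_smul, map_smul,
        LinearMap.smul_apply] at ha ⊢
      rw [ha, smul_zero]
    | mem y hy =>
      induction hw using Submodule.span_induction with
      | zero => simp [pair3, pair2]
      | add a b _ _ ha hb =>
        simp only [pair3, pair2_add_right, TensorProduct.tmul_add, map_add,
          LinearMap.add_apply] at ha hb ⊢
        rw [ha, hb, add_zero]
      | smul k a _ ha =>
        simp only [pair3, pair2_smul_right, TensorProduct.tmul_smul, map_smul,
          LinearMap.smul_apply] at ha ⊢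
        rw [ha, smul_zero]
      | mem w hw => exact h x hx y hy w hw

section Orthonormal

variable {c} {κ : Type*} [Fintype κ] [DecidableEq κ] {T : Module.Basis κ ℂ 𝔤}
  (hT : ∀ a a', form c (T a) (T a') = if a = a' then 1 else 0)
include hT

theorem sum_form_smul (x : 𝔤) : ∑ a, form c (T a) x • T a = x := by
  conv_rhs => rw [← T.sum_repr x]
  refine Finset.sum_congr rfl fun a _ => ?_
  congr 1
  conv_lhs => rw [← T.sum_repr x]
  simp only [form_sum_right, form_smul_right, hT, mul_ite, mul_one, mul_zero, Finset.sum_ite_eq,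
    Finset.mem_univ, if_true]

theorem sum_pair2_smul (R : 𝔤 ⊗[ℂ] 𝔤) :
    ∑ a, ∑ a', pair2 c (T a) (T a') R • (T a ⊗ₜ[ℂ] T a') = R := by
  induction R with
  | zero => simp
  | add R S hR hS => simp only [map_add, add_smul, Finset.sum_add_distrib, hR, hS]
  | tmul x y =>
    conv_rhs => rw [← sum_form_smul hT x, ← sum_form_smul hT y]
    rw [TensorProduct.sum_tmul]
    refine Finset.sum_congr rfl fun a _ => ?_
    simp only [TensorProduct.tmul_sum, pair2_tmul, TensorProduct.smul_tmul_smul]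

theorem eq_of_pair2_eq {R S : 𝔤 ⊗[ℂ] 𝔤}
    (h : ∀ a a', pair2 c (T a) (T a') R = pair2 c (T a) (T a') S) : R = S := by
  rw [← sum_pair2_smul hT R, ← sum_pair2_smul hT S]
  simp only [h]

theorem sum_pair3_smul (X : 𝔤 ⊗[ℂ] (𝔤 ⊗[ℂ] 𝔤)) :
    ∑ a, ∑ b, ∑ d, pair3 c (T a) (T b) (T d) X • (T a ⊗ₜ[ℂ] (T b ⊗ₜ[ℂ] T d)) = X := by
  induction X with
  | zero => simp
  | add R S hR hS => simp only [map_add, add_smul, Finset.sum_add_distrib, hR, hS]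
  | tmul x R =>
    conv_rhs => rw [← sum_form_smul hT x, ← sum_pair2_smul hT R]
    rw [TensorProduct.sum_tmul]
    refine Finset.sum_congr rfl fun a _ => ?_
    simp only [TensorProduct.tmul_sum, pair3_tmul, TensorProduct.smul_tmul_smul]

theorem eq_zero_of_pair3_eq_zero {X : 𝔤 ⊗[ℂ] (𝔤 ⊗[ℂ] 𝔤)}
    (h : ∀ x y w, pair3 c x y w X = 0) : X = 0 := by
  rw [← sum_pair3_smul hT X]
  simp [h]

end Orthonormal

end Pairing

/-! ### The grading defined by a diagram automorphism -/

section Grading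

variable {𝔤 : Type*} [LieRing 𝔤] [LieAlgebra ℂ 𝔤] [FiniteDimensional ℂ 𝔤]
  [LieAlgebra.IsSimple ℂ 𝔤] {H : LieSubalgebra ℂ 𝔤} [H.IsCartanSubalgebra]
  {b : (LieAlgebra.IsKilling.rootSystem H).Base} {r : ℕ}

namespace DiagramAut

variable (N : DiagramAut H b r) (c : ℂ)

theorem iterate_eq_pow (j : ℕ) (x : 𝔤) :
    N.ν^[j] x = ((N.ν : 𝔤 →ₗ[ℂ] 𝔤) ^ j) x := by
  rw [Module.End.pow_apply]; rfl

theorem iterate_smul (j : ℕ) (a : ℂ) (x : 𝔤) : N.ν^[j] (a • x) = a • N.ν^[j] x := by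
  simp only [iterate_eq_pow, map_smul]

theorem iterate_sum (j : ℕ) {κ : Type*} (s : Finset κ) (f : κ → 𝔤) :
    N.ν^[j] (∑ i ∈ s, f i) = ∑ i ∈ s, N.ν^[j] (f i) := by
  simp only [iterate_eq_pow, map_sum]

theorem iterate_lie (j : ℕ) (x y : 𝔤) : N.ν^[j] ⁅x, y⁆ = ⁅N.ν^[j] x, N.ν^[j] y⁆ := by
  induction j with
  | zero => rfl
  | succ j ih => simp only [Function.iterate_succ_apply', ih, LieEquiv.map_lie]

theorem form_map (x y : 𝔤) : form c (N.ν x) (N.ν y) = form c x y := by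
  rw [form, form, LieAlgebra.killingForm_of_equiv_apply]

theorem form_iterate (j : ℕ) (x y : 𝔤) : form c (N.ν^[j] x) (N.ν^[j] y) = form c x y := by
  induction j with
  | zero => rfl
  | succ j ih => simp only [Function.iterate_succ_apply', form_map, ih]

theorem iterate_of_eigen {x : 𝔤} {n : ℤ} (hx : N.ν x = ee (n / r) • x) (j : ℕ) :
    N.ν^[j] x = ee (j * n / r) • x := by
  induction j with
  | zero => simp [ee_zero]
  | succ j ih =>
    rw [Function.iterate_succ_apply', ih, map_smul, hx, smul_smul, ← ee_add]
    push_cast; ring_nf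

/-- The form pairs the eigenspaces `𝔤_m` and `𝔤_n` to zero unless `m + n ≡ 0`. -/
theorem dvd_of_form_ne_zero (hr : r ≠ 0) {x y : 𝔤} {m n : ℤ} (hx : N.ν x = ee (m / r) • x)
    (hy : N.ν y = ee (n / r) • y) (h : form c x y ≠ 0) : (r : ℤ) ∣ m + n := by
  have h1 := N.form_map c x y
  rw [hx, hy, form_smul_left, form_smul_right, ← mul_assoc, ← ee_add] at h1
  have h2 : ee (m / r + n / r) = 1 := mul_right_cancel₀ h (by rw [h1, one_mul])
  obtain ⟨k, hk⟩ := ee_eq_one_iff.1 h2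
  have hr' : (r : ℂ) ≠ 0 := Nat.cast_ne_zero.2 hr
  refine ⟨k, ?_⟩
  field_simp at hk
  have : ((m + n : ℤ) : ℂ) = ((r * k : ℤ) : ℂ) := by push_cast; linear_combination hk
  exact_mod_cast this

theorem eigen_lie {x y : 𝔤} {m n : ℤ} (hx : N.ν x = ee (m / r) • x)
    (hy : N.ν y = ee (n / r) • y) : N.ν ⁅x, y⁆ = ee ((m + n : ℤ) / r) • ⁅x, y⁆ := by
  rw [LieEquiv.map_lie, hx, hy, smul_lie, lie_smul, smul_smul, ← ee_add]
  push_cast; ring_nf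

/-- Applying `ν` shifts the summation index cyclically, because `ν ^ r = 1` identifies the term `j =
r` with the term `j = 0`. -/
theorem twist_eigen (hr : r ≠ 0) (m : ℕ) (x : 𝔤) :
    N.ν (N.twist m x) = ee ((m : ℤ) / r) • N.twist m x := by
  have hr' : (r : ℂ) ≠ 0 := Nat.cast_ne_zero.2 hr
  unfold twist
  set f : ℕ → 𝔤 := fun j => ee (-((j : ℂ) * m) / r) • N.ν^[j] x
  have h1 : N.ν (∑ j ∈ Finset.range r, f j) =
      ee ((m : ℤ) / r) • ∑ j ∈ Finset.range r, f (j + 1) := by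
    rw [map_sum, Finset.smul_sum]
    refine Finset.sum_congr rfl fun j _ => ?_
    simp only [f, map_smul, Function.iterate_succ_apply', smul_smul, ← ee_add]
    congr 2
    push_cast
    ring
  have h2 : f r = f 0 := by
    simp only [f, N.iterate_eq, Function.iterate_zero, id]
    congr 1
    exact ee_eq_of_add_int (-m) (by push_cast; field_simp; ring)
  have h3 := Finset.sum_range_succ f r
  rw [Finset.sum_range_succ', h2] at h3
  rw [h1, add_right_cancel h3]

theorem twist_smul (m : ℕ) (a : ℂ) (x : 𝔤) : N.twist m (a • x) = a • N.twist m x := by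
  simp only [twist, iterate_smul, Finset.smul_sum, smul_comm a]

theorem twist_sum (m : ℕ) {κ : Type*} (s : Finset κ) (f : κ → 𝔤) :
    N.twist m (∑ i ∈ s, f i) = ∑ i ∈ s, N.twist m (f i) := by
  simp only [twist, iterate_sum, Finset.smul_sum]
  exact Finset.sum_comm

/-- The projections to the eigenspaces add up to the identity. -/
theorem sum_twist (x : 𝔤) : ∑ m ∈ Finset.range r, N.twist m x = (r : ℂ) • x := by
  rcases Nat.eq_zero_or_pos r with hr | hr
  · subst hr; simp
  have hr' : (r : ℂ) ≠ 0 := Nat.cast_ne_zero.2 hr.ne'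
  unfold twist
  rw [Finset.sum_comm]
  simp only [← Finset.sum_smul]
  -- A geometric sum of powers of `ω^{-j} ≠ 1`; only `j = 0` contributes to the double sum.
  have key : ∀ j ∈ Finset.range r, j ≠ 0 →
      ∑ m ∈ Finset.range r, ee (-((j : ℂ) * m) / r) = 0 := by
    intro j hj hj0
    have e : ∀ m : ℕ, ee (-((j : ℂ) * m) / r) = ee (-(j : ℂ) / r) ^ m := by
      intro m
      induction m with
      | zero => simp [ee_zero]
      | succ m ih => rw [pow_succ, ← ih, ← ee_add]; push_cast; ring_nf
    simp only [e]
    have h1 := mul_geom_sum (ee (-(j : ℂ) / r)) r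
    rw [← e r, show -((j : ℂ) * r) / r = ((-j : ℤ) : ℂ) by push_cast; field_simp, ee_int,
      sub_self] at h1
    refine (mul_eq_zero.1 h1).resolve_left (sub_ne_zero.2 fun h2 => ?_)
    obtain ⟨k, hk⟩ := ee_eq_one_iff.1 h2
    field_simp at hk
    have h3 : (-(j : ℤ)) = r * k := by exact_mod_cast hk
    have h4 : (r : ℤ) ∣ j := ⟨-k, by linarith⟩
    have h5 := Nat.le_of_dvd (Nat.pos_of_ne_zero hj0) (Int.natCast_dvd_natCast.1 h4)
    exact absurd (Finset.mem_range.1 hj) (by omega)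
  rw [Finset.sum_eq_single_of_mem 0 (Finset.mem_range.2 hr)]
  · simp [ee_zero]
  · intro j hj hj0
    rw [key j hj hj0, zero_smul]

theorem twist_of_eigen (hr : r ≠ 0) {x : 𝔤} {n : ℤ} (hx : N.ν x = ee (n / r) • x) {m : ℕ}
    (h : (r : ℤ) ∣ m - n) : N.twist m x = (r : ℂ) • x := by
  have hr' : (r : ℂ) ≠ 0 := Nat.cast_ne_zero.2 hr
  obtain ⟨k, hk⟩ := h
  have hk' : (m : ℂ) - n = r * k := by exact_mod_cast hk
  unfold twist
  rw [Finset.sum_congr rfl (g := fun _ => x) fun j _ => ?_]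
  · simp [Nat.cast_smul_eq_nsmul]
  · rw [N.iterate_of_eigen hx, smul_smul, ← ee_add]
    rw [show -((j : ℂ) * m) / r + j * n / r = ((-(j * k) : ℤ) : ℂ) by
      push_cast; field_simp; linear_combination (-(j : ℂ)) * hk', ee_int, one_smul]

/-- By invariance of the form `ν^j` can be moved to the eigenvector `y`, where its scalar cancels
`ω^{-jm}`: all `r` summands equal `(y, x)`. -/
theorem form_twist (hr : r ≠ 0) {y : 𝔤} {n : ℤ} (hy : N.ν y = ee (n / r) • y) {m : ℕ}
    (h : (r : ℤ) ∣ m + n) (x : 𝔤) : form c y (N.twist m x) = r * form c y x := by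
  have hr' : (r : ℂ) ≠ 0 := Nat.cast_ne_zero.2 hr
  obtain ⟨k, hk⟩ := h
  have hk' : (m : ℂ) + n = r * k := by exact_mod_cast hk
  unfold twist
  rw [form_sum_right, Finset.sum_congr rfl (g := fun _ => form c y x) fun j _ => ?_]
  · simp
  · have h1 := N.form_iterate c j y x
    rw [N.iterate_of_eigen hy, form_smul_left] at h1
    rw [form_smul_right, ← h1]
    congr 1
    exact ee_eq_of_add_int (-(j * k)) (by
      push_cast; field_simp; linear_combination (-(j : ℂ)) * hk')

theorem onCartan_coe (h : H) : (N.onCartan h : 𝔤) = N.ν h := rfl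

theorem onCartan_iterate_coe (j : ℕ) (h : H) : (N.onCartan^[j] h : 𝔤) = N.ν^[j] h := by
  induction j with
  | zero => rfl
  | succ j ih => rw [Function.iterate_succ_apply', Function.iterate_succ_apply', onCartan_coe, ih]

theorem onCartan_eq_iff {h : H} : N.onCartan h = h ↔ N.ν (h : 𝔤) = h := by
  rw [← onCartan_coe, Subtype.ext_iff]

theorem twist_mem_cartan (m : ℕ) (h : H) : N.twist m (h : 𝔤) ∈ H := by
  unfold twist
  refine sum_mem fun j _ => H.smul_mem _ ?_
  rw [← onCartan_iterate_coe]
  exact (N.onCartan^[j] h).2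

/-- The projection of the Cartan subalgebra to its `ν`-invariants. -/
def avg (h : H) : H := (1 / (r : ℂ)) • ⟨N.twist 0 (h : 𝔤), N.twist_mem_cartan 0 h⟩

theorem onCartan_avg (hr : r ≠ 0) (h : H) : N.onCartan (N.avg h) = N.avg h := by
  rw [onCartan_eq_iff]
  have h1 := N.twist_eigen hr 0 (h : 𝔤)
  simp only [Nat.cast_zero, Int.cast_zero, zero_div, ee_zero, one_smul] at h1
  change N.ν ((1 / (r : ℂ)) • N.twist 0 (h : 𝔤)) = (1 / (r : ℂ)) • N.twist 0 (h : 𝔤)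
  rw [map_smul, h1]

/-- Since `ϖ` need not be `ν`-fixed, this is how `α̃(𝐮 + ϖ)` becomes a weight evaluated on `𝔥₀`. -/
theorem avgRoot_eq_avg (α : LieModule.Weight ℂ H 𝔤) (h : H) : N.avgRoot α h = α (N.avg h) := by
  have h1 : N.avg h = (1 / (r : ℂ)) • ∑ j ∈ Finset.range r, N.onCartan^[j] h := by
    unfold avg
    congr 1
    ext
    simp [twist, ee_zero, onCartan_iterate_coe]
  rw [h1, ← LieModule.Weight.toLinear_apply, map_smul, map_sum, smul_eq_mul]
  rfl

theorem avgRoot_of_fixed (hr : r ≠ 0) (α : LieModule.Weight ℂ H 𝔤) {h : H}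
    (hh : N.onCartan h = h) : N.avgRoot α h = α h := by
  have hr' : (r : ℂ) ≠ 0 := Nat.cast_ne_zero.2 hr
  unfold avgRoot
  simp only [Function.iterate_fixed hh]
  simp
  field_simp

theorem avgRoot_avg (hr : r ≠ 0) (α : LieModule.Weight ℂ H 𝔤) (h : H) :
    N.avgRoot α (N.avg h) = N.avgRoot α h := by
  rw [N.avgRoot_of_fixed hr α (N.onCartan_avg hr h), avgRoot_eq_avg]

theorem avgRoot_neg (α : LieModule.Weight ℂ H 𝔤) (h : H) : N.avgRoot (-α) h = -N.avgRoot α h := by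
  simp [avgRoot]

theorem avgRoot_zero (α : LieModule.Weight ℂ H 𝔤) : N.avgRoot α 0 = 0 := by
  rw [avgRoot_eq_avg, ← LieModule.Weight.toLinear_apply]
  have : N.avg 0 = 0 := by
    ext
    simp [avg, twist]
  rw [this, map_zero]

theorem avgRoot_add (α : LieModule.Weight ℂ H 𝔤) (h h' : H) :
    N.avgRoot α (h + h') = N.avgRoot α h + N.avgRoot α h' := by
  simp only [avgRoot_eq_avg, ← LieModule.Weight.toLinear_apply, ← map_add]
  congr 1
  ext
  simp [avg, twist, iterate_eq_pow, Finset.sum_add_distrib]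

theorem avgRoot_smul (α : LieModule.Weight ℂ H 𝔤) (a : ℂ) (h : H) :
    N.avgRoot α (a • h) = a * N.avgRoot α h := by
  simp only [avgRoot_eq_avg, ← LieModule.Weight.toLinear_apply, ← smul_eq_mul, ← map_smul]
  congr 1
  ext
  simp [avg, twist, iterate_eq_pow, Finset.smul_sum, smul_comm a]

theorem avgRoot_sum (α : LieModule.Weight ℂ H 𝔤) {κ : Type*} (s : Finset κ) (f : κ → H) :
    N.avgRoot α (∑ i ∈ s, f i) = ∑ i ∈ s, N.avgRoot α (f i) := by
  classical
  induction s using Finset.induction_on with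
  | empty => simp [avgRoot_zero]
  | insert a s ha ih => rw [Finset.sum_insert ha, Finset.sum_insert ha, avgRoot_add, ih]

/-- The elements orthogonal to the Cartan subalgebra are stable under `ν`. -/
theorem form_cartan_iterate (hr : r ≠ 0) {x : 𝔤} (hx : ∀ h : H, form c (h : 𝔤) x = 0) (j : ℕ)
    (h : H) : form c (h : 𝔤) (N.ν^[j] x) = 0 := by
  induction j generalizing h with
  | zero => exact hx h
  | succ j ih =>
    obtain ⟨s, rfl⟩ := Nat.exists_eq_succ_of_ne_zero hr
    -- Writing `h` as `ν^r h` provides the `ν` that cancels against the outer one, leaving `ν^{r-1}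
    -- h`, still in the Cartan subalgebra.
    rw [Function.iterate_succ_apply', ← N.iterate_eq (h : 𝔤), Function.iterate_succ_apply',
      form_map, ← onCartan_iterate_coe]
    exact ih _

theorem form_cartan_twist (hr : r ≠ 0) {x : 𝔤} (hx : ∀ h : H, form c (h : 𝔤) x = 0) (m : ℕ)
    (h : H) : form c (h : 𝔤) (N.twist m x) = 0 := by
  unfold twist
  rw [form_sum_right]
  refine Finset.sum_eq_zero fun j _ => ?_
  rw [form_smul_right, N.form_cartan_iterate c hr hx, mul_zero]

/-- For `ν h = h`, `ad h` commutes with `ν`, so all `ν^j x` have the same eigenvalue. -/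
theorem lie_twist {x : 𝔤} {α : LieModule.Weight ℂ H 𝔤}
    (hx : x ∈ LieAlgebra.rootSpace H α) (m : ℕ) {h : H} (hh : N.onCartan h = h) :
    ⁅(h : 𝔤), N.twist m x⁆ = α h • N.twist m x := by
  have h1 : ⁅(h : 𝔤), x⁆ = α h • x := LieAlgebra.IsKilling.lie_eq_smul_of_mem_rootSpace hx h
  unfold twist
  rw [lie_sum, Finset.smul_sum]
  refine Finset.sum_congr rfl fun j _ => ?_
  have h2 : N.ν^[j] (h : 𝔤) = h := by rw [← onCartan_iterate_coe, Function.iterate_fixed hh]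
  rw [lie_smul, smul_comm (α h), ← iterate_smul, ← h1, iterate_lie, h2]

end DiagramAut

/-! ### Root vectors -/

theorem form_rootSpace_eq_zero (c : ℂ) {α β : H → ℂ} {x y : 𝔤}
    (hx : x ∈ LieAlgebra.rootSpace H α) (hy : y ∈ LieAlgebra.rootSpace H β) (h : α + β ≠ 0) :
    form c x y = 0 := by
  rw [form, LieAlgebra.killingForm_apply_eq_zero_of_mem_rootSpace_of_add_ne_zero ℂ 𝔤 H hx hy h,
    mul_zero]

theorem form_cartan_rootSpace (c : ℂ) {α : LieModule.Weight ℂ H 𝔤} (hα : α ∈ H.root) {x : 𝔤}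
    (hx : x ∈ LieAlgebra.rootSpace H α) (h : H) : form c (h : 𝔤) x = 0 := by
  refine form_rootSpace_eq_zero c (α := 0)
    (LieAlgebra.toLieSubmodule_le_rootSpace_zero ℂ 𝔤 H h.2) hx ?_
  rw [zero_add]
  simpa using hα

theorem neg_mem_root {α : LieModule.Weight ℂ H 𝔤} (hα : α ∈ H.root) : -α ∈ H.root := by
  simpa using hα

/-- The root space decomposition, with one-dimensional root spaces and zero weight space `H`. -/
theorem mem_span_of_rootVectors {E : LieModule.Weight ℂ H 𝔤 → 𝔤}
    (hE : ∀ α ∈ H.root, E α ∈ LieAlgebra.rootSpace H α) (hE0 : ∀ α ∈ H.root, E α ≠ 0)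
    {p : Submodule ℂ 𝔤} (hp : ∀ h : H, (h : 𝔤) ∈ p) (hpE : ∀ α ∈ H.root, E α ∈ p) : p = ⊤ := by
  rw [eq_top_iff, ← LieSubmodule.top_toSubmodule (R := ℂ) (L := H) (M := 𝔤),
    ← LieModule.iSup_genWeightSpace_eq_top' ℂ H 𝔤, LieSubmodule.iSup_toSubmodule]
  refine iSup_le fun α => ?_
  by_cases hα : α.IsZero
  · intro x hx
    have h1 : (α : H → ℂ) = 0 := hα
    rw [h1] at hx
    have h2 : x ∈ LieAlgebra.zeroRootSubalgebra ℂ 𝔤 H := hx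
    rw [LieAlgebra.zeroRootSubalgebra_eq_of_is_cartan] at h2
    exact hp ⟨x, h2⟩
  · have hα' : α ∈ H.root := by simpa using hα
    intro x hx
    obtain ⟨a, ha⟩ := (finrank_eq_one_iff_of_nonzero' (⟨E α, hE α hα'⟩ : LieAlgebra.rootSpace H α)
      (fun h => hE0 α hα' (congrArg Subtype.val h))).1
      (LieAlgebra.IsKilling.finrank_rootSpace_eq_one α hα) ⟨x, hx⟩
    have : x = a • E α := (congrArg Subtype.val ha).symm
    rw [this]
    exact p.smul_mem _ (hpE α hα')

end Grading

/-! ### Contractions of the root and Cartan tensors -/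

section Adapted

variable {𝔤 : Type*} [LieRing 𝔤] [LieAlgebra ℂ 𝔤] [FiniteDimensional ℂ 𝔤]
  [LieAlgebra.IsSimple ℂ 𝔤] {H : LieSubalgebra ℂ 𝔤} [H.IsCartanSubalgebra]
  {b : (LieAlgebra.IsKilling.rootSystem H).Base} {r : ℕ}

/-- Invariance of the form: vectors that pair nontrivially have opposite weights. -/
theorem add_eq_zero_of_form_ne_zero (c : ℂ) {h x y : 𝔤} {a a' : ℂ} (hx : ⁅h, x⁆ = a • x)
    (hy : ⁅h, y⁆ = a' • y) (hxy : form c x y ≠ 0) : a + a' = 0 := by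
  have h1 := form_lie_right c h x y
  rw [hx, hy, form_smul_left, form_smul_right] at h1
  exact (mul_eq_zero.1 (show (a + a') * form c x y = 0 by linear_combination h1)).resolve_right hxy

theorem sum_ite_dvd_sub (hr : r ≠ 0) (n : ℤ) (a : ℂ) :
    ∑ m ∈ Finset.range r, (if (r : ℤ) ∣ m - n then a else 0) = a := by
  have hr' : (0 : ℤ) < r := by exact_mod_cast Nat.pos_of_ne_zero hr
  have h0 := Int.emod_nonneg n hr'.ne'
  have h1 := Int.emod_lt_of_pos n hr'
  have h2 : (((n % r).toNat : ℕ) : ℤ) = n % r := Int.toNat_of_nonneg h0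
  have h3 := Int.emod_add_mul_ediv n r
  rw [Finset.sum_eq_single_of_mem (n % r).toNat (Finset.mem_range.2 (by omega)), if_pos]
  · rw [h2]; exact ⟨-(n / r), by linarith⟩
  · intro m hm hne
    rw [if_neg]
    intro hd
    have h4 : (r : ℤ) ∣ m - n % r := by
      have : (m : ℤ) - n % r = (m - n) + r * (n / r) := by linarith
      rw [this]; exact dvd_add hd (dvd_mul_right _ _)
    obtain ⟨k, hk⟩ := h4
    have hm' := Finset.mem_range.1 hm
    have hk0 : k = 0 := by
      by_contra hk0
      rcases lt_or_gt_of_ne hk0 with h | h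
      · have : (r : ℤ) * k ≤ r * (-1) := mul_le_mul_of_nonneg_left (by omega) hr'.le
        omega
      · have : (r : ℤ) * 1 ≤ r * k := mul_le_mul_of_nonneg_left (by omega) hr'.le
        omega
    rw [hk0, mul_zero] at hk
    omega

namespace AdaptedBasis

variable {N : DiagramAut H b r} {c : ℂ} {ι₀ ι₁ : Type*} [DecidableEq ι₀] [DecidableEq ι₁]
  (B : AdaptedBasis N c ι₀ ι₁)

theorem form_E_E {α β : LieModule.Weight ℂ H 𝔤} (hα : α ∈ H.root) (hβ : β ∈ H.root)
    (h : α ≠ -β) : form c (B.E α) (B.E β) = 0 := by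
  refine form_rootSpace_eq_zero c (B.E_mem α hα) (B.E_mem β hβ) fun h1 => h ?_
  ext x
  simpa [add_eq_zero_iff_eq_neg] using congrFun h1 x

theorem E_ne_zero {α : LieModule.Weight ℂ H 𝔤} (hα : α ∈ H.root) : B.E α ≠ 0 := by
  intro h
  have := B.E_pair α hα
  rw [h, form_zero_left] at this
  exact zero_ne_one this

theorem form_cartan_E {α : LieModule.Weight ℂ H 𝔤} (hα : α ∈ H.root) (h : H) :
    form c (h : 𝔤) (B.E α) = 0 := form_cartan_rootSpace c hα (B.E_mem α hα) h

theorem form_ne_zero_nondegenerate (hc : c ≠ 0) {x : 𝔤} (h : ∀ y, form c x y = 0) : x = 0 := by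
  have h1 : x ∈ LinearMap.ker (killingForm ℂ 𝔤) := by
    rw [LinearMap.mem_ker]
    ext y
    exact (mul_eq_zero.1 (h y)).resolve_left hc
  simpa using h1

/-- The Casimir expansion of an element orthogonal to the Cartan subalgebra. -/
theorem sum_form_smul_E (hc : c ≠ 0) {y : 𝔤} (hy : ∀ h : H, form c (h : 𝔤) y = 0) :
    ∑ α ∈ H.root, form c y (B.E (-α)) • B.E α = y := by
  refine (sub_eq_zero.1 (form_ne_zero_nondegenerate hc
    (x := y - ∑ α ∈ H.root, form c y (B.E (-α)) • B.E α) fun z => ?_)).symm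
  -- By nondegeneracy it suffices to test the difference on the Cartan subalgebra and on the root
  -- vectors.
  have hker : LinearMap.ker (formL c (y - ∑ α ∈ H.root, form c y (B.E (-α)) • B.E α)) = ⊤ := by
    refine mem_span_of_rootVectors B.E_mem (fun α hα => B.E_ne_zero hα) ?_ ?_
    · intro h
      rw [LinearMap.mem_ker, map_sub, LinearMap.sub_apply, formL_apply, formL_apply, form_sum_left,
        form_comm, hy, zero_sub, neg_eq_zero]
      refine Finset.sum_eq_zero fun α hα => ?_
      rw [form_smul_left, form_comm c (B.E α), B.form_cartan_E hα, mul_zero]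
    · intro β hβ
      rw [LinearMap.mem_ker, map_sub, LinearMap.sub_apply, formL_apply, formL_apply, form_sum_left,
        Finset.sum_eq_single_of_mem (-β) (neg_mem_root hβ)]
      · rw [form_smul_left, form_comm c (B.E _), neg_neg, B.E_pair β hβ, mul_one, sub_self]
      · intro α hα hne
        rw [form_smul_left, B.form_E_E hα hβ hne, mul_zero]
  have : z ∈ LinearMap.ker (formL c (y - ∑ α ∈ H.root, form c y (B.E (-α)) • B.E α)) :=
    hker ▸ Submodule.mem_top
  exact this

theorem sum_form_smul_E_neg (hc : c ≠ 0) {y : 𝔤} (hy : ∀ h : H, form c (h : 𝔤) y = 0) :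
    ∑ α ∈ H.root, form c y (B.E α) • B.E (-α) = y := by
  conv_rhs => rw [← B.sum_form_smul_E hc hy]
  refine Finset.sum_nbij' (fun α => -α) (fun α => -α) (fun α hα => neg_mem_root hα)
    (fun α hα => neg_mem_root hα) (fun α _ => neg_neg α) (fun α _ => neg_neg α) fun α _ => ?_
  rw [neg_neg]

theorem t_eigen (hr : r ≠ 0) (m : ℕ) (α : LieModule.Weight ℂ H 𝔤) :
    N.ν (B.t m α) = ee ((m : ℤ) / r) • B.t m α := N.twist_eigen hr m _

theorem form_cartan_t (hr : r ≠ 0) (m : ℕ) {α : LieModule.Weight ℂ H 𝔤} (hα : α ∈ H.root) (h : H) :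
    form c (h : 𝔤) (B.t m α) = 0 := N.form_cartan_twist c hr (B.form_cartan_E hα) m h

theorem lie_t (hr : r ≠ 0) (m : ℕ) {α : LieModule.Weight ℂ H 𝔤} (hα : α ∈ H.root) {h : H}
    (hh : N.onCartan h = h) : ⁅(h : 𝔤), B.t m α⁆ = N.avgRoot α h • B.t m α := by
  rw [N.avgRoot_of_fixed hr α hh]
  exact N.lie_twist (B.E_mem α hα) m hh

/-- The tensor `(1/r²) ∑_{m,α} κ(m, α) 𝔱^m_α ⊗ 𝔱^{r-m}_{-α}`. -/
def rootTensor (κ : ℕ → LieModule.Weight ℂ H 𝔤 → ℂ) : 𝔤 ⊗[ℂ] 𝔤 :=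
  (1 / (r : ℂ) ^ 2) • ∑ m ∈ Finset.range r, ∑ α ∈ H.root,
    κ m α • (B.t m α ⊗ₜ[ℂ] B.t (r - m) (-α))

theorem pair2_rootTensor (κ : ℕ → LieModule.Weight ℂ H 𝔤 → ℂ) (x y : 𝔤) :
    pair2 c x y (B.rootTensor κ) = (1 / (r : ℂ) ^ 2) * ∑ m ∈ Finset.range r, ∑ α ∈ H.root,
      κ m α * (form c x (B.t m α) * form c y (B.t (r - m) (-α))) := by
  simp [rootTensor]

/-- Only terms with `m ≡ n` mod `r` and `α̃ = β` on `𝔥₀` pair with `y`, and on these the coefficient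
is the constant `K`. The rest is the degree-`n` projection of the Casimir expansion of `y`;
projecting each tensor factor costs a factor `r`, which cancels `1/r²`. -/
theorem pair2_rootTensor_right (hr : r ≠ 0) (hc : c ≠ 0)
    (κ : ℕ → LieModule.Weight ℂ H 𝔤 → ℂ) {y : 𝔤} {n : ℤ} {β : H → ℂ} {K : ℂ}
    (hy : N.ν y = ee (n / r) • y) (hyH : ∀ h : H, form c (h : 𝔤) y = 0)
    (hw : ∀ h : H, N.onCartan h = h → ⁅(h : 𝔤), y⁆ = β h • y)
    (hK : ∀ (m : ℕ) (α : LieModule.Weight ℂ H 𝔤), (r : ℤ) ∣ m - n →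
      (∀ h : H, N.onCartan h = h → N.avgRoot α h = β h) → κ m α = K) (x : 𝔤) :
    pair2 c x y (B.rootTensor κ) = K * form c x y := by
  have hr' : (r : ℂ) ≠ 0 := Nat.cast_ne_zero.2 hr
  rw [pair2_rootTensor]
  have h1 : ∀ m ∈ Finset.range r, ∑ α ∈ H.root,
      κ m α * (form c x (B.t m α) * form c y (B.t (r - m) (-α))) =
        if (r : ℤ) ∣ m - n then K * (r * (r * form c x y)) else 0 := by
    intro m hm
    have hm' := Finset.mem_range.1 hm
    split_ifs with hd
    · have hd' : (r : ℤ) ∣ ((r - m : ℕ) : ℤ) + n := by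
        rw [Nat.cast_sub hm'.le, show (r : ℤ) - m + n = r - (m - n) by ring]
        exact dvd_sub (dvd_refl _) hd
      -- Apply the degree-`m` twist to the Casimir expansion of `y`: on `y` it is multiplication by
      -- `r`, and it turns `E_α` into `𝔱^m_α`.
      have h2 : r * form c x y = ∑ α ∈ H.root, form c y (B.E (-α)) * form c x (B.t m α) := by
        rw [← form_smul_right, ← N.twist_of_eigen hr hy hd]
        conv_lhs => rw [← B.sum_form_smul_E hc hyH]
        simp only [N.twist_sum, N.twist_smul, form_sum_right, form_smul_right]
        rfl
      rw [h2, Finset.mul_sum, Finset.mul_sum]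
      refine Finset.sum_congr rfl fun α hα => ?_
      have h3 : form c y (B.t (r - m) (-α)) = r * form c y (B.E (-α)) :=
        N.form_twist c hr hy hd' _
      by_cases h4 : form c y (B.t (r - m) (-α)) = 0
      · rw [h4] at h3 ⊢
        rw [(mul_eq_zero.1 h3.symm).resolve_left hr']
        ring
      · rw [hK m α hd, h3]
        · ring
        · intro h hh
          have := add_eq_zero_of_form_ne_zero c (hw h hh)
            (B.lie_t hr (r - m) (neg_mem_root hα) hh) h4
          rw [N.avgRoot_neg] at this
          linear_combination -this
    · refine Finset.sum_eq_zero fun α hα => ?_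
      have h4 : form c y (B.t (r - m) (-α)) = 0 := by
        by_contra h4
        have := N.dvd_of_form_ne_zero c hr hy (B.t_eigen hr (r - m) (-α)) h4
        rw [Nat.cast_sub hm'.le] at this
        refine hd ?_
        rw [show (m : ℤ) - n = r - (n + (r - m)) by ring]
        exact dvd_sub (dvd_refl _) this
      rw [h4]; ring
  rw [Finset.sum_congr rfl h1, sum_ite_dvd_sub hr]
  field_simp

/-- The same mechanism from the other side: the first factor must now have the degree and weight
opposite to those of `x`. -/
theorem pair2_rootTensor_left (hr : r ≠ 0) (hc : c ≠ 0)
    (κ : ℕ → LieModule.Weight ℂ H 𝔤 → ℂ) {x : 𝔤} {n : ℤ} {β : H → ℂ} {K : ℂ}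
    (hx : N.ν x = ee (n / r) • x) (hxH : ∀ h : H, form c (h : 𝔤) x = 0)
    (hw : ∀ h : H, N.onCartan h = h → ⁅(h : 𝔤), x⁆ = β h • x)
    (hK : ∀ (m : ℕ) (α : LieModule.Weight ℂ H 𝔤), (r : ℤ) ∣ m + n →
      (∀ h : H, N.onCartan h = h → N.avgRoot α h = -β h) → κ m α = K) (y : 𝔤) :
    pair2 c x y (B.rootTensor κ) = K * form c x y := by
  have hr' : (r : ℂ) ≠ 0 := Nat.cast_ne_zero.2 hr
  rw [pair2_rootTensor]
  have h1 : ∀ m ∈ Finset.range r, ∑ α ∈ H.root,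
      κ m α * (form c x (B.t m α) * form c y (B.t (r - m) (-α))) =
        if (r : ℤ) ∣ m - (-n) then K * (r * (r * form c x y)) else 0 := by
    intro m hm
    have hm' := Finset.mem_range.1 hm
    rw [sub_neg_eq_add]
    split_ifs with hd
    · have hd' : (r : ℤ) ∣ ((r - m : ℕ) : ℤ) - n := by
        rw [Nat.cast_sub hm'.le, show (r : ℤ) - m - n = r - (m + n) by ring]
        exact dvd_sub (dvd_refl _) hd
      have h2 : r * form c x y = ∑ α ∈ H.root, form c x (B.E α) * form c y (B.t (r - m) (-α)) := by
        rw [form_comm, ← form_smul_right, ← N.twist_of_eigen hr hx hd']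
        conv_lhs => rw [← B.sum_form_smul_E_neg hc hxH]
        simp only [N.twist_sum, N.twist_smul, form_sum_right, form_smul_right]
        rfl
      rw [h2, Finset.mul_sum, Finset.mul_sum]
      refine Finset.sum_congr rfl fun α hα => ?_
      have h3 : form c x (B.t m α) = r * form c x (B.E α) := N.form_twist c hr hx hd _
      by_cases h4 : form c x (B.t m α) = 0
      · rw [h4] at h3 ⊢
        rw [(mul_eq_zero.1 h3.symm).resolve_left hr']
        ring
      · rw [hK m α hd, h3]
        · ring
        · intro h hh
          have := add_eq_zero_of_form_ne_zero c (hw h hh) (B.lie_t hr m hα hh) h4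
          linear_combination this
    · refine Finset.sum_eq_zero fun α hα => ?_
      have h4 : form c x (B.t m α) = 0 := by
        by_contra h4
        have := N.dvd_of_form_ne_zero c hr hx (B.t_eigen hr m α) h4
        exact hd (by rwa [add_comm])
      rw [h4]; ring
  rw [Finset.sum_congr rfl h1, sum_ite_dvd_sub hr]
  field_simp

theorem pair2_rootTensor_cartan_right (hr : r ≠ 0) (κ : ℕ → LieModule.Weight ℂ H 𝔤 → ℂ) (x : 𝔤)
    (h : H) : pair2 c x (h : 𝔤) (B.rootTensor κ) = 0 := by
  rw [pair2_rootTensor, Finset.sum_eq_zero, mul_zero]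
  intro m _
  refine Finset.sum_eq_zero fun α hα => ?_
  rw [B.form_cartan_t hr _ (neg_mem_root hα), mul_zero, mul_zero]

theorem pair2_rootTensor_cartan_left (hr : r ≠ 0) (κ : ℕ → LieModule.Weight ℂ H 𝔤 → ℂ) (y : 𝔤)
    (h : H) : pair2 c (h : 𝔤) y (B.rootTensor κ) = 0 := by
  rw [pair2_rootTensor, Finset.sum_eq_zero, mul_zero]
  intro m _
  refine Finset.sum_eq_zero fun α hα => ?_
  rw [B.form_cartan_t hr _ hα, zero_mul, mul_zero]

theorem e0_eigen (k : ι₀) : N.ν (B.e0 k : 𝔤) = ee (((0 : ℤ) : ℂ) / r) • (B.e0 k : 𝔤) := by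
  rw [N.onCartan_eq_iff.1 (B.e0_fixed k), Int.cast_zero, zero_div, ee_zero, one_smul]

theorem e_eigenvector {m : ℕ} (h0 : 0 < m) (hm : m < r) (k : ι₁) :
    N.ν (B.e m k : 𝔤) = ee (((m : ℤ) : ℂ) / r) • (B.e m k : 𝔤) := by
  rw [← N.onCartan_coe, B.e_eigen m h0 hm, Int.cast_natCast]
  rfl

theorem form_e0_e {m : ℕ} (h0 : 0 < m) (hm : m < r) (k : ι₀) (j : ι₁) :
    form c (B.e m j : 𝔤) (B.e0 k) = 0 := by
  by_contra h
  have := N.dvd_of_form_ne_zero c (by omega) (B.e_eigenvector h0 hm j) (B.e0_eigen k) h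
  have h5 := Int.le_of_dvd (by omega) this
  omega

theorem form_e_e_eq_zero {m n : ℕ} (h0 : 0 < m) (hm : m < r) (h0' : 0 < n) (hn : n < r)
    (h : m + n ≠ r) (j k : ι₁) : form c (B.e m j : 𝔤) (B.e n k) = 0 := by
  by_contra h1
  obtain ⟨l, hl⟩ := N.dvd_of_form_ne_zero c (by omega) (B.e_eigenvector h0 hm j)
    (B.e_eigenvector h0' hn k) h1
  have hl1 : l = 1 := by
    have h2 : 0 < l := by
      by_contra h2
      have : (r : ℤ) * l ≤ r * 0 := mul_le_mul_of_nonneg_left (by omega) (by omega)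
      omega
    have h3 : l < 2 := by
      by_contra h3
      have : (r : ℤ) * 2 ≤ r * l := mul_le_mul_of_nonneg_left (by omega) (by omega)
      omega
    omega
  rw [hl1] at hl
  omega

variable [Fintype ι₀] [Fintype ι₁]

/-- The Cartan part of the `r`-matrix. -/
def cartanTensor (τ z : ℂ) : 𝔤 ⊗[ℂ] 𝔤 :=
  ∑ m ∈ Finset.range r,
    if m = 0 then eisensteinE1 τ z • ∑ k, (B.e0 k : 𝔤) ⊗ₜ[ℂ] (B.e0 k : 𝔤)
    else gTw τ r (-(m : ℤ)) 0 z • ∑ k, (B.e m k : 𝔤) ⊗ₜ[ℂ] (B.e (r - m) k : 𝔤)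

theorem rMatrix_eq (τ : ℂ) (ϖ u : H) (z : ℂ) :
    B.rMatrix τ ϖ u z = B.cartanTensor τ z +
      B.rootTensor fun m α => gTw τ r (-(m : ℤ)) (-N.avgRoot α (u + ϖ)) z := by
  simp only [rMatrix, rComp, cartanTensor, rootTensor, Finset.sum_add_distrib, Finset.smul_sum]

theorem pair2_cartanTensor (τ z : ℂ) (x y : 𝔤) :
    pair2 c x y (B.cartanTensor τ z) = ∑ m ∈ Finset.range r,
      if m = 0 then eisensteinE1 τ z * ∑ k, form c x (B.e0 k) * form c y (B.e0 k)
      else gTw τ r (-(m : ℤ)) 0 z * ∑ k, form c x (B.e m k) * form c y (B.e (r - m) k) := by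
  simp only [cartanTensor, map_sum, apply_ite, map_smul, pair2_tmul, smul_eq_mul]

theorem pair2_cartanTensor_right_of_orthogonal (τ z : ℂ) (x : 𝔤) {y : 𝔤}
    (hy : ∀ h : H, form c (h : 𝔤) y = 0) : pair2 c x y (B.cartanTensor τ z) = 0 := by
  rw [pair2_cartanTensor]
  simp [form_comm c y, hy]

theorem pair2_cartanTensor_left_of_orthogonal (τ z : ℂ) {x : 𝔤} (y : 𝔤)
    (hx : ∀ h : H, form c (h : 𝔤) x = 0) : pair2 c x y (B.cartanTensor τ z) = 0 := by
  rw [pair2_cartanTensor]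
  simp [form_comm c x, hx]

theorem pair2_cartanTensor_e0_right (hr : 0 < r) (τ z : ℂ) (x : 𝔤) (j : ι₀) :
    pair2 c x (B.e0 j) (B.cartanTensor τ z) = eisensteinE1 τ z * form c x (B.e0 j) := by
  rw [pair2_cartanTensor, Finset.sum_eq_single_of_mem 0 (Finset.mem_range.2 hr)]
  · simp [B.e0_pair]
  · intro m hm h0
    rw [if_neg h0]
    have hm' := Finset.mem_range.1 hm
    simp [form_comm c (B.e0 j : 𝔤), B.form_e0_e (show 0 < r - m by omega) (by omega)]

theorem pair2_cartanTensor_e0_left (hr : 0 < r) (τ z : ℂ) (y : 𝔤) (j : ι₀) :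
    pair2 c (B.e0 j : 𝔤) y (B.cartanTensor τ z) = eisensteinE1 τ z * form c (B.e0 j : 𝔤) y := by
  rw [pair2_cartanTensor, Finset.sum_eq_single_of_mem 0 (Finset.mem_range.2 hr)]
  · simp [B.e0_pair, form_comm c y]
  · intro m hm h0
    rw [if_neg h0]
    have hm' := Finset.mem_range.1 hm
    simp [form_comm c (B.e0 j : 𝔤), B.form_e0_e (show 0 < m by omega) hm']

theorem pair2_cartanTensor_e_right {n : ℕ} (h0 : 0 < n) (hn : n < r) (τ z : ℂ) (x : 𝔤) (j : ι₁) :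
    pair2 c x (B.e n j) (B.cartanTensor τ z) = gTw τ r (-(n : ℤ)) 0 z * form c x (B.e n j) := by
  rw [pair2_cartanTensor, Finset.sum_eq_single_of_mem n (Finset.mem_range.2 hn)]
  · rw [if_neg h0.ne']
    simp [B.e_pair n h0 hn]
  · intro m hm hmn
    have hm' := Finset.mem_range.1 hm
    split_ifs with hm0
    · simp [B.form_e0_e h0 hn]
    · simp [B.form_e_e_eq_zero h0 hn (show 0 < r - m by omega) (by omega) (by omega)]

/-- The component selected is `m = r - n`, and `g^{(-(r-n))} = g^{(n)}` by periodicity in the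
degree. -/
theorem pair2_cartanTensor_e_left {n : ℕ} (h0 : 0 < n) (hn : n < r) (τ z : ℂ) (y : 𝔤) (j : ι₁) :
    pair2 c (B.e n j : 𝔤) y (B.cartanTensor τ z) =
      gTw τ r (n : ℤ) 0 z * form c (B.e n j : 𝔤) y := by
  rw [pair2_cartanTensor, Finset.sum_eq_single_of_mem (r - n) (Finset.mem_range.2 (by omega))]
  · rw [if_neg (by omega), gTw_congr (m := -((r - n : ℕ) : ℤ)) (n := n) (by omega)]
    · simp [B.e_pair n h0 hn, show r - (r - n) = n by omega, form_comm c y]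
    · rw [Nat.cast_sub hn.le]
      exact ⟨-1, by ring⟩
  · intro m hm hmn
    have hm' := Finset.mem_range.1 hm
    split_ifs with hm0
    · simp [B.form_e0_e h0 hn]
    · simp [B.form_e_e_eq_zero h0 hn (show 0 < m by omega) hm' (by omega)]

end AdaptedBasis

end Adapted

/-! ### The dynamical Yang–Baxter equation -/

section YangBaxter

variable {𝔤 : Type*} [LieRing 𝔤] [LieAlgebra ℂ 𝔤] [FiniteDimensional ℂ 𝔤]
  [LieAlgebra.IsSimple ℂ 𝔤] {H : LieSubalgebra ℂ 𝔤} [H.IsCartanSubalgebra]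
  {b : (LieAlgebra.IsKilling.rootSystem H).Base} {r : ℕ}

namespace AdaptedBasis

variable {N : DiagramAut H b r} {c : ℂ} {ι₀ ι₁ : Type*} [DecidableEq ι₀] [DecidableEq ι₁]
  [Fintype ι₀] [Fintype ι₁] (B : AdaptedBasis N c ι₀ ι₁)

theorem onCartan_vec (u : ι₀ → ℂ) : N.onCartan (B.vec u) = B.vec u := by
  have h : ((B.vec u : H) : 𝔤) = ∑ k, u k • (B.e0 k : 𝔤) := by
    simp [vec]
  rw [N.onCartan_eq_iff, h, map_sum]
  simp only [map_smul, N.onCartan_eq_iff.1 (B.e0_fixed _)]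

/-- The tensor `(1/r²) ∑ ∂g^{(-m)}_α(z) α̃(h) 𝔱^m_α ⊗ 𝔱^{r-m}_{-α}`. -/
def dynTensor (τ : ℂ) (ϖ u h : H) (z : ℂ) : 𝔤 ⊗[ℂ] 𝔤 :=
  B.rootTensor fun m α => B.dg τ ϖ m α u z * N.avgRoot α h

theorem dg_eq (τ : ℂ) (ϖ : H) (m : ℕ) (α : LieModule.Weight ℂ H 𝔤) (u : H) (z : ℂ) :
    B.dg τ ϖ m α u z = -dgTw τ r (-(m : ℤ)) (-N.avgRoot α (u + ϖ)) z :=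
  deriv_comp_neg (fun x => gTw τ r (-(m : ℤ)) x z) _

theorem anomaly_eq (τ : ℂ) (ϖ u : H) (S : 𝔤) (z : ℂ) :
    B.anomaly τ ϖ u S z = B.dynTensor τ ϖ u (B.cartanPart S) z := rfl

theorem form_dualRoot (w : 𝔤) (α : LieModule.Weight ℂ H 𝔤) :
    form c w (B.dualRoot α) = N.avgRoot α (B.cartanPart w) := by
  have h : ((B.dualRoot α : H) : 𝔤) = ∑ k, N.avgRoot α (B.e0 k) • (B.e0 k : 𝔤) := by
    simp [dualRoot]
  rw [h, form_sum_right, cartanPart, N.avgRoot_sum]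
  simp only [form_smul_right, N.avgRoot_smul, mul_comm]

theorem pair3_dynTerm (τ : ℂ) (ϖ u : H) (z₁ z₂ z₃ : ℂ) (x y w : 𝔤) :
    pair3 c x y w (B.dynTerm τ ϖ u z₁ z₂ z₃) =
      pair2 c x y (B.dynTensor τ ϖ u (B.cartanPart w) (z₁ - z₂)) -
        pair2 c x w (B.dynTensor τ ϖ u (B.cartanPart y) (z₁ - z₃)) +
        pair2 c y w (B.dynTensor τ ϖ u (B.cartanPart x) (z₂ - z₃)) := by
  simp only [dynTensor, pair2_rootTensor, dynTerm, map_smul, map_sum, map_add, map_sub,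
    pair3_tmul, pair2_tmul, form_dualRoot, smul_eq_mul, Finset.sum_add_distrib,
    Finset.sum_sub_distrib, mul_add, mul_sub]
  simp only [Finset.mul_sum]
  congr 1
  · congr 1 <;>
    · refine Finset.sum_congr rfl fun m _ => Finset.sum_congr rfl fun α _ => ?_
      ring
  · refine Finset.sum_congr rfl fun m _ => Finset.sum_congr rfl fun α _ => ?_
    ring

/-- An element of the eigenspace of weight `β` and degree `n`, together with the contraction laws
of the `r`-matrix on this eigenspace. -/
structure IsTwistedVector (τ : ℂ) (ϖ u : H) (x : 𝔤) (n : ℤ) (β : H → ℂ) : Prop where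
  eigen : N.ν x = ee (n / r) • x
  weight : ∀ h : H, N.onCartan h = h → ⁅(h : 𝔤), x⁆ = β h • x
  cartanPart_eq : B.cartanPart x = 0
  regular : β (N.avg (u + ϖ)) + n * τ / r ∉ periods τ
  right : ∀ z y, pair2 c y x (B.rMatrix τ ϖ u z) =
    gTw τ r (-n) (-β (N.avg (u + ϖ))) z * form c y x
  left : ∀ z y, pair2 c x y (B.rMatrix τ ϖ u z) = gTw τ r n (β (N.avg (u + ϖ))) z * form c x y
  dyn_right : ∀ (h : H), N.onCartan h = h → ∀ z y, pair2 c y x (B.dynTensor τ ϖ u h z) =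
    -dgTw τ r (-n) (-β (N.avg (u + ϖ))) z * β h * form c y x
  dyn_left : ∀ (h : H), N.onCartan h = h → ∀ z y, pair2 c x y (B.dynTensor τ ϖ u h z) =
    dgTw τ r n (β (N.avg (u + ϖ))) z * β h * form c x y

variable {τ : ℂ} {ϖ u : H}

theorem cartanPart_eq_zero {x : 𝔤} (h : ∀ k, form c x (B.e0 k) = 0) : B.cartanPart x = 0 := by
  simp [cartanPart, h]

theorem cartanPart_e0 (k : ι₀) : B.cartanPart (B.e0 k : 𝔤) = B.e0 k := by
  simp [cartanPart, B.e0_pair]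

theorem isTwistedVector_e (hτ : 0 < τ.im) {n : ℕ} (h0 : 0 < n) (hn : n < r) (j : ι₁) :
    B.IsTwistedVector τ ϖ u (B.e n j) n (fun _ => 0) where
  eigen := B.e_eigenvector h0 hn j
  weight h _ := by
    have : ⁅h, B.e n j⁆ = 0 := trivial_lie_zero _ _ _ _
    rw [zero_smul, ← LieSubalgebra.coe_bracket, this]
    rfl
  cartanPart_eq := B.cartanPart_eq_zero fun k => B.form_e0_e h0 hn k j
  regular := by simpa using natCast_mul_div_notMem_periods hτ h0 hn
  right z y := by
    rw [rMatrix_eq, map_add, B.pair2_rootTensor_cartan_right (by omega),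
      B.pair2_cartanTensor_e_right h0 hn, neg_zero, add_zero]
  left z y := by
    rw [rMatrix_eq, map_add, B.pair2_rootTensor_cartan_left (by omega),
      B.pair2_cartanTensor_e_left h0 hn, add_zero]
  dyn_right h _ z y := by
    rw [dynTensor, B.pair2_rootTensor_cartan_right (by omega), mul_zero, zero_mul]
  dyn_left h _ z y := by
    rw [dynTensor, B.pair2_rootTensor_cartan_left (by omega), mul_zero, zero_mul]

/-- The coefficients of `r` and of its derivatives depend on a root only through its restriction to
`𝔥₀`, and on the degree only mod `r`; this is the constancy that the contraction lemmas for root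
tensors require. -/
theorem isTwistedVector_t (hc : c ≠ 0) (hu : B.IsRegular τ ϖ u) {m : ℕ} (hm : m < r)
    {α : LieModule.Weight ℂ H 𝔤} (hα : α ∈ H.root) (ht : B.t m α ≠ 0) :
    B.IsTwistedVector τ ϖ u (B.t m α) m (N.avgRoot α) := by
  have hr : r ≠ 0 := by omega
  have hH := fun h => B.form_cartan_t hr m hα h
  have hw : ∀ h : H, N.onCartan h = h → ⁅(h : 𝔤), B.t m α⁆ = N.avgRoot α h • B.t m α :=
    fun h hh => B.lie_t hr m hα hh
  have havg := N.onCartan_avg hr (u + ϖ)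
  refine ⟨B.t_eigen hr m α, hw, B.cartanPart_eq_zero fun k => ?_, ?_, fun z y => ?_, fun z y => ?_,
    fun h hh z y => ?_, fun h hh z y => ?_⟩
  · rw [form_comm, hH]
  · rw [N.avgRoot_avg hr]
    simpa using hu m hm α hα ht
  · rw [rMatrix_eq, map_add, B.pair2_cartanTensor_right_of_orthogonal _ _ _ hH, zero_add]
    refine B.pair2_rootTensor_right hr hc _ (B.t_eigen hr m α) hH hw (fun l γ hd hγ => ?_) y
    rw [gTw_congr hr (m := -(l : ℤ)) (n := -(m : ℤ)), ← N.avgRoot_avg hr γ, hγ _ havg]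
    rw [show -(l : ℤ) - -(m : ℤ) = -(l - m) by ring]
    exact (dvd_neg).2 hd
  · rw [rMatrix_eq, map_add, B.pair2_cartanTensor_left_of_orthogonal _ _ _ hH, zero_add]
    refine B.pair2_rootTensor_left hr hc _ (B.t_eigen hr m α) hH hw (fun l γ hd hγ => ?_) y
    rw [gTw_congr hr (m := -(l : ℤ)) (n := (m : ℤ)), ← N.avgRoot_avg hr γ, hγ _ havg, neg_neg]
    rw [show -(l : ℤ) - (m : ℤ) = -(l + m) by ring]
    exact (dvd_neg).2 hd
  · refine B.pair2_rootTensor_right hr hc _ (B.t_eigen hr m α) hH hw (fun l γ hd hγ => ?_) y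
    rw [dg_eq, dgTw_congr hr (m := -(l : ℤ)) (n := -(m : ℤ)), ← N.avgRoot_avg hr γ, hγ _ havg,
      hγ h hh]
    rw [show -(l : ℤ) - -(m : ℤ) = -(l - m) by ring]
    exact (dvd_neg).2 hd
  · refine B.pair2_rootTensor_left hr hc _ (B.t_eigen hr m α) hH hw (fun l γ hd hγ => ?_) y
    rw [dg_eq, dgTw_congr hr (m := -(l : ℤ)) (n := (m : ℤ)), ← N.avgRoot_avg hr γ, hγ _ havg,
      hγ h hh, neg_neg, neg_mul_neg]
    rw [show -(l : ℤ) - (m : ℤ) = -(l + m) by ring]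
    exact (dvd_neg).2 hd

/-- A spanning set of homogeneous elements adapted to the twisted grading. -/
def homogeneous (τ : ℂ) (ϖ u : H) : Set 𝔤 :=
  {x | (∃ k, x = (B.e0 k : 𝔤)) ∨ ∃ n β, B.IsTwistedVector τ ϖ u x n β}

variable {B} in
theorem IsTwistedVector.mem_homogeneous {x : 𝔤} {n : ℤ} {β : H → ℂ}
    (h : B.IsTwistedVector τ ϖ u x n β) : x ∈ B.homogeneous τ ϖ u := Or.inr ⟨n, β, h⟩

theorem e0_mem_homogeneous (k : ι₀) : (B.e0 k : 𝔤) ∈ B.homogeneous τ ϖ u := Or.inl ⟨k, rfl⟩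

/-- Every vector is `1/r` times the sum of its twists, so it suffices to treat the twists of Cartan
elements and of root vectors. -/
theorem span_homogeneous (hr : r ≠ 0) (hτ : 0 < τ.im) (hc : c ≠ 0) (hu : B.IsRegular τ ϖ u) :
    Submodule.span ℂ (B.homogeneous τ ϖ u) = ⊤ := by
  have hr' : (r : ℂ) ≠ 0 := Nat.cast_ne_zero.2 hr
  set p := Submodule.span ℂ (B.homogeneous τ ϖ u)
  have hsum : ∀ x, (∀ m < r, N.twist m x ∈ p) → x ∈ p := by
    intro x hx
    have : x = (1 / (r : ℂ)) • ∑ m ∈ Finset.range r, N.twist m x := by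
      rw [N.sum_twist, smul_smul, one_div_mul_cancel hr', one_smul]
    rw [this]
    exact p.smul_mem _ (p.sum_mem fun m hm => hx m (Finset.mem_range.1 hm))
  have hspan : ∀ s : Set H, (∀ x ∈ s, (x : 𝔤) ∈ p) → ∀ h ∈ Submodule.span ℂ s, (h : 𝔤) ∈ p := by
    intro s hs h hh
    have h1 : Submodule.span ℂ s ≤ p.comap H.toSubmodule.subtype := Submodule.span_le.2 hs
    exact h1 hh
  refine mem_span_of_rootVectors B.E_mem (fun α hα => B.E_ne_zero hα) (fun h => ?_) fun α hα => ?_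
  · refine hsum _ fun m hm => ?_
    have h1 := N.twist_eigen hr m (h : 𝔤)
    rcases Nat.eq_zero_or_pos m with h0 | h0
    · subst h0
      refine hspan (Set.range B.e0) (Set.forall_mem_range.2 fun k =>
          Submodule.subset_span (B.e0_mem_homogeneous k))
        ⟨N.twist 0 (h : 𝔤), N.twist_mem_cartan 0 h⟩ (B.e0_span _ (Subtype.ext ?_))
      rw [Nat.cast_zero, Int.cast_zero, zero_div, ee_zero, one_smul] at h1
      exact h1
    · have h2 : N.onCartan ⟨N.twist m (h : 𝔤), N.twist_mem_cartan m h⟩ =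
          ee (m / r) • (⟨N.twist m (h : 𝔤), N.twist_mem_cartan m h⟩ : H) := by
        rw [Int.cast_natCast] at h1
        ext
        rw [N.onCartan_coe]
        exact h1
      refine hspan (Set.range (B.e m)) (Set.forall_mem_range.2 fun k =>
          Submodule.subset_span (B.isTwistedVector_e hτ h0 hm k).mem_homogeneous)
        ⟨N.twist m (h : 𝔤), N.twist_mem_cartan m h⟩ (B.e_span m h0 hm _ h2)
  · refine hsum _ fun m hm => ?_
    by_cases ht : B.t m α = 0
    · have : N.twist m (B.E α) = 0 := ht
      rw [this]; exact p.zero_mem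
    · exact Submodule.subset_span (B.isTwistedVector_t hc hu hm hα ht).mem_homogeneous

section Contractions

variable {B}

theorem e0_right (hr : r ≠ 0) (z : ℂ) (y : 𝔤) (k : ι₀) :
    pair2 c y (B.e0 k) (B.rMatrix τ ϖ u z) = eisensteinE1 τ z * form c y (B.e0 k) := by
  rw [rMatrix_eq, map_add, B.pair2_rootTensor_cartan_right hr,
    B.pair2_cartanTensor_e0_right (Nat.pos_of_ne_zero hr), add_zero]

theorem e0_left (hr : r ≠ 0) (z : ℂ) (y : 𝔤) (k : ι₀) :
    pair2 c (B.e0 k : 𝔤) y (B.rMatrix τ ϖ u z) = eisensteinE1 τ z * form c (B.e0 k : 𝔤) y := by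
  rw [rMatrix_eq, map_add, B.pair2_rootTensor_cartan_left hr,
    B.pair2_cartanTensor_e0_left (Nat.pos_of_ne_zero hr), add_zero]

theorem dynTensor_zero (z : ℂ) : B.dynTensor τ ϖ u 0 z = 0 := by
  simp [dynTensor, rootTensor, N.avgRoot_zero]

theorem contrR_eq (hc : c ≠ 0) {R : 𝔤 ⊗[ℂ] 𝔤} {y : 𝔤} {f : ℂ}
    (h : ∀ x, pair2 c x y R = f * form c x y) : contrR c y R = f • y := by
  refine sub_eq_zero.1 (form_ne_zero_nondegenerate hc fun x => ?_)
  rw [form_comm, sub_eq_add_neg, form_add_right, form_neg_right, form_contrR, form_smul_right, h]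
  ring

theorem contrL_eq (hc : c ≠ 0) {R : 𝔤 ⊗[ℂ] 𝔤} {x : 𝔤} {f : ℂ}
    (h : ∀ y, pair2 c x y R = f * form c x y) : contrL c x R = f • x := by
  refine sub_eq_zero.1 (form_ne_zero_nondegenerate hc fun y => ?_)
  rw [form_comm, sub_eq_add_neg, form_add_right, form_neg_right, form_contrL, form_smul_right, h,
    form_comm]
  ring

/-- The pairing of the left-hand side of the Yang–Baxter equation with homogeneous elements. -/
theorem pair3_brackets (hc : c ≠ 0) {R₁₂ R₁₃ R₂₃ : 𝔤 ⊗[ℂ] 𝔤} {x y w : 𝔤}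
    {f₁ f₂ g₁ g₂ k₁ k₂ : ℂ}
    (hy12 : ∀ a, pair2 c a y R₁₂ = f₁ * form c a y) (hw13 : ∀ a, pair2 c a w R₁₃ = f₂ * form c a w)
    (hx12 : ∀ a, pair2 c x a R₁₂ = g₁ * form c x a) (hw23 : ∀ a, pair2 c a w R₂₃ = g₂ * form c a w)
    (hx13 : ∀ a, pair2 c x a R₁₃ = k₁ * form c x a)
    (hy23 : ∀ a, pair2 c y a R₂₃ = k₂ * form c y a) :
    pair3 c x y w (br1213 R₁₂ R₁₃ + br1223 R₁₂ R₂₃ + br1323 R₁₃ R₂₃) =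
      (f₁ * f₂ - g₁ * g₂ + k₁ * k₂) * form c ⁅x, y⁆ w := by
  rw [map_add, map_add, pair3_br1213, pair3_br1223, pair3_br1323, contrR_eq hc hy12,
    contrR_eq hc hw13, contrL_eq hc hx12, contrR_eq hc hw23, contrL_eq hc hx13, contrL_eq hc hy23]
  simp only [smul_lie, lie_smul, form_smul_right]
  rw [form_lie_right c x y w, ← form_lie c x y w, form_comm c w ⁅x, y⁆]
  ring

end Contractions

end AdaptedBasis

end YangBaxter

section YangBaxterEquation

variable {τ : ℂ} {r : ℕ}

theorem regular_congr (hr : r ≠ 0) {m n : ℤ} (h : (r : ℤ) ∣ m - n) {x : ℂ}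
    (hx : x + m * τ / r ∉ periods τ) : x + n * τ / r ∉ periods τ := by
  have hr' : (r : ℂ) ≠ 0 := Nat.cast_ne_zero.2 hr
  obtain ⟨k, hk⟩ := h
  have hm : (m : ℂ) = n + r * k := by
    have : m = n + r * k := by linarith
    rw [this]; push_cast; ring
  intro hp
  refine hx ?_
  rw [show x + m * τ / r = x + n * τ / r + k * τ by rw [hm]; field_simp; ring]
  exact mem_periods_add hp ⟨0, k, by simp⟩

theorem regular_neg {n : ℤ} {x : ℂ} (hx : x + n * τ / r ∉ periods τ) :
    -x + (-n : ℤ) * τ / r ∉ periods τ := by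
  rw [show -x + (-n : ℤ) * τ / r = -(x + n * τ / r) by push_cast; ring]
  exact neg_notMem_periods hx

/-- Fay's identity in the form in which it enters the Yang–Baxter equation. -/
theorem gTw_fay_cyclic (hr : r ≠ 0) (hτ : 0 < τ.im) {l m n : ℤ} (hd : (r : ℤ) ∣ l + m + n)
    {x y w : ℂ} (hs : x + y + w = 0) (hx : x + l * τ / r ∉ periods τ)
    (hy : y + m * τ / r ∉ periods τ) (hw : w + n * τ / r ∉ periods τ) {z₁ z₂ z₃ : ℂ}
    (h12 : z₁ - z₂ ∉ periods τ) (h13 : z₁ - z₃ ∉ periods τ) (h23 : z₂ - z₃ ∉ periods τ) :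
    gTw τ r (-m) (-y) (z₁ - z₂) * gTw τ r (-n) (-w) (z₁ - z₃) -
      gTw τ r l x (z₁ - z₂) * gTw τ r (-n) (-w) (z₂ - z₃) +
      gTw τ r l x (z₁ - z₃) * gTw τ r m y (z₂ - z₃) = 0 := by
  -- Fay's identity is applied to `-y, -w` in degrees `-m, -n`, whose sums are `x` and, mod `r`,
  -- `l`.
  have hx' : x = -y + -w := by linear_combination hs
  have hd' : (r : ℤ) ∣ l - (-m + -n) := by
    rwa [show l - (-m + -n) = l + m + n by ring]
  have h := gTw_fay hτ (r := r) (regular_neg hy) (regular_neg hw)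
    (hx' ▸ regular_congr hr hd' hx) h12 h13
    (by rw [show z₁ - z₂ - (z₁ - z₃) = -(z₂ - z₃) by ring]; exact neg_notMem_periods h23)
  rw [show z₁ - z₂ - (z₁ - z₃) = -(z₂ - z₃) by ring, gTw_neg,
    show z₁ - z₃ - (z₁ - z₂) = z₂ - z₃ by ring, ← hx', ← gTw_congr hr hd', ← gTw_congr hr hd'] at h
  rw [h]
  ring

variable {𝔤 : Type*} [LieRing 𝔤] [LieAlgebra ℂ 𝔤] [FiniteDimensional ℂ 𝔤]
  [LieAlgebra.IsSimple ℂ 𝔤] {H : LieSubalgebra ℂ 𝔤} [H.IsCartanSubalgebra]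
  {b : (LieAlgebra.IsKilling.rootSystem H).Base}

namespace AdaptedBasis

variable {N : DiagramAut H b r} {c : ℂ} {ι₀ ι₁ : Type*} [DecidableEq ι₀] [DecidableEq ι₁]
  [Fintype ι₀] [Fintype ι₁] {B : AdaptedBasis N c ι₀ ι₁} {ϖ u : H}

theorem form_cyclic (x y w : 𝔤) : form c ⁅x, y⁆ w = form c ⁅y, w⁆ x := by
  rw [form_lie, form_comm]

theorem lie_cartan (h h' : H) : ⁅(h : 𝔤), (h' : 𝔤)⁆ = 0 := by
  have : ⁅h, h'⁆ = 0 := trivial_lie_zero _ _ _ _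
  rw [← LieSubalgebra.coe_bracket, this]
  rfl

theorem dyn_cartan_right (hr : r ≠ 0) (h : H) (z : ℂ) (y : 𝔤) (k : ι₀) :
    pair2 c y (B.e0 k) (B.dynTensor τ ϖ u h z) = 0 := B.pair2_rootTensor_cartan_right hr _ _ _

theorem dyn_cartan_left (hr : r ≠ 0) (h : H) (z : ℂ) (y : 𝔤) (k : ι₀) :
    pair2 c (B.e0 k : 𝔤) y (B.dynTensor τ ϖ u h z) = 0 := B.pair2_rootTensor_cartan_left hr _ _ _

namespace IsTwistedVector

variable {x y : 𝔤} {m n : ℤ} {β γ : H → ℂ}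

theorem add_eq_zero (hx : B.IsTwistedVector τ ϖ u x m β) (hy : B.IsTwistedVector τ ϖ u y n γ)
    (hxy : form c x y ≠ 0) {h : H} (hh : N.onCartan h = h) : β h = -γ h :=
  eq_neg_of_add_eq_zero_left (add_eq_zero_of_form_ne_zero c (hx.weight h hh) (hy.weight h hh) hxy)

/-- On vectors that pair nontrivially, the left contraction factor of one is the right contraction
factor of the other. -/
theorem gTw_eq (hr : r ≠ 0) (hx : B.IsTwistedVector τ ϖ u x m β)
    (hy : B.IsTwistedVector τ ϖ u y n γ) (hxy : form c x y ≠ 0) (z : ℂ) :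
    gTw τ r m (β (N.avg (u + ϖ))) z = gTw τ r (-n) (-γ (N.avg (u + ϖ))) z := by
  rw [hx.add_eq_zero hy hxy (N.onCartan_avg hr _)]
  refine gTw_congr hr ?_ _ _
  rw [sub_neg_eq_add]
  exact N.dvd_of_form_ne_zero c hr hx.eigen hy.eigen hxy

theorem form_triple (hx : B.IsTwistedVector τ ϖ u x m β) {h : H} (hh : N.onCartan h = h) (y : 𝔤) :
    form c ⁅(h : 𝔤), x⁆ y = β h * form c x y := by
  rw [hx.weight h hh, form_smul_left]

end IsTwistedVector

/-- The classical dynamical Yang–Baxter equation, paired with homogeneous elements. -/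
theorem pair3_yangBaxter_of_homogeneous (hr : r ≠ 0) (hτ : 0 < τ.im) (hc : c ≠ 0) {x y w : 𝔤}
    (hx : x ∈ B.homogeneous τ ϖ u) (hy : y ∈ B.homogeneous τ ϖ u)
    (hw : w ∈ B.homogeneous τ ϖ u) {z₁ z₂ z₃ : ℂ}
    (h12 : z₁ - z₂ ∉ periods τ) (h13 : z₁ - z₃ ∉ periods τ) (h23 : z₂ - z₃ ∉ periods τ) :
    pair3 c x y w (br1213 (B.rMatrix τ ϖ u (z₁ - z₂)) (B.rMatrix τ ϖ u (z₁ - z₃)) +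
      br1223 (B.rMatrix τ ϖ u (z₁ - z₂)) (B.rMatrix τ ϖ u (z₂ - z₃)) +
      br1323 (B.rMatrix τ ϖ u (z₁ - z₃)) (B.rMatrix τ ϖ u (z₂ - z₃)) -
      B.dynTerm τ ϖ u z₁ z₂ z₃) = 0 := by
  rw [map_sub, pair3_dynTerm]
  have h32 := neg_notMem_periods h23
  rcases hx with ⟨i, rfl⟩ | ⟨l, α, hx⟩ <;> rcases hy with ⟨j, rfl⟩ | ⟨m, β, hy⟩ <;>
    rcases hw with ⟨k, rfl⟩ | ⟨n, γ, hw⟩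
  -- With at least two vectors in `𝔥₀` the triple product vanishes because `𝔥` is abelian, and the
  -- dynamical terms vanish because root tensors are orthogonal to `𝔥`.
  · rw [pair3_brackets hc (e0_right hr _ · j) (e0_right hr _ · k) (e0_left hr _ · i)
      (e0_right hr _ · k) (e0_left hr _ · i) (e0_left hr _ · j), lie_cartan, form_zero_left,
      dyn_cartan_right hr, dyn_cartan_right hr, dyn_cartan_right hr]
    ring
  · rw [pair3_brackets hc (e0_right hr _ · j) (hw.right _ ·) (e0_left hr _ · i)
      (hw.right _ ·) (e0_left hr _ · i) (e0_left hr _ · j), lie_cartan, form_zero_left,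
      dyn_cartan_left hr, dyn_cartan_left hr, dyn_cartan_left hr]
    ring
  · rw [pair3_brackets hc (hy.right _ ·) (e0_right hr _ · k) (e0_left hr _ · i)
      (e0_right hr _ · k) (e0_left hr _ · i) (hy.left _ ·), form_cyclic, form_cyclic, lie_cartan,
      form_zero_left, dyn_cartan_left hr, dyn_cartan_right hr, dyn_cartan_right hr]
    ring
  · rw [pair3_brackets hc (hy.right _ ·) (hw.right _ ·) (e0_left hr _ · i)
      (hw.right _ ·) (e0_left hr _ · i) (hy.left _ ·), dyn_cartan_left hr, dyn_cartan_left hr,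
      cartanPart_e0, hw.dyn_right _ (B.e0_fixed i), hy.form_triple (B.e0_fixed i)]
    by_cases hyw : form c y w = 0
    · rw [hyw]; ring
    -- With one vector in `𝔥₀`, a single dynamical term survives; it is the derivative in the
    -- degenerate Fay identity, multiplied by the weight at the Cartan vector.
    have hD := gTw_fay_degenerate hτ (r := r) (regular_neg hw.regular) h13 h12
      (by rwa [show z₁ - z₃ - (z₁ - z₂) = z₂ - z₃ by ring])
    have e1 := hw.gTw_eq hr hy (by rwa [form_comm]) (z₁ - z₂)
    rw [neg_neg, neg_neg, show z₁ - z₃ - (z₁ - z₂) = z₂ - z₃ by ring, e1] at hD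
    rw [hy.gTw_eq hr hw hyw, hy.add_eq_zero hw hyw (B.e0_fixed i)]
    linear_combination (-γ (B.e0 i) * form c y w) * hD
  · rw [pair3_brackets hc (e0_right hr _ · j) (e0_right hr _ · k) (hx.left _ ·)
      (e0_right hr _ · k) (hx.left _ ·) (e0_left hr _ · j), form_cyclic, lie_cartan,
      form_zero_left, dyn_cartan_right hr, dyn_cartan_right hr, dyn_cartan_right hr]
    ring
  · rw [pair3_brackets hc (e0_right hr _ · j) (hw.right _ ·) (hx.left _ ·)
      (hw.right _ ·) (hx.left _ ·) (e0_left hr _ · j), dyn_cartan_right hr, dyn_cartan_left hr,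
      cartanPart_e0, hw.dyn_right _ (B.e0_fixed j), form_cyclic, hw.form_triple (B.e0_fixed j)]
    by_cases hxw : form c x w = 0
    · rw [form_comm c w, hxw]; ring
    -- The Cartan vector sits in the middle factor, so the arguments are `z₁ - z₂` and `z₃ - z₂`,
    -- with difference `z₁ - z₃`; oddness of `E₁` and `gTw_neg` restore `z₂ - z₃`.
    have hD := gTw_fay_degenerate hτ (r := r) (regular_neg hw.regular) h12 h32
      (by rwa [show z₁ - z₂ - -(z₂ - z₃) = z₁ - z₃ by ring])
    rw [gTw_neg (-n), show z₁ - z₂ - -(z₂ - z₃) = z₁ - z₃ by ring, eisensteinE1_neg] at hD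
    rw [hx.gTw_eq hr hw hxw, hx.gTw_eq hr hw hxw, form_comm c w]
    linear_combination (γ (B.e0 j) * form c x w) * hD
  · rw [pair3_brackets hc (hy.right _ ·) (e0_right hr _ · k) (hx.left _ ·)
      (e0_right hr _ · k) (hx.left _ ·) (hy.left _ ·), dyn_cartan_right hr, dyn_cartan_right hr,
      cartanPart_e0, hy.dyn_right _ (B.e0_fixed k), form_cyclic, form_cyclic,
      hx.form_triple (B.e0_fixed k)]
    by_cases hxy : form c x y = 0
    · rw [hxy]; ring
    have hD := gTw_fay_degenerate hτ (r := r) (regular_neg hy.regular) h13 h23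
      (by rwa [show z₁ - z₃ - (z₂ - z₃) = z₁ - z₂ by ring])
    rw [neg_neg, neg_neg, show z₁ - z₃ - (z₂ - z₃) = z₁ - z₂ by ring] at hD
    rw [hx.gTw_eq hr hy hxy, hx.gTw_eq hr hy hxy, hx.add_eq_zero hy hxy (B.e0_fixed k)]
    linear_combination (-β (B.e0 k) * form c x y) * hD
  -- No vector has a component in `𝔥₀`, so there is no dynamical term. If the triple product is
  -- nonzero, degrees and weights cancel, and Fay's identity applies.
  · rw [pair3_brackets hc (hy.right _ ·) (hw.right _ ·) (hx.left _ ·)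
      (hw.right _ ·) (hx.left _ ·) (hy.left _ ·), hx.cartanPart_eq, hy.cartanPart_eq,
      hw.cartanPart_eq, dynTensor_zero, dynTensor_zero, dynTensor_zero]
    by_cases hT : form c ⁅x, y⁆ w = 0
    · rw [hT]; simp
    have hd := N.dvd_of_form_ne_zero c hr (N.eigen_lie hx.eigen hy.eigen) hw.eigen hT
    have hs : α (N.avg (u + ϖ)) + β (N.avg (u + ϖ)) + γ (N.avg (u + ϖ)) = 0 := by
      refine add_eq_zero_of_form_ne_zero c (h := (N.avg (u + ϖ) : 𝔤)) ?_
        (hw.weight _ (N.onCartan_avg hr _)) hT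
      rw [leibniz_lie, hx.weight _ (N.onCartan_avg hr _), hy.weight _ (N.onCartan_avg hr _),
        smul_lie, lie_smul, ← add_smul]
    rw [gTw_fay_cyclic hr hτ hd hs hx.regular hy.regular hw.regular h12 h13 h23]
    simp

end AdaptedBasis

end YangBaxterEquation

/-! ### The `RLL` relation -/

section RLL

variable {τ : ℂ} {r : ℕ} {𝔤 : Type*} [LieRing 𝔤] [LieAlgebra ℂ 𝔤] [FiniteDimensional ℂ 𝔤]
  [LieAlgebra.IsSimple ℂ 𝔤] {H : LieSubalgebra ℂ 𝔤} [H.IsCartanSubalgebra]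
  {b : (LieAlgebra.IsKilling.rootSystem H).Base}

namespace AdaptedBasis

variable {N : DiagramAut H b r} {c : ℂ} {ι₀ ι₁ : Type*} [DecidableEq ι₀] [DecidableEq ι₁]
  [Fintype ι₀] [Fintype ι₁] {B : AdaptedBasis N c ι₀ ι₁} {ϖ u : H}

theorem pair3_yangBaxter (hr : r ≠ 0) (hτ : 0 < τ.im) (hc : c ≠ 0) (hu : B.IsRegular τ ϖ u)
    (x y w : 𝔤) {z₁ z₂ z₃ : ℂ} (h12 : z₁ - z₂ ∉ periods τ) (h13 : z₁ - z₃ ∉ periods τ)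
    (h23 : z₂ - z₃ ∉ periods τ) :
    pair3 c x y w (br1213 (B.rMatrix τ ϖ u (z₁ - z₂)) (B.rMatrix τ ϖ u (z₁ - z₃)) +
      br1223 (B.rMatrix τ ϖ u (z₁ - z₂)) (B.rMatrix τ ϖ u (z₂ - z₃)) +
      br1323 (B.rMatrix τ ϖ u (z₁ - z₃)) (B.rMatrix τ ϖ u (z₂ - z₃)) -
      B.dynTerm τ ϖ u z₁ z₂ z₃) = 0 :=
  pair3_eq_zero_of_span c (B.span_homogeneous hr hτ hc hu) (fun _ hx _ hy _ hw =>
    pair3_yangBaxter_of_homogeneous hr hτ hc hx hy hw h12 h13 h23) x y w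

/-- The `r`-matrix is invariant under the `ν`-fixed part of the Cartan subalgebra. -/
theorem pair2_rMatrix_invariant (hr : r ≠ 0) (hτ : 0 < τ.im) (hc : c ≠ 0)
    (hu : B.IsRegular τ ϖ u) {h : H} (hh : N.onCartan h = h) (z : ℂ) (x y : 𝔤) :
    pair2 c ⁅(h : 𝔤), x⁆ y (B.rMatrix τ ϖ u z) +
      pair2 c x ⁅(h : 𝔤), y⁆ (B.rMatrix τ ϖ u z) = 0 := by
  have hx : x ∈ Submodule.span ℂ (B.homogeneous τ ϖ u) := by
    rw [B.span_homogeneous hr hτ hc hu]; trivial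
  induction hx using Submodule.span_induction with
  | zero => simp [pair2_zero_left]
  | add a a' _ _ ha ha' =>
    simp only [lie_add, pair2_add_left, LinearMap.add_apply]
    linear_combination ha + ha'
  | smul k a _ ha =>
    simp only [lie_smul, pair2_smul_left, LinearMap.smul_apply, smul_eq_mul]
    linear_combination k * ha
  | mem x hx =>
    rcases hx with ⟨i, rfl⟩ | ⟨n, β, hx⟩
    · rw [lie_cartan, pair2_zero_left, e0_left hr, form_lie_right, lie_cartan, form_zero_left]
      simp
    -- Contraction with `x` is a scalar multiple of the form, so invariance of `r` reduces to that
    -- of the form.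
    · rw [hx.weight h hh, pair2_smul_left, LinearMap.smul_apply, hx.left, hx.left, form_lie_right,
        hx.form_triple hh, smul_eq_mul]
      ring

theorem vec_coe (v : ι₀ → ℂ) : ((B.vec v : H) : 𝔤) = ∑ k, v k • (B.e0 k : 𝔤) := by
  simp [vec]

theorem pair2_dynTensor (h : H) (z : ℂ) (x y : 𝔤) :
    pair2 c x y (B.dynTensor τ ϖ u h z) = (1 / (r : ℂ) ^ 2) * ∑ m ∈ Finset.range r,
      ∑ α ∈ H.root, B.dg τ ϖ m α u z * N.avgRoot α h *
        (form c x (B.t m α) * form c y (B.t (r - m) (-α))) :=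
  B.pair2_rootTensor _ _ _

theorem pair2_dynTensor_vec (w : ι₀ → ℂ) (z : ℂ) (x y : 𝔤) :
    pair2 c x y (B.dynTensor τ ϖ u (B.vec w) z) =
      ∑ k, w k * pair2 c x y (B.dynTensor τ ϖ u (B.e0 k) z) := by
  simp only [pair2_dynTensor, vec, N.avgRoot_sum, N.avgRoot_smul, Finset.mul_sum, Finset.sum_mul]
  symm
  rw [Finset.sum_comm]
  refine Finset.sum_congr rfl fun m _ => ?_
  rw [Finset.sum_comm]
  refine Finset.sum_congr rfl fun α _ => Finset.sum_congr rfl fun k _ => ?_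
  ring

/-- The Lax operator is the contraction of the `r`-matrix with the spin variable. -/
theorem lax_eq (hr : r ≠ 0) (z : ℂ) (p : (ι₀ → ℂ) × (ι₀ → ℂ) × 𝔤) :
    B.lax τ ϖ z p = (B.vec p.1 : 𝔤) + contrR c p.2.2 (B.rMatrix τ ϖ (B.vec p.2.1) z) := by
  have h0 : 0 ∈ Finset.range r := Finset.mem_range.2 (Nat.pos_of_ne_zero hr)
  -- The momentum belongs to the component `m = 0`; after this both sides can be compared degree by
  -- degree.
  have hv : ((B.vec p.1 : H) : 𝔤) = ∑ m ∈ Finset.range r,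
      if m = 0 then ∑ k, p.1 k • (B.e0 k : 𝔤) else 0 := by
    rw [vec_coe, Finset.sum_ite_eq' _ 0, if_pos h0]
  rw [hv, rMatrix, map_sum, lax, ← Finset.sum_add_distrib]
  refine Finset.sum_congr rfl fun m _ => ?_
  unfold laxComp rComp
  rw [map_add, ← add_assoc]
  congr 1
  · split_ifs
    · simp [add_smul, Finset.sum_add_distrib, Finset.smul_sum, smul_smul, mul_comm]
    · simp [Finset.smul_sum, smul_smul, mul_comm]
  · simp [smul_smul, mul_comm]

theorem form_lax (hr : r ≠ 0) (z : ℂ) (p : (ι₀ → ℂ) × (ι₀ → ℂ) × 𝔤) (x : 𝔤) :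
    form c (B.lax τ ϖ z p) x =
      ∑ k, p.1 k * form c (B.e0 k : 𝔤) x + pair2 c x p.2.2 (B.rMatrix τ ϖ (B.vec p.2.1) z) := by
  rw [lax_eq hr, form_add_left, form_comm c (contrR _ _ _), form_contrR, vec_coe, form_sum_left]
  simp only [form_smul_left]

theorem vec_add_smul_single (w : ι₀ → ℂ) (k : ι₀) (s : ℂ) :
    B.vec (w + s • Pi.single k 1) = B.vec w + s • B.e0 k := by
  simp [vec, add_smul, Finset.sum_add_distrib, Pi.single_apply]

theorem hasDerivAt_rMatrix (hτ : 0 < τ.im) {w : ι₀ → ℂ} (hu : B.IsRegular τ ϖ (B.vec w)) (z : ℂ)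
    (x y : 𝔤) (k : ι₀) :
    HasDerivAt (fun s : ℂ => pair2 c x y (B.rMatrix τ ϖ (B.vec (w + s • Pi.single k 1)) z))
      (pair2 c x y (B.dynTensor τ ϖ (B.vec w) (B.e0 k) z)) 0 := by
  simp only [rMatrix_eq, map_add, pair2_dynTensor, pair2_rootTensor, vec_add_smul_single]
  refine HasDerivAt.const_add _ (HasDerivAt.const_mul _ (HasDerivAt.fun_sum fun m hm =>
    HasDerivAt.fun_sum fun α hα => ?_))
  -- Regularity says nothing about these terms, whose coefficients may sit at a pole, but their
  -- tensors vanish.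
  by_cases ht : B.t m α = 0
  · simp only [ht, form_zero_right, zero_mul, mul_zero]
    exact hasDerivAt_const _ _
  refine HasDerivAt.mul_const ?_ _
  have hreg := hu m (Finset.mem_range.1 hm) α hα ht
  have e : ∀ s : ℂ, -N.avgRoot α (B.vec w + s • B.e0 k + ϖ) =
      -N.avgRoot α (B.vec w + ϖ) - s * N.avgRoot α (B.e0 k) := by
    intro s
    simp only [N.avgRoot_add, N.avgRoot_smul]
    ring
  simp only [e]
  have h1 : HasDerivAt (fun s : ℂ => -N.avgRoot α (B.vec w + ϖ) - s * N.avgRoot α (B.e0 k))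
      (-N.avgRoot α (B.e0 k)) 0 := by
    simpa using ((hasDerivAt_id (0 : ℂ)).mul_const (N.avgRoot α (B.e0 k))).const_sub
      (-N.avgRoot α (B.vec w + ϖ))
  have h2 : HasDerivAt (fun x => gTw τ r (-(m : ℤ)) x z)
      (dgTw τ r (-(m : ℤ)) (-N.avgRoot α (B.vec w + ϖ)) z)
      (-N.avgRoot α (B.vec w + ϖ) - 0 * N.avgRoot α (B.e0 k)) := by
    rw [zero_mul, sub_zero]
    exact hasDerivAt_gTw hτ (regular_neg (by simpa using hreg)) z
  refine (h2.comp (0 : ℂ) h1).congr_deriv ?_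
  rw [dg_eq]
  ring

variable {κ : Type*} [Fintype κ] [DecidableEq κ] (T : Module.Basis κ ℂ 𝔤)

variable (B) in
/-- The partial derivatives of the coordinate `(L(z), x)` of the Lax operator. -/
def laxDeriv (τ : ℂ) (ϖ : H) (u : ι₀ → ℂ) (S : 𝔤) (z : ℂ) (x : 𝔤) : ι₀ ⊕ ι₀ ⊕ κ → ℂ :=
  Sum.elim (fun k => form c (B.e0 k : 𝔤) x)
    (Sum.elim (fun k => pair2 c x S (B.dynTensor τ ϖ (B.vec u) (B.e0 k) z))
      (fun a => pair2 c x (T a) (B.rMatrix τ ϖ (B.vec u) z)))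

theorem lineDeriv_lax (hr : r ≠ 0) (hτ : 0 < τ.im) {v u : ι₀ → ℂ}
    (hu : B.IsRegular τ ϖ (B.vec u)) (S : 𝔤) (z : ℂ) (x : 𝔤) (i : ι₀ ⊕ ι₀ ⊕ κ) :
    lineDeriv ℂ (fun p => form c (B.lax τ ϖ z p) x) (v, u, S) (coordDir T i) =
      B.laxDeriv T τ ϖ u S z x i := by
  refine HasDerivAt.deriv ?_
  rcases i with k | k | a
  · simp only [coordDir, laxDeriv, Sum.elim_inl, form_lax hr, Prod.smul_mk, smul_zero,
      Prod.mk_add_mk, add_zero]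
    refine HasDerivAt.add_const _ ?_
    have e : ∀ s : ℂ, ∑ l, (v + s • (Pi.single k 1 : ι₀ → ℂ)) l * form c (B.e0 l : 𝔤) x =
        ∑ l, v l * form c (B.e0 l : 𝔤) x + s * form c (B.e0 k : 𝔤) x := by
      intro s
      simp [add_mul, Finset.sum_add_distrib, Pi.single_apply]
    simp only [e]
    simpa using ((hasDerivAt_id (0 : ℂ)).mul_const (form c (B.e0 k : 𝔤) x)).const_add
      (∑ l, v l * form c (B.e0 l : 𝔤) x)
  · simp only [coordDir, laxDeriv, Sum.elim_inl, Sum.elim_inr, form_lax hr, Prod.smul_mk,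
      smul_zero, Prod.mk_add_mk, add_zero]
    exact (hasDerivAt_rMatrix hτ hu z x S k).const_add _
  · simp only [coordDir, laxDeriv, Sum.elim_inr, form_lax hr, Prod.smul_mk,
      smul_zero, Prod.mk_add_mk, add_zero, pair2_add_right, pair2_smul_right, LinearMap.add_apply,
      LinearMap.smul_apply, smul_eq_mul]
    refine HasDerivAt.const_add _ ?_
    simpa using ((hasDerivAt_id (0 : ℂ)).mul_const
      (pair2 c x (T a) (B.rMatrix τ ϖ (B.vec u) z))).const_add
      (pair2 c x S (B.rMatrix τ ϖ (B.vec u) z))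

variable {T} (hT : ∀ a a', form c (T a) (T a') = if a = a' then 1 else 0)
include hT

theorem pair2_pbracketTensor (P : ι₀ ⊕ ι₀ ⊕ κ → ι₀ ⊕ ι₀ ⊕ κ → ℂ)
    (F G : (ι₀ → ℂ) × (ι₀ → ℂ) × 𝔤 → 𝔤) (p : (ι₀ → ℂ) × (ι₀ → ℂ) × 𝔤) (a a' : κ) :
    pair2 c (T a) (T a') (pbracketTensor c T P F G p) =
      pbracket T P (fun x => form c (F x) (T a)) (fun x => form c (G x) (T a')) p := by
  simp [pbracketTensor, hT]

theorem sum_form_lie (S A A' : 𝔤) :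
    ∑ a, ∑ a', form c S ⁅T a, T a'⁆ * form c (T a) A * form c (T a') A' = form c S ⁅A, A'⁆ := by
  conv_rhs => rw [← sum_form_smul hT A, ← sum_form_smul hT A']
  simp only [sum_lie, lie_sum, smul_lie, lie_smul, form_sum_right, form_smul_right, Finset.mul_sum]
  rw [Finset.sum_comm]
  refine Finset.sum_congr rfl fun a _ => Finset.sum_congr rfl fun a' _ => ?_
  ring

theorem sum_poissonMatrix_mul (S : 𝔤) (p q : ι₀ ⊕ ι₀ ⊕ κ → ℂ) :
    ∑ i, ∑ j, poissonMatrix c T S i j * p i * q j =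
      ∑ k, p (Sum.inl k) * q (Sum.inr (Sum.inl k)) - ∑ k, p (Sum.inr (Sum.inl k)) * q (Sum.inl k) -
        ∑ a, ∑ a', form c S ⁅T a, T a'⁆ * p (Sum.inr (Sum.inr a)) * q (Sum.inr (Sum.inr a')) := by
  simp only [Fintype.sum_sum_type, poissonMatrix, zero_mul, Finset.sum_const_zero, add_zero,
    zero_add, ite_mul, one_mul, neg_mul, Finset.sum_ite_eq, Finset.mem_univ, if_true,
    Finset.sum_neg_distrib]
  ring

/-- The `RLL` relation. -/
theorem rll_relation (hr : r ≠ 0) (hτ : 0 < τ.im) (hc : c ≠ 0) {v u : ι₀ → ℂ}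
    (hu : B.IsRegular τ ϖ (B.vec u)) (S : 𝔤) {z₁ z₂ : ℂ} (h1 : z₁ ∉ periods τ)
    (h2 : z₂ ∉ periods τ) (h12 : z₁ - z₂ ∉ periods τ) :
    pbracketTensor c T (poissonMatrix c T S) (B.lax τ ϖ z₁) (B.lax τ ϖ z₂) (v, u, S) =
      -brL (B.lax τ ϖ z₁ (v, u, S)) (B.lax τ ϖ z₂ (v, u, S)) (B.rMatrix τ ϖ (B.vec u) (z₁ - z₂)) -
        B.anomaly τ ϖ (B.vec u) S (z₁ - z₂) := by
  refine eq_of_pair2_eq hT fun a a' => ?_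
  rw [pair2_pbracketTensor hT, pbracket]
  simp only [lineDeriv_lax T hr hτ hu]
  rw [sum_poissonMatrix_mul hT]
  simp only [laxDeriv, Sum.elim_inl, Sum.elim_inr]
  generalize T a = x
  generalize T a' = y
  -- With `z₃ = 0` and third factor paired with `𝐒`, `r₁₃` and `r₂₃` contract to the `𝐒`-dependent
  -- parts of `L(z₁)` and `L(z₂)`.
  have hYB := pair3_yangBaxter hr hτ hc hu x y S (z₃ := 0) h12 (by rwa [sub_zero])
    (by rwa [sub_zero])
  rw [map_sub, map_add, map_add, pair3_dynTerm, pair3_br1213, pair3_br1223, pair3_br1323, sub_zero,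
    sub_zero] at hYB
  -- The canonical brackets `{v, u}` assemble the derivatives of `r` along the basis of `𝔥₀` into
  -- the derivative along the `𝔥₀`-part of `y`, as in the dynamical term.
  have e1 : ∀ (s y : 𝔤) (z : ℂ), ∑ k, form c (B.e0 k : 𝔤) y *
      pair2 c s S (B.dynTensor τ ϖ (B.vec u) (B.e0 k) z) =
        pair2 c s S (B.dynTensor τ ϖ (B.vec u) (B.cartanPart y) z) := by
    intro s y z
    refine Eq.trans ?_ (pair2_dynTensor_vec _ _ _ _).symm
    simp only [form_comm c _ y]
  have e2 : ∑ k, pair2 c x S (B.dynTensor τ ϖ (B.vec u) (B.e0 k) z₁) * form c (B.e0 k : 𝔤) y =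
      pair2 c x S (B.dynTensor τ ϖ (B.vec u) (B.cartanPart y) z₁) := by
    rw [← e1]
    exact Finset.sum_congr rfl fun k _ => mul_comm _ _
  rw [e1, e2]
  simp only [← form_contrL c x _ (B.rMatrix τ ϖ (B.vec u) z₁),
    ← form_contrL c y _ (B.rMatrix τ ϖ (B.vec u) z₂)]
  rw [sum_form_lie hT, map_sub, map_neg, pair2_brL, lax_eq hr, lax_eq hr, anomaly_eq, add_lie,
    add_lie, form_add_right, form_add_right, form_lie_right c (B.vec v : 𝔤) x,
    form_lie_right c (B.vec v : 𝔤) y, form_contrR, form_contrL,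
    ← lie_skew (contrR c S _) (contrR c y _), ← lie_skew (contrR c S _) (contrL c x _),
    form_neg_right, form_neg_right]
  -- This removes the commutator of `r` with `𝐯 ⊗ 1 + 1 ⊗ 𝐯`, which has no counterpart in the
  -- Yang–Baxter equation.
  have hinv := pair2_rMatrix_invariant hr hτ hc hu (B.onCartan_vec v) (z₁ - z₂) x y
  linear_combination -hYB - hinv

end AdaptedBasis

end RLL

/-! ### Uniqueness of the Poisson brackets -/

section Uniqueness

open Filter Topology

variable {τ : ℂ} {r : ℕ} {𝔤 : Type*} [LieRing 𝔤] [LieAlgebra ℂ 𝔤] [FiniteDimensional ℂ 𝔤]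
  [LieAlgebra.IsSimple ℂ 𝔤] {H : LieSubalgebra ℂ 𝔤} [H.IsCartanSubalgebra]
  {b : (LieAlgebra.IsKilling.rootSystem H).Base}

namespace AdaptedBasis

variable {N : DiagramAut H b r} {c : ℂ} {ι₀ ι₁ κ : Type*} [DecidableEq ι₀] [DecidableEq ι₁]
  [DecidableEq κ] [Fintype ι₀] [Fintype ι₁] [Fintype κ] {B : AdaptedBasis N c ι₀ ι₁} {ϖ : H}
  {T : Module.Basis κ ℂ 𝔤}

/-- For `m = 0` the dual index `r - m` is `r`, outside the range `0 ≤ m < r` in which regularity is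
stated. -/
theorem t_order (hr : r ≠ 0) (α : LieModule.Weight ℂ H 𝔤) : B.t r α = B.t 0 α := by
  have hr' : (r : ℂ) ≠ 0 := Nat.cast_ne_zero.2 hr
  unfold t DiagramAut.twist
  refine Finset.sum_congr rfl fun j _ => ?_
  rw [ee_eq_of_add_int (-(j : ℤ)) (y := -((j : ℂ) * (0 : ℕ)) / r)]
  push_cast
  field_simp
  ring

theorem sum_mul_laxDeriv (u : ι₀ → ℂ) (S x : 𝔤) (z : ℂ) (q : ι₀ ⊕ ι₀ ⊕ κ → ℂ) :
    ∑ i, q i * B.laxDeriv T τ ϖ u S z x i =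
      ∑ k, q (Sum.inl k) * form c (B.e0 k : 𝔤) x +
      (pair2 c x S (B.dynTensor τ ϖ (B.vec u) (B.vec fun k => q (Sum.inr (Sum.inl k))) z) +
        pair2 c x (∑ a, q (Sum.inr (Sum.inr a)) • T a) (B.rMatrix τ ϖ (B.vec u) z)) := by
  rw [Fintype.sum_sum_type, Fintype.sum_sum_type, pair2_dynTensor_vec, pair2_sum_right]
  simp [laxDeriv, pair2_smul_right]

/-- Testing with `x = 𝔢⁰_k` gives a relation between `1` and `E₁`, killing the `v`-part of `q` and
the `𝔥₀`-part of `X`. Testing with twisted vectors gives relations between `∂g` and `g`, killing the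
remainder of `X` and every product `β(w)(x, 𝐒)`. -/
theorem eq_zero_of_sum_mul_laxDeriv (hr : r ≠ 0) (hτ : 0 < τ.im) (hc : c ≠ 0) {u : ι₀ → ℂ}
    (hu : B.IsRegular τ ϖ (B.vec u)) {S : 𝔤} (hS : B.IsGeneric S) {q : ι₀ ⊕ ι₀ ⊕ κ → ℂ}
    (h : ∀ x, ∀ᶠ z in 𝓝[≠] (0 : ℂ), ∑ i, q i * B.laxDeriv T τ ϖ u S z x i = 0) : q = 0 := by
  simp only [sum_mul_laxDeriv] at h
  set w : ι₀ → ℂ := fun k => q (Sum.inr (Sum.inl k)) with hw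
  set X : 𝔤 := ∑ a, q (Sum.inr (Sum.inr a)) • T a with hX
  have h0 : ∀ k, q (Sum.inl k) = 0 ∧ form c (B.e0 k : 𝔤) X = 0 := by
    intro k
    refine eisensteinE1_independent hτ ((h (B.e0 k)).mono fun z hz => ?_)
    rw [e0_left hr, dynTensor, B.pair2_rootTensor_cartan_left hr] at hz
    simp only [B.e0_pair, mul_ite, mul_one, mul_zero, Finset.sum_ite_eq', Finset.mem_univ, if_true,
      zero_add] at hz
    rw [← hz, mul_comm]
  have h1 : ∀ x n β, B.IsTwistedVector τ ϖ (B.vec u) x n β →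
      β (B.vec w) * form c x S = 0 ∧ form c x X = 0 := by
    intro x n β hx
    refine gTw_independent hτ hx.regular ((h x).mono fun z hz => ?_)
    simp only [(h0 _).1, zero_mul, Finset.sum_const_zero, zero_add] at hz
    rw [hx.left, hx.dyn_left _ (B.onCartan_vec _)] at hz
    rw [← hz]
    ring
  have hX0 : X = 0 := by
    refine form_ne_zero_nondegenerate hc fun x => ?_
    rw [form_comm]
    have hx : x ∈ Submodule.span ℂ (B.homogeneous τ ϖ (B.vec u)) := by
      rw [B.span_homogeneous hr hτ hc hu]; trivial
    induction hx using Submodule.span_induction with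
    | zero => exact form_zero_left c _
    | add a a' _ _ ha ha' => rw [form_add_left, ha, ha', add_zero]
    | smul k a _ ha => rw [form_smul_left, ha, mul_zero]
    | mem x hx =>
      rcases hx with ⟨k, rfl⟩ | ⟨n, β, hx⟩
      · exact (h0 k).2
      · exact (h1 x n β hx).2
  -- A nonzero spin component `(𝐒, 𝔱^{r-m}_{-α})` forces `α̃(w) = 0`; genericity says that such `α̃`
  -- span.
  have hw0 : w = 0 := by
    refine hS w fun m hm α hα hne => ?_
    have ht : B.t (r - m) (-α) ≠ 0 := fun h' => hne (by rw [h', form_zero_right])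
    have key : N.avgRoot (-α) (B.vec w) * form c (B.t (r - m) (-α)) S = 0 := by
      rcases Nat.eq_zero_or_pos m with rfl | hm0
      · rw [Nat.sub_zero, t_order hr] at ht ⊢
        exact (h1 _ _ _ (B.isTwistedVector_t hc hu hm (neg_mem_root hα) ht)).1
      · exact (h1 _ _ _ (B.isTwistedVector_t hc hu (by omega) (neg_mem_root hα) ht)).1
    rw [form_comm, N.avgRoot_neg] at key
    exact neg_eq_zero.1 ((mul_eq_zero.1 key).resolve_right hne)
  funext i
  rcases i with k | k | a
  · exact (h0 k).1
  · exact congrFun hw0 k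
  · exact Fintype.linearIndependent_iff.1 T.linearIndependent _ hX0 a

theorem laxDeriv_eq_sum (hT : ∀ a a', form c (T a) (T a') = if a = a' then 1 else 0)
    (u : ι₀ → ℂ) (S x : 𝔤) (z : ℂ) (i : ι₀ ⊕ ι₀ ⊕ κ) :
    B.laxDeriv T τ ϖ u S z x i =
      ∑ a, form c (T a) x * B.laxDeriv T τ ϖ u S z (T a) i := by
  have hp : ∀ (y : 𝔤) R, pair2 c x y R = ∑ a, form c (T a) x * pair2 c (T a) y R := by
    intro y R
    simp only [← form_contrR, ← form_comm c (contrR c y R)]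
    conv_lhs => rw [← sum_form_smul hT x]
    simp only [form_sum_right, form_smul_right]
  rcases i with k | k | a
  · simp only [laxDeriv, Sum.elim_inl]
    conv_lhs => rw [← sum_form_smul hT x]
    simp only [form_sum_right, form_smul_right]
  · exact hp _ _
  · exact hp _ _

theorem sum_mul_laxDeriv_eq_zero
    (hT : ∀ a a', form c (T a) (T a') = if a = a' then 1 else 0) {u : ι₀ → ℂ} {S : 𝔤} {z : ℂ}
    {q : ι₀ ⊕ ι₀ ⊕ κ → ℂ} (h : ∀ a, ∑ i, q i * B.laxDeriv T τ ϖ u S z (T a) i = 0) (x : 𝔤) :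
    ∑ i, q i * B.laxDeriv T τ ϖ u S z x i = 0 := by
  simp only [laxDeriv_eq_sum hT _ _ x, Finset.mul_sum]
  rw [Finset.sum_comm]
  refine Finset.sum_eq_zero fun a _ => ?_
  rw [← mul_zero (form c (T a) x), ← h a, Finset.mul_sum]
  exact Finset.sum_congr rfl fun j _ => mul_left_comm _ _ _

/-- The difference `P - Q` pairs to zero with all derivative vectors at `z₁` and `z₂`. Neither
antisymmetry nor the Jacobi identity enters. -/
theorem poissonMatrix_unique (hT : ∀ a a', form c (T a) (T a') = if a = a' then 1 else 0)
    (hr : r ≠ 0) (hτ : 0 < τ.im) (hc : c ≠ 0) {v u : ι₀ → ℂ}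
    (hu : B.IsRegular τ ϖ (B.vec u)) {S : 𝔤} (hS : B.IsGeneric S)
    {P Q : ι₀ ⊕ ι₀ ⊕ κ → ι₀ ⊕ ι₀ ⊕ κ → ℂ}
    (h : ∀ z₁ z₂ : ℂ, z₁ ∉ periods τ → z₂ ∉ periods τ → z₁ - z₂ ∉ periods τ →
      pbracketTensor c T P (B.lax τ ϖ z₁) (B.lax τ ϖ z₂) (v, u, S) =
        pbracketTensor c T Q (B.lax τ ϖ z₁) (B.lax τ ϖ z₂) (v, u, S)) : P = Q := by
  set D : ℂ → 𝔤 → ι₀ ⊕ ι₀ ⊕ κ → ℂ := fun z x => B.laxDeriv T τ ϖ u S z x with hD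
  have h1 : ∀ z₁ z₂ : ℂ, z₁ ∉ periods τ → z₂ ∉ periods τ → z₁ - z₂ ∉ periods τ → ∀ x a',
      ∑ i, (∑ j, (P i j - Q i j) * D z₂ (T a') j) * D z₁ x i = 0 := by
    intro z₁ z₂ hz₁ hz₂ hz x a'
    refine sum_mul_laxDeriv_eq_zero hT (fun a => ?_) x
    have := congrArg (pair2 c (T a) (T a')) (h z₁ z₂ hz₁ hz₂ hz)
    rw [pair2_pbracketTensor hT, pair2_pbracketTensor hT, pbracket, pbracket, ← sub_eq_zero,
      ← Finset.sum_sub_distrib] at this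
    simp only [lineDeriv_lax T hr hτ hu] at this
    rw [← this]
    refine Finset.sum_congr rfl fun i _ => ?_
    rw [← Finset.sum_sub_distrib, Finset.sum_mul]
    refine Finset.sum_congr rfl fun j _ => ?_
    ring
  -- Fix `z₂` and let `z₁` range near `0`: this strips the row index. The column index is stripped
  -- afterwards by `z₂` near `0`.
  have h2 : ∀ z₂ ∉ periods τ, ∀ a' i, ∑ j, (P i j - Q i j) * D z₂ (T a') j = 0 := by
    intro z₂ hz₂ a' i
    refine congrFun (eq_zero_of_sum_mul_laxDeriv (T := T) hr hτ hc hu hS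
      (q := fun i => ∑ j, (P i j - Q i j) * D z₂ (T a') j) fun x => ?_) i
    filter_upwards [eventually_notMem_periods_zero hτ, eventually_sub_notMem_periods hτ hz₂]
      with z₁ hz₁ hz
    exact h1 z₁ z₂ hz₁ hz₂ hz x a'
  funext i
  refine sub_eq_zero.1 (eq_zero_of_sum_mul_laxDeriv (T := T) hr hτ hc hu hS
    (q := P i - Q i) fun x => ?_)
  filter_upwards [eventually_notMem_periods_zero hτ] with z hz
  exact sum_mul_laxDeriv_eq_zero hT (fun a => h2 z hz a i) x

/-- The factor comes from the prefactor `e(-mz/r)` alone, since `φ` and `E₁` have period `1` in `z`.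
-/
theorem rComp_add_one (m : ℕ) (u : H) (z : ℂ) :
    B.rComp τ ϖ m u (z + 1) = ee (-(m : ℂ) / r) • B.rComp τ ϖ m u z := by
  unfold rComp
  simp only [gTw_add_one, eisensteinE1_add_one, Int.cast_neg, Int.cast_natCast, smul_add,
    Finset.smul_sum, mul_smul]
  congr 1
  · split_ifs with hm
    · subst hm
      simp [ee_zero]
    · rw [Finset.smul_sum]
  · exact Finset.sum_congr rfl fun α _ => smul_comm _ _ _

end AdaptedBasis

end Uniqueness

end TwistedCM

end

theorem mainTheorem10
    {𝔤 : Type*} [LieRing 𝔤] [LieAlgebra ℂ 𝔤] [FiniteDimensional ℂ 𝔤] [LieAlgebra.IsSimple ℂ 𝔤]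
    (H : LieSubalgebra ℂ 𝔤) [H.IsCartanSubalgebra]
    (b : (LieAlgebra.IsKilling.rootSystem H).Base)
    (r : ℕ) (hr : r = 2 ∨ r = 3) (N : TwistedCM.DiagramAut H b r)
    (c : ℂ) (hc : c ≠ 0)
    {ι₀ ι₁ κ : Type*} [Fintype ι₀] [Fintype ι₁] [Fintype κ]
    [DecidableEq ι₀] [DecidableEq ι₁] [DecidableEq κ]
    (B : TwistedCM.AdaptedBasis N c ι₀ ι₁)
    (T : Module.Basis κ ℂ 𝔤)
    (hT : ∀ a a', TwistedCM.form c (T a) (T a') = if a = a' then 1 else 0)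
    (τ : ℂ) (hτ : 0 < τ.im) (ϖ : H) :
    -- `r_m(𝐮, tω) = ω^{-m} r_m(𝐮, t)`
    (∀ m < r, ∀ (u : H) (z : ℂ),
      B.rComp τ ϖ m u (z + 1) = TwistedCM.ee (-(m : ℂ) / r) • B.rComp τ ϖ m u z) ∧
    -- the classical dynamical Yang–Baxter equation
    (∀ u : H, N.onCartan u = u → B.IsRegular τ ϖ u → ∀ z₁ z₂ z₃ : ℂ,
      z₁ - z₂ ∉ TwistedCM.periods τ → z₁ - z₃ ∉ TwistedCM.periods τ →
      z₂ - z₃ ∉ TwistedCM.periods τ →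
      TwistedCM.br1213 (B.rMatrix τ ϖ u (z₁ - z₂)) (B.rMatrix τ ϖ u (z₁ - z₃)) +
        TwistedCM.br1223 (B.rMatrix τ ϖ u (z₁ - z₂)) (B.rMatrix τ ϖ u (z₂ - z₃)) +
        TwistedCM.br1323 (B.rMatrix τ ϖ u (z₁ - z₃)) (B.rMatrix τ ϖ u (z₂ - z₃)) -
        B.dynTerm τ ϖ u z₁ z₂ z₃ = 0) ∧
    -- the RLL relation for the canonical and Lie–Poisson brackets
    (∀ (v u : ι₀ → ℂ) (S : 𝔤), B.IsRegular τ ϖ (B.vec u) → ∀ z₁ z₂ : ℂ,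
      z₁ ∉ TwistedCM.periods τ → z₂ ∉ TwistedCM.periods τ → z₁ - z₂ ∉ TwistedCM.periods τ →
      TwistedCM.pbracketTensor c T (TwistedCM.poissonMatrix c T S)
          (B.lax τ ϖ z₁) (B.lax τ ϖ z₂) (v, u, S) =
        -TwistedCM.brL (B.lax τ ϖ z₁ (v, u, S)) (B.lax τ ϖ z₂ (v, u, S))
            (B.rMatrix τ ϖ (B.vec u) (z₁ - z₂)) -
          B.anomaly τ ϖ (B.vec u) S (z₁ - z₂)) ∧
    -- the anomalous term vanishes on the moment constraints
    (∀ (u : ι₀ → ℂ) (S : 𝔤), B.cartanPart S = 0 → ∀ z : ℂ,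
      B.anomaly τ ϖ (B.vec u) S z = 0) ∧
    -- at generic points the RLL relation determines the Poisson brackets
    (∀ (v u : ι₀ → ℂ) (S : 𝔤), B.IsRegular τ ϖ (B.vec u) → B.IsGeneric S →
      ∀ P : ι₀ ⊕ ι₀ ⊕ κ → ι₀ ⊕ ι₀ ⊕ κ → ℂ,
      (∀ z₁ z₂ : ℂ, z₁ ∉ TwistedCM.periods τ → z₂ ∉ TwistedCM.periods τ →
        z₁ - z₂ ∉ TwistedCM.periods τ →
        TwistedCM.pbracketTensor c T P (B.lax τ ϖ z₁) (B.lax τ ϖ z₂) (v, u, S) =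
          -TwistedCM.brL (B.lax τ ϖ z₁ (v, u, S)) (B.lax τ ϖ z₂ (v, u, S))
              (B.rMatrix τ ϖ (B.vec u) (z₁ - z₂)) -
            B.anomaly τ ϖ (B.vec u) S (z₁ - z₂)) →
      P = TwistedCM.poissonMatrix c T S) := by
  have hr0 : r ≠ 0 := by omega
  refine ⟨fun m _ u z => TwistedCM.AdaptedBasis.rComp_add_one m u z,
    fun u _ hu z₁ z₂ z₃ h12 h13 h23 => TwistedCM.eq_zero_of_pair3_eq_zero hT fun x y w =>
      TwistedCM.AdaptedBasis.pair3_yangBaxter hr0 hτ hc hu x y w h12 h13 h23,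
    fun v u S hu z₁ z₂ h1 h2 h12 =>
      TwistedCM.AdaptedBasis.rll_relation hT hr0 hτ hc hu S h1 h2 h12,
    fun u S hS z => ?_, fun v u S hu hS P hP => ?_⟩
  · rw [B.anomaly_eq, hS, TwistedCM.AdaptedBasis.dynTensor_zero]
  · refine TwistedCM.AdaptedBasis.poissonMatrix_unique hT hr0 hτ hc hu hS (v := v)
      fun z₁ z₂ h1 h2 h12 => ?_
    rw [hP z₁ z₂ h1 h2 h12, TwistedCM.AdaptedBasis.rll_relation hT hr0 hτ hc hu S h1 h2 h12]
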